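/- **The stent.** Let $\mathcal N=(\mathcal V,\mathcal E)$ be a finite connected oriented network in $\mathbb R^3$ with $n_{\mathcal V}$ vertices and $n_{\mathcal E}\ge 1$ edges. Each edge $i$ is a straight strut of length $\ell^i>0$ with constant unit tangent $t^i$, so that $\ell^i t^i$ is the difference of its end point and its starting point. Let $J_j^+$ and $J_j^-$ be the sets of edges that enter and leave the vertex $j$. Each strut carries a smooth rotation-valued frame $\mathbf R^i:[0,\ell^i]\to SO(3)$ with first column $t^i$ and a matrix $H^i=\mathrm{diag}(\mu^iK^i,E^iI^i_n,E^iI^i_b)$ with $\mu^i,K^i,E^i,I^i_n,I^i_b>0$. Assume that $$\sum_{i\in J_j^+}\alpha_i t^i-\sum_{i\in J_j^-}\alpha_i t^i=0\ \text{ for all vertices } j$$ with $\alpha_i\in\mathbb R$ implies $\alpha_i=0$ for all $i$. **The mixed problem** (for any network $\mathcal N$ of this kind). Put $L^2(\mathcal N)=\prod_i L^2(0,\ell^i;\mathbb R^3)$ and $L^2_{H^r}(\mathcal N)=\prod_i H^r(0,\ell^i;\mathbb R^3)$ (with $H^0=L^2$ and no continuity at the vertices), and $$V=L^2(\mathcal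 N)^2\times(\mathbb R^{3n_{\mathcal E}})^4\times\mathbb R^3\times\mathbb R^3,\qquad M=L^2_{H^1}(\mathcal N)^2\times(\mathbb R^{3n_{\mathcal V}})^2,$$ all with their Hilbert (root of sum of squares) norms. Write $\Sigma=(q,p,P_+,P_-,Q_+,Q_-,\alpha,\beta)$ and $\Gamma=(\xi,\theta,\dots)$ for elements of $V$, and $\varphi=(u,\omega,U,\Omega)$ and $\psi=(v,w,\mathsf V,\mathsf W)$ for elements of $M$. For $f\in L^2(\mathcal N)$ let $$a(\Sigma,\Gamma)=\sum_i\int_0^{\ell^i}\mathbf R^i(H^i)^{-1}(\mathbf R^i)^Tq^i\cdot\xi^i\,ds,\qquad F_f(\psi)=-\sum_i\int_0^{\ell^i}f^i\cdot v^i\,ds,$$ $$\begin{aligned}b(\Sigma,\psi)=&\sum_i\int_0^{\ell^i}\bigl(-p^i\cdot(\partial_sv^i+t^i\times w^i)-q^i\cdot\partial_sw^i\bigr)ds\\&+\sum_i\bigl(P^i_+\cdot v^i(\ell^i)-P^i_-\cdot v^i(0)+Q^i_+\cdot w^i(\ell^i)-Q^i_-\cdot w^i(0)\bigr)\\&-\sum_j\Bigl(\sum_{i\in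 J_j^+}P^i_+-\sum_{i\in J_j^-}P^i_-\Bigr)\cdot \mathsf V^j-\sum_j\Bigl(\sum_{i\in J_j^+}Q^i_+-\sum_{i\in J_j^-}Q^i_-\Bigr)\cdot \mathsf W^j\\&+\alpha\cdot\sum_i\int_0^{\ell^i}v^i\,ds+\beta\cdot\sum_i\int_0^{\ell^i}w^i\,ds.\end{aligned}$$ The continuous problem is to find $(\Sigma,\varphi)\in V\times M$ with $$a(\Sigma,\Gamma)+b(\Gamma,\varphi)=0\ \ (\Gamma\in V),\qquad b(\Sigma,\psi)=F_f(\psi)\ \ (\psi\in M).$$ Let $V_k\subset V$ consist of the elements for which $q,p$ are polynomials of degree at most $k$ on every edge, and $M_n\subset M$ of those for which $u,\omega$ are polynomials of degree at most $n$ on every edge. The discrete problem is the same one with $V_k,M_n$ in place of $V,M$. **Refinement.** A subdivision $\mathcal T$ of $\mathcal N$ is the network obtained by adding finitely many (possibly no) vertices in the interior of the struts, the geometry and the material being unchanged. Let $h$ be the maximal length of an edge of $\mathcal T$. **Theorem.** Let $n=k+1$ with $k\ge0$, let $r\ge0$ be an integer and let $\sigma\in\mathbb R$. There is a constant $c>0$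 depending only on $\mathcal N$ (with its geometry and material), $k$, $r$ and $\sigma$ such that the following holds for every subdivision $\mathcal T$ of $\mathcal N$ (in particular for $\mathcal T=\mathcal N$) in which any two edge lengths have ratio at most $\sigma$; if $k=0$, suppose also that the discrete problem on $\mathcal T$ has at most one solution. Let $f\in L^2_{H^r}(\mathcal T)$, let $(\Sigma,\varphi)\in V\times M$ be the solution of the continuous problem on $\mathcal T$ and $(\Sigma^h,\varphi^h)\in V_k\times M_n$ the solution of the discrete problem on $\mathcal T$. Then $$\|\Sigma-\Sigma^h\|_V+\|\varphi-\varphi^h\|_M\le c\,h^{\min\{r+1,k+1\}}\,\|f\|_{L^2_{H^r}(\mathcal T)}.$$ -/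

import Mathlib

open scoped ContDiff Matrix

noncomputable section

/-- Euclidean space `ℝ³`. -/
abbrev R3 : Type := EuclideanSpace ℝ (Fin 3)

/-- The vector product in `ℝ³`. -/
def cross (a b : R3) : R3 := WithLp.toLp 2 (crossProduct a.ofLp b.ofLp)

/-- A matrix acting on a vector of `ℝ³`. -/
def matVec (A : Matrix (Fin 3) (Fin 3) ℝ) (x : R3) : R3 := WithLp.toLp 2 (A *ᵥ x.ofLp)

/-! ### Sobolev functions on an interval -/

/-- Square integrability on `(0, ℓ)`. -/
def IsL2 (ℓ : ℝ) (u : ℝ → R3) : Prop :=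
  MeasureTheory.MemLp u 2 (MeasureTheory.volume.restrict (Set.Ioc 0 ℓ))

/-- `g` is the weak derivative of `u` on the open interval `(0, ℓ)`: integration by parts holds
against every smooth test function compactly supported in `(0, ℓ)`. -/
def HasWeakDeriv (ℓ : ℝ) (u g : ℝ → R3) : Prop :=
  ∀ η : ℝ → ℝ, ContDiff ℝ ∞ η → HasCompactSupport η → tsupport η ⊆ Set.Ioo 0 ℓ →
    ∫ s in (0 : ℝ)..ℓ, deriv η s • u s = - ∫ s in (0 : ℝ)..ℓ, η s • g s

/-- `u` is the continuous representative of an element of `H¹(0, ℓ; ℝ³)` and `du` is its weak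
derivative. The traces of the element are then the values `u 0` and `u ℓ`. -/
structure IsH1 (ℓ : ℝ) (u du : ℝ → R3) : Prop where
  cont : ContinuousOn u (Set.Icc 0 ℓ)
  deriv_mem : IsL2 ℓ du
  weak : HasWeakDeriv ℓ u du

/-- `u` belongs to `H^r(0, ℓ; ℝ³)` and `D 0 = u, D 1, …, D r` are its weak derivatives. -/
structure IsHr (ℓ : ℝ) (r : ℕ) (u : ℝ → R3) (D : ℕ → ℝ → R3) : Prop where
  zero : D 0 = u
  mem : ∀ j ≤ r, IsL2 ℓ (D j)
  weak : ∀ j < r, HasWeakDeriv ℓ (D j) (D (j + 1))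

/-- `u` is on `[0, ℓ]` a polynomial (with vector coefficients) of degree at most `m`. -/
def IsPolyOn (ℓ : ℝ) (m : ℕ) (u : ℝ → R3) : Prop :=
  ∀ a : Fin 3, ∃ P : Polynomial ℝ, P.natDegree ≤ m ∧ ∀ s ∈ Set.Icc 0 ℓ, u s a = P.eval s

/-! ### Networks of straight struts -/

/-- The data of a network of straight struts: vertices `V` placed in space, oriented edges `E`,
for every edge the local basis `[t, n, b]` along the strut (as the columns of a matrix depending
on the arc length), and the material and cross-section parameters of the strut. -/
structure StrutNetwork (V E : Type*) where
  /-- position of a vertex -/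
  pos : V → R3
  /-- the vertex that an edge leaves -/
  src : E → V
  /-- the vertex that an edge enters -/
  tgt : E → V
  /-- the local basis `[t, n, b]` at arc length `s` -/
  frame : E → ℝ → Matrix (Fin 3) (Fin 3) ℝ
  /-- shear modulus `μ` -/
  shear : E → ℝ
  /-- torsion constant `K` of the cross-section -/
  torsion : E → ℝ
  /-- Young modulus `E` -/
  young : E → ℝ
  /-- moment of inertia `I_n` of the cross-section -/
  inertiaN : E → ℝ
  /-- moment of inertia `I_b` of the cross-section -/
  inertiaB : E → ℝ

namespace StrutNetwork

variable {V E : Type*}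

/-- The length `ℓ` of a strut. -/
def len (N : StrutNetwork V E) (i : E) : ℝ := dist (N.pos (N.src i)) (N.pos (N.tgt i))

/-- The unit tangent `t` of a straight strut, so that `ℓ t` joins its end points. -/
def tangent (N : StrutNetwork V E) (i : E) : R3 :=
  (N.len i)⁻¹ • (N.pos (N.tgt i) - N.pos (N.src i))

/-- The diagonal matrix `H = diag(μ K, E I_n, E I_b)`. -/
def stiffness (N : StrutNetwork V E) (i : E) : Matrix (Fin 3) (Fin 3) ℝ :=
  Matrix.diagonal ![N.shear i * N.torsion i, N.young i * N.inertiaN i, N.young i * N.inertiaB i]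

/-- The compliance matrix `Q H⁻¹ Qᵀ` at arc length `s`. -/
def compliance (N : StrutNetwork V E) (i : E) (s : ℝ) : Matrix (Fin 3) (Fin 3) ℝ :=
  N.frame i s * (N.stiffness i)⁻¹ * (N.frame i s)ᵀ

/-- The standing assumptions on a stent with straight struts. -/
structure IsStent (N : StrutNetwork V E) : Prop where
  nonempty : Nonempty E
  connected : (SimpleGraph.fromRel fun a b => ∃ i, N.src i = a ∧ N.tgt i = b).Connected
  nondegenerate : ∀ i, N.pos (N.src i) ≠ N.pos (N.tgt i)
  frame_rotation : ∀ i, ∀ s ∈ Set.Icc 0 (N.len i),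
    N.frame i s ∈ Matrix.specialOrthogonalGroup (Fin 3) ℝ
  frame_tangent : ∀ i, ∀ s ∈ Set.Icc 0 (N.len i), ∀ a, N.frame i s a 0 = N.tangent i a
  frame_smooth : ∀ i a b, ContDiffOn ℝ ∞ (fun s => N.frame i s a b) (Set.Icc 0 (N.len i))
  shear_pos : ∀ i, 0 < N.shear i
  torsion_pos : ∀ i, 0 < N.torsion i
  young_pos : ∀ i, 0 < N.young i
  inertiaN_pos : ∀ i, 0 < N.inertiaN i
  inertiaB_pos : ∀ i, 0 < N.inertiaB i

open Classical in
/-- The action of the incidence matrices: the value of `A⁺ P₊ - A⁻ P₋` at the vertex `j`, i.e.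
the sum of `P₊` over the edges entering `j` minus the sum of `P₋` over the edges leaving `j`. -/
def balance [Fintype E] (N : StrutNetwork V E) (Pp Pm : E → R3) (j : V) : R3 :=
  (∑ i with N.tgt i = j, Pp i) - ∑ i with N.src i = j, Pm i

/-- The geometric assumption: axial forces `αᵢ tᵢ` in the (straight) struts that balance at
every vertex vanish. -/
def NoAxialSelfStress [Fintype E] (N : StrutNetwork V E) : Prop :=
  ∀ α : E → ℝ,
    (∀ j, N.balance (fun i => α i • N.tangent i) (fun i => α i • N.tangent i) j = 0) →
      ∀ i, α i = 0

/-- `h`, the maximal length of a strut. -/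
def maxLen (N : StrutNetwork V E) : ℝ := ⨆ i, N.len i

end StrutNetwork

/-! ### The unknowns -/

/-- A tuple `Σ = (q, p, P₊, P₋, Q₊, Q₋, α, β)`: contact moment, contact force, their values at the
ends of the struts, and the multipliers of the two mean value conditions. -/
structure ForceField (E : Type*) where
  q : E → ℝ → R3
  p : E → ℝ → R3
  Pp : E → R3
  Pm : E → R3
  Qp : E → R3
  Qm : E → R3
  α : R3
  β : R3

instance {E : Type*} : Sub (ForceField E) where
  sub S T :=
    { q := fun i s => S.q i s - T.q i s
      p := fun i s => S.p i s - T.p i s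
      Pp := fun i => S.Pp i - T.Pp i
      Pm := fun i => S.Pm i - T.Pm i
      Qp := fun i => S.Qp i - T.Qp i
      Qm := fun i => S.Qm i - T.Qm i
      α := S.α - T.α
      β := S.β - T.β }

/-- A tuple `φ = (u, w, U, W)`: displacement and infinitesimal rotation on the struts (together
with their weak derivatives `du`, `dw`) and at the vertices. -/
structure MotionField (V E : Type*) where
  u : E → ℝ → R3
  du : E → ℝ → R3
  w : E → ℝ → R3
  dw : E → ℝ → R3
  U : V → R3
  W : V → R3

instance {V E : Type*} : Sub (MotionField V E) where
  sub φ ψ :=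
    { u := fun i s => φ.u i s - ψ.u i s
      du := fun i s => φ.du i s - ψ.du i s
      w := fun i s => φ.w i s - ψ.w i s
      dw := fun i s => φ.dw i s - ψ.dw i s
      U := fun j => φ.U j - ψ.U j
      W := fun j => φ.W j - ψ.W j }

namespace StrutNetwork

variable {V E : Type*}

/-- Membership in `V = L² × L² × (ℝ^{3 n_E})⁴ × ℝ³ × ℝ³`. -/
structure MemV (N : StrutNetwork V E) (S : ForceField E) : Prop where
  q_mem : ∀ i, IsL2 (N.len i) (S.q i)
  p_mem : ∀ i, IsL2 (N.len i) (S.p i)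

/-- Membership in `M = L²_{H¹} × L²_{H¹} × ℝ^{3 n_V} × ℝ^{3 n_V}`. -/
structure MemM (N : StrutNetwork V E) (φ : MotionField V E) : Prop where
  u_mem : ∀ i, IsH1 (N.len i) (φ.u i) (φ.du i)
  w_mem : ∀ i, IsH1 (N.len i) (φ.w i) (φ.dw i)

/-- Membership in the finite element space `V_k`. -/
structure MemVh (N : StrutNetwork V E) (k : ℕ) (S : ForceField E) : Prop where
  mem : N.MemV S
  q_poly : ∀ i, IsPolyOn (N.len i) k (S.q i)
  p_poly : ∀ i, IsPolyOn (N.len i) k (S.p i)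

/-- Membership in the finite element space `M_n`. -/
structure MemMh (N : StrutNetwork V E) (n : ℕ) (φ : MotionField V E) : Prop where
  mem : N.MemM φ
  u_poly : ∀ i, IsPolyOn (N.len i) n (φ.u i)
  w_poly : ∀ i, IsPolyOn (N.len i) n (φ.w i)

/-- The norm of `V`. -/
def normV [Fintype E] (N : StrutNetwork V E) (S : ForceField E) : ℝ :=
  Real.sqrt
    ((∑ i, ∫ s in (0 : ℝ)..N.len i, ‖S.q i s‖ ^ 2) + (∑ i, ∫ s in (0 : ℝ)..N.len i, ‖S.p i s‖ ^ 2)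
      + (∑ i, (‖S.Pp i‖ ^ 2 + ‖S.Pm i‖ ^ 2 + ‖S.Qp i‖ ^ 2 + ‖S.Qm i‖ ^ 2))
      + ‖S.α‖ ^ 2 + ‖S.β‖ ^ 2)

/-- The norm of `M`. -/
def normM [Fintype V] [Fintype E] (N : StrutNetwork V E) (φ : MotionField V E) : ℝ :=
  Real.sqrt
    ((∑ i, ∫ s in (0 : ℝ)..N.len i, (‖φ.u i s‖ ^ 2 + ‖φ.du i s‖ ^ 2))
      + (∑ i, ∫ s in (0 : ℝ)..N.len i, (‖φ.w i s‖ ^ 2 + ‖φ.dw i s‖ ^ 2))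
      + ∑ j, (‖φ.U j‖ ^ 2 + ‖φ.W j‖ ^ 2))

/-- The load `f` belongs to `L²_{H^r}` and `D i j` is the `j`-th weak derivative of `f i`. -/
def IsLoad (N : StrutNetwork V E) (r : ℕ) (f : E → ℝ → R3) (D : E → ℕ → ℝ → R3) : Prop :=
  ∀ i, IsHr (N.len i) r (f i) (D i)

/-- The norm of `L²_{H^r}` of a function with the weak derivatives `D`. -/
def normHr [Fintype E] (N : StrutNetwork V E) (r : ℕ) (D : E → ℕ → ℝ → R3) : ℝ :=
  Real.sqrt (∑ i, ∑ j ∈ Finset.range (r + 1), ∫ s in (0 : ℝ)..N.len i, ‖D i j s‖ ^ 2)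

/-! ### The mixed problem and its discretization -/

/-- The bilinear form `a`. -/
def formA [Fintype E] (N : StrutNetwork V E) (S G : ForceField E) : ℝ :=
  ∑ i, ∫ s in (0 : ℝ)..N.len i, inner ℝ (matVec (N.compliance i s) (S.q i s)) (G.q i s)

/-- The bilinear form `b`. -/
def formB [Fintype V] [Fintype E] (N : StrutNetwork V E) (S : ForceField E)
    (ψ : MotionField V E) : ℝ :=
  (∑ i, ∫ s in (0 : ℝ)..N.len i,
      (- inner ℝ (S.p i s) (ψ.du i s + cross (N.tangent i) (ψ.w i s))
        - inner ℝ (S.q i s) (ψ.dw i s)))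
    + (∑ i, (inner ℝ (S.Pp i) (ψ.u i (N.len i)) - inner ℝ (S.Pm i) (ψ.u i 0)))
    + (∑ i, (inner ℝ (S.Qp i) (ψ.w i (N.len i)) - inner ℝ (S.Qm i) (ψ.w i 0)))
    - (∑ j, inner ℝ (N.balance S.Pp S.Pm j) (ψ.U j))
    - (∑ j, inner ℝ (N.balance S.Qp S.Qm j) (ψ.W j))
    + inner ℝ S.α (∑ i, ∫ s in (0 : ℝ)..N.len i, ψ.u i s)
    + inner ℝ S.β (∑ i, ∫ s in (0 : ℝ)..N.len i, ψ.w i s)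

/-- The linear functional given by the load `f`. -/
def formF [Fintype E] (N : StrutNetwork V E) (f : E → ℝ → R3) (ψ : MotionField V E) : ℝ :=
  - ∑ i, ∫ s in (0 : ℝ)..N.len i, inner ℝ (f i s) (ψ.u i s)

/-- `(S, φ) ∈ V × M` solves the mixed variational problem with the load `f`. -/
structure Solves [Fintype V] [Fintype E] (N : StrutNetwork V E) (f : E → ℝ → R3)
    (S : ForceField E) (φ : MotionField V E) : Prop where
  mem_V : N.MemV S
  mem_M : N.MemM φ
  eq_V : ∀ G, N.MemV G → N.formA S G + N.formB G φ = 0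
  eq_M : ∀ ψ, N.MemM ψ → N.formB S ψ = N.formF f ψ

/-- `(S, φ) ∈ V_k × M_n` solves the discrete mixed problem with the load `f`. -/
structure SolvesDiscrete [Fintype V] [Fintype E] (N : StrutNetwork V E) (k n : ℕ)
    (f : E → ℝ → R3) (S : ForceField E) (φ : MotionField V E) : Prop where
  mem_V : N.MemVh k S
  mem_M : N.MemMh n φ
  eq_V : ∀ G, N.MemVh k G → N.formA S G + N.formB G φ = 0
  eq_M : ∀ ψ, N.MemMh n ψ → N.formB S ψ = N.formF f ψ

/-- The discrete problem on `V_k × M_n` has at most one solution: without load there is only the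
zero solution. -/
def DiscreteUnique [Fintype V] [Fintype E] (N : StrutNetwork V E) (k n : ℕ) : Prop :=
  ∀ S φ, N.SolvesDiscrete k n 0 S φ → N.normV S = 0 ∧ N.normM φ = 0

/-! ### Refinement by additional vertices on the struts -/

/-- A subdivision of the struts: on the strut `i` there are `m i` additional vertices, and
`node i` lists the arc length parameters `0 = x₀ < x₁ < … < x_{m i + 1} = ℓ i` of all vertices. -/
structure Subdivision (N : StrutNetwork V E) where
  m : E → ℕ
  node : ∀ i, Fin (m i + 2) → ℝ
  mono : ∀ i, StrictMono (node i)
  first : ∀ i, node i 0 = 0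
  last : ∀ i, node i (Fin.last (m i + 1)) = N.len i

namespace Subdivision

variable {N : StrutNetwork V E}

/-- The network with the additional vertices. The geometry and the material are unchanged: the
element `⟨i, j⟩` is the part of the strut `i` between `x_j` and `x_{j+1}`, oriented like `i`. -/
def refine (T : N.Subdivision) :
    StrutNetwork (V ⊕ (Σ i, Fin (T.m i))) (Σ i, Fin (T.m i + 1)) where
  pos := Sum.elim N.pos
    fun v => N.pos (N.src v.1) + T.node v.1 v.2.succ.castSucc • N.tangent v.1
  src := fun e => Fin.cases (motive := fun _ => V ⊕ (Σ i, Fin (T.m i)))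
    (Sum.inl (N.src e.1)) (fun j => Sum.inr ⟨e.1, j⟩) e.2
  tgt := fun e => Fin.lastCases (motive := fun _ => V ⊕ (Σ i, Fin (T.m i)))
    (Sum.inl (N.tgt e.1)) (fun j => Sum.inr ⟨e.1, j⟩) e.2
  frame := fun e s => N.frame e.1 (T.node e.1 e.2.castSucc + s)
  shear := fun e => N.shear e.1
  torsion := fun e => N.torsion e.1
  young := fun e => N.young e.1
  inertiaN := fun e => N.inertiaN e.1
  inertiaB := fun e => N.inertiaB e.1

/-- The ratio of the lengths of any two elements is at most `σ`. -/
def QuasiUniform (T : N.Subdivision) (σ : ℝ) : Prop :=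
  ∀ e e', T.refine.len e ≤ σ * T.refine.len e'

end Subdivision

end StrutNetwork

end

noncomputable section

open MeasureTheory Set

/-! ### Linear algebra in `ℝ³` -/

/-! On each strut the mixed problem is a chain of ordinary differential equations: p' = -(f + α) for
the force, q' = p × t - β for the moment, ω' = C q for the rotation, with the compliance C, and u' =
-t × ω for the displacement. The struts are coupled only through nodal values, balances and mean
values. Since n = k + 1, the derivatives of the discrete motions are exactly the polynomials of
degree k, so the discrete problem gives the same equations up to L² projection on each element, and
errors can be studied element by element.

The norms contain the nodal forces, moments, displacements and rotations without a weight, and a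
subdivision has about 1/h of them. Let η be the size of the best polynomial approximation of p, q, C
q and ω. The core of the proof is that nodal errors are O(h η), which is better than the error η in
the interior. Quasi-uniformity bounds the number of elements by a multiple of 1/h, so the sum of the
squared nodal errors is still O(η²).

Stress. Rigid motions are discrete motions, so the multipliers of both problems agree. The nodal
differences of forces and moments then form a self-equilibrated stress κ of the original network: a
constant force and an affine moment on every strut, balanced at the vertices. These stresses form a
finite-dimensional space that does not depend on the subdivision (`exists_self_stress_error`).
Inside an element the moment error is the projection of the moment of κ, plus a term z of order h ε,
plus a remainder of order ε orthogonal to the polynomials of degree k, where ε is the local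
approximation error. The stress field of κ, projected or not, is annihilated by b in the discrete
and in the continuous problem (`formB_stressField`). Testing both problems with it bounds the
elastic energy of the projected κ by a multiple of h η ‖κ‖ (`element_energy_le`,
`exists_stress_estimate`).

Coercivity. The energy must control κ uniformly in the subdivision (`exists_stress_bound`). For k ≥
1 the moment of κ is not changed by the projection, and a stress without moments consists of axial
forces, which the geometric assumption excludes. For k = 0 only the mean moments of the elements are
seen. On a strut with an interior node they still control the slope of the moment, uniformly by
quasi-uniformity; on an undivided strut the slope is lost, and uniqueness of the discrete problem
replaces it. Only the set of divided struts matters, and there are finitely many such sets, so the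
constant is uniform.

Motion. The integrals of the errors of ω' and u' over an element gain a factor h, because the
remainder of the moment error has mean zero there. Summing the increments along struts and through
the connected graph, and fixing the free constant by the mean value conditions, gives the nodal
errors (`exists_nodal_bound`, `exists_motion_estimate`).

Approximation. A bound of the exact nodal forces and moments by the load, uniform in the subdivision
(`exists_stability`), follows from the same coercivity with k = 1. Taylor expansions with L²
remainder, passed through the chain of equations, then give η of order h^min(r+1, k+1)
(`exists_approximation`). -/

theorem inner_R3 (x y : R3) : inner ℝ x y = x 0 * y 0 + x 1 * y 1 + x 2 * y 2 := by
  simp [PiLp.inner_apply, Fin.sum_univ_three, mul_comm]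

@[simp] theorem cross_zero_coord (a b : R3) : cross a b 0 = a 1 * b 2 - a 2 * b 1 := by
  simp [cross, cross_apply]

@[simp] theorem cross_one_coord (a b : R3) : cross a b 1 = a 2 * b 0 - a 0 * b 2 := by
  simp [cross, cross_apply]

@[simp] theorem cross_two_coord (a b : R3) : cross a b 2 = a 0 * b 1 - a 1 * b 0 := by
  simp [cross, cross_apply]

theorem R3_ext {x y : R3} (h0 : x 0 = y 0) (h1 : x 1 = y 1) (h2 : x 2 = y 2) : x = y := by
  ext i; fin_cases i <;> assumption

theorem norm_sq_R3 (x : R3) : ‖x‖ ^ 2 = x 0 ^ 2 + x 1 ^ 2 + x 2 ^ 2 := by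
  simp [EuclideanSpace.norm_sq_eq, Fin.sum_univ_three]

theorem norm_cross_sq (a b : R3) : ‖cross a b‖ ^ 2 = ‖a‖ ^ 2 * ‖b‖ ^ 2 - inner ℝ a b ^ 2 := by
  simp only [norm_sq_R3, inner_R3, cross_zero_coord, cross_one_coord, cross_two_coord]
  ring

theorem norm_cross_le (a b : R3) : ‖cross a b‖ ≤ ‖a‖ * ‖b‖ := by
  apply le_of_sq_le_sq _ (by positivity)
  rw [norm_cross_sq, mul_pow]
  nlinarith [sq_nonneg (inner ℝ a b)]

/-- The scalar triple product moves `t ×` from the test rotation to the force; this produces the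
load p × t of the moment equation. -/
theorem inner_cross (p t w : R3) : inner ℝ p (cross t w) = inner ℝ (cross p t) w := by
  simp only [inner_R3, cross_zero_coord, cross_one_coord, cross_two_coord]
  ring

theorem cross_swap (a b : R3) : cross a b = - cross b a := by
  apply R3_ext <;> simp <;> ring

/-- The vector product with a fixed first factor as a continuous linear map. -/
def crossL (t : R3) : R3 →L[ℝ] R3 :=
  LinearMap.toContinuousLinearMap
    { toFun := fun x => cross t x
      map_add' := fun x y => by apply R3_ext <;> simp <;> ring
      map_smul' := fun c x => by apply R3_ext <;> simp <;> ring }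

@[simp] theorem crossL_apply (t x : R3) : crossL t x = cross t x := rfl

@[simp] theorem cross_zero' (t : R3) : cross t 0 = 0 := (crossL t).map_zero
@[simp] theorem zero_cross' (t : R3) : cross 0 t = 0 := by rw [cross_swap]; simp
theorem cross_add' (t x y : R3) : cross t (x + y) = cross t x + cross t y := (crossL t).map_add x y
theorem cross_sub' (t x y : R3) : cross t (x - y) = cross t x - cross t y := (crossL t).map_sub x y
theorem cross_smul' (t : R3) (c : ℝ) (x : R3) : cross t (c • x) = c • cross t x :=
  (crossL t).map_smul c x
theorem add_cross' (x y t : R3) : cross (x + y) t = cross x t + cross y t := by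
  rw [cross_swap, cross_add', cross_swap x, cross_swap y]; abel
theorem sub_cross' (x y t : R3) : cross (x - y) t = cross x t - cross y t := by
  rw [cross_swap, cross_sub', cross_swap x, cross_swap y]; abel
theorem smul_cross' (c : ℝ) (x t : R3) : cross (c • x) t = c • cross x t := by
  rw [cross_swap, cross_smul', cross_swap x, smul_neg]

/-- The vector product with a fixed second factor as a continuous linear map. -/
def crossR (t : R3) : R3 →L[ℝ] R3 := - crossL t

@[simp] theorem crossR_apply (t x : R3) : crossR t x = cross x t := by
  rw [cross_swap]; rfl

/-- If `‖t‖ = 1` and `d × t = 0` then `d` is parallel to `t`. -/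
theorem eq_smul_of_cross_eq_zero {d t : R3} (ht : ‖t‖ = 1) (h : cross d t = 0) :
    d = (inner ℝ d t) • t := by
  have h1 := norm_cross_sq d t
  have h2 : ‖d - (inner ℝ d t) • t‖ ^ 2 = 0 := by
    rw [norm_sub_sq_real, norm_smul, inner_smul_right, ht]
    rw [h, ht] at h1
    simp at h1 ⊢
    nlinarith
  have := pow_eq_zero_iff (two_ne_zero) |>.1 h2
  exact sub_eq_zero.1 (norm_eq_zero.1 this)

/-- A `3 × 3` matrix as a continuous linear map. -/
def matCLM (A : Matrix (Fin 3) (Fin 3) ℝ) : R3 →L[ℝ] R3 := Matrix.toEuclideanCLM (𝕜 := ℝ) A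

theorem matVec_eq (A : Matrix (Fin 3) (Fin 3) ℝ) (x : R3) : matVec A x = matCLM A x := by
  simp [matVec, matCLM, Matrix.toEuclideanCLM]
  rfl

/-! ### The `L²` norm on an interval -/

/-- The norm of `L²(0, ℓ; ℝ³)`. -/
def l2norm (ℓ : ℝ) (u : ℝ → R3) : ℝ := √(∫ s in (0 : ℝ)..ℓ, ‖u s‖ ^ 2)

theorem l2norm_nonneg (ℓ : ℝ) (u : ℝ → R3) : 0 ≤ l2norm ℓ u := Real.sqrt_nonneg _

section L2

variable {ℓ : ℝ} {u v : ℝ → R3}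

theorem integral_norm_sq_nonneg (hℓ : 0 ≤ ℓ) (u : ℝ → R3) : 0 ≤ ∫ s in (0 : ℝ)..ℓ, ‖u s‖ ^ 2 :=
  intervalIntegral.integral_nonneg hℓ fun _ _ => by positivity

theorem sq_l2norm (hℓ : 0 ≤ ℓ) (u : ℝ → R3) : l2norm ℓ u ^ 2 = ∫ s in (0 : ℝ)..ℓ, ‖u s‖ ^ 2 :=
  Real.sq_sqrt (integral_norm_sq_nonneg hℓ u)

theorem IsL2.memLp (hu : IsL2 ℓ u) : MemLp u 2 (volume.restrict (Ioc 0 ℓ)) := hu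

/-- The element of the Hilbert space `L²` given by a square integrable function. -/
def IsL2.toLp (hu : IsL2 ℓ u) : Lp R3 2 (volume.restrict (Ioc 0 ℓ)) := MemLp.toLp u hu.memLp

theorem IsL2.coeFn_toLp (hu : IsL2 ℓ u) : hu.toLp =ᵐ[volume.restrict (Ioc 0 ℓ)] u :=
  MemLp.coeFn_toLp hu.memLp

/-- Identification with the norm of a Hilbert space, from which Cauchy–Schwarz and the triangle
inequality are inherited. -/
theorem l2norm_eq_norm_toLp (hℓ : 0 ≤ ℓ) (hu : IsL2 ℓ u) :
    l2norm ℓ u = ‖hu.toLp‖ := by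
  rw [IsL2.toLp, Lp.norm_toLp, hu.memLp.eLpNorm_eq_integral_rpow_norm (by simp) (by simp), ENNReal.toReal_ofReal
    (by positivity), l2norm, intervalIntegral.integral_of_le hℓ, Real.sqrt_eq_rpow]
  norm_num

theorem integral_inner_eq (hℓ : 0 ≤ ℓ) (hu : IsL2 ℓ u) (hv : IsL2 ℓ v) :
    ∫ s in (0 : ℝ)..ℓ, inner ℝ (u s) (v s)
      = inner ℝ hu.toLp hv.toLp := by
  rw [L2.inner_def, intervalIntegral.integral_of_le hℓ]
  apply integral_congr_ae
  filter_upwards [hu.coeFn_toLp, hv.coeFn_toLp] with s h1 h2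
  rw [h1, h2]

theorem abs_integral_inner_le (hℓ : 0 ≤ ℓ) (hu : IsL2 ℓ u) (hv : IsL2 ℓ v) :
    |∫ s in (0 : ℝ)..ℓ, inner ℝ (u s) (v s)| ≤ l2norm ℓ u * l2norm ℓ v := by
  rw [integral_inner_eq hℓ hu hv, l2norm_eq_norm_toLp hℓ hu, l2norm_eq_norm_toLp hℓ hv]
  exact abs_real_inner_le_norm _ _

theorem IsL2.add (hu : IsL2 ℓ u) (hv : IsL2 ℓ v) : IsL2 ℓ (fun s => u s + v s) := MemLp.add hu hv
theorem IsL2.sub (hu : IsL2 ℓ u) (hv : IsL2 ℓ v) : IsL2 ℓ (fun s => u s - v s) := MemLp.sub hu hv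
theorem IsL2.neg (hu : IsL2 ℓ u) : IsL2 ℓ (fun s => - u s) := MemLp.neg hu
theorem isL2_const (c : R3) : IsL2 ℓ (fun _ => c) := memLp_const c
theorem IsL2.clm (L : R3 →L[ℝ] R3) (hu : IsL2 ℓ u) : IsL2 ℓ (fun s => L (u s)) := L.comp_memLp' hu

theorem IsL2.intervalIntegrable (hℓ : 0 ≤ ℓ) (hu : IsL2 ℓ u) :
    IntervalIntegrable u volume 0 ℓ := by
  rw [intervalIntegrable_iff_integrableOn_Ioc_of_le hℓ]
  exact MemLp.integrable (by norm_num) hu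

theorem IsL2.intervalIntegrable_inner (hℓ : 0 ≤ ℓ) (hu : IsL2 ℓ u) (hv : IsL2 ℓ v) :
    IntervalIntegrable (fun s => inner ℝ (u s) (v s)) volume 0 ℓ := by
  rw [intervalIntegrable_iff_integrableOn_Ioc_of_le hℓ]
  have := L2.integrable_inner (𝕜 := ℝ) hu.toLp hv.toLp
  refine this.congr ?_
  filter_upwards [hu.coeFn_toLp, hv.coeFn_toLp] with s h1 h2
  rw [h1, h2]

theorem IsL2.intervalIntegrable_sq (hℓ : 0 ≤ ℓ) (hu : IsL2 ℓ u) :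
    IntervalIntegrable (fun s => ‖u s‖ ^ 2) volume 0 ℓ := by
  simpa using hu.intervalIntegrable_inner hℓ hu

theorem l2norm_add_le (hℓ : 0 ≤ ℓ) (hu : IsL2 ℓ u) (hv : IsL2 ℓ v) :
    l2norm ℓ (fun s => u s + v s) ≤ l2norm ℓ u + l2norm ℓ v := by
  rw [l2norm_eq_norm_toLp hℓ (hu.add hv), l2norm_eq_norm_toLp hℓ hu, l2norm_eq_norm_toLp hℓ hv]
  exact norm_add_le hu.toLp hv.toLp

theorem l2norm_neg (u : ℝ → R3) : l2norm ℓ (fun s => - u s) = l2norm ℓ u := by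
  simp [l2norm]

theorem l2norm_sub_le (hℓ : 0 ≤ ℓ) (hu : IsL2 ℓ u) (hv : IsL2 ℓ v) :
    l2norm ℓ (fun s => u s - v s) ≤ l2norm ℓ u + l2norm ℓ v := by
  simpa only [sub_eq_add_neg, l2norm_neg] using l2norm_add_le hℓ hu hv.neg

theorem l2norm_mono_ae (hℓ : 0 ≤ ℓ) {c : ℝ} (hc : 0 ≤ c) (hv : IsL2 ℓ v)
    (h : ∀ᵐ s ∂volume.restrict (Ioc 0 ℓ), ‖u s‖ ≤ c * ‖v s‖) :
    l2norm ℓ u ≤ c * l2norm ℓ v := by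
  rw [l2norm, l2norm, ← Real.sqrt_sq hc, ← Real.sqrt_mul (sq_nonneg c)]
  apply Real.sqrt_le_sqrt
  rw [← intervalIntegral.integral_const_mul, intervalIntegral.integral_of_le hℓ,
    intervalIntegral.integral_of_le hℓ]
  apply integral_mono_of_nonneg
  · exact Filter.Eventually.of_forall fun s => by positivity
  · exact ((hv.intervalIntegrable_sq hℓ).1.const_mul (c ^ 2))
  · filter_upwards [h] with s hs
    rw [← mul_pow]
    gcongr

theorem l2norm_congr_ae (hℓ : 0 ≤ ℓ) (h : ∀ᵐ s ∂volume.restrict (Ioc 0 ℓ), u s = v s) :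
    l2norm ℓ u = l2norm ℓ v := by
  rw [l2norm, l2norm, intervalIntegral.integral_of_le hℓ, intervalIntegral.integral_of_le hℓ]
  congr 1
  apply integral_congr_ae
  filter_upwards [h] with s hs
  rw [hs]

theorem ae_of_forall_Ioc {P : ℝ → Prop} (h : ∀ s ∈ Ioc 0 ℓ, P s) :
    ∀ᵐ s ∂volume.restrict (Ioc 0 ℓ), P s :=
  (ae_restrict_iff' measurableSet_Ioc).2 (Filter.Eventually.of_forall h)

theorem integral_congr_Ioc {X : Type*} [NormedAddCommGroup X] [NormedSpace ℝ X] {f g : ℝ → X}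
    (hℓ : 0 ≤ ℓ) (h : ∀ᵐ s ∂volume.restrict (Ioc 0 ℓ), f s = g s) :
    ∫ s in (0 : ℝ)..ℓ, f s = ∫ s in (0 : ℝ)..ℓ, g s := by
  rw [intervalIntegral.integral_of_le hℓ, intervalIntegral.integral_of_le hℓ]
  exact integral_congr_ae h

theorem IsL2.congr_ae (hu : IsL2 ℓ u) (h : ∀ᵐ s ∂volume.restrict (Ioc 0 ℓ), u s = v s) :
    IsL2 ℓ v := (memLp_congr_ae h).1 hu

theorem l2norm_const (hℓ : 0 ≤ ℓ) (c : R3) : l2norm ℓ (fun _ => c) = √ℓ * ‖c‖ := by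
  simp [l2norm, Real.sqrt_mul hℓ, Real.sqrt_sq (norm_nonneg c)]

theorem l2norm_le_of_bound (hℓ : 0 ≤ ℓ) {M : ℝ} (hM : 0 ≤ M) (h : ∀ s ∈ Ioc 0 ℓ, ‖u s‖ ≤ M) :
    l2norm ℓ u ≤ √ℓ * M := by
  have h1 : l2norm ℓ u ≤ M * l2norm ℓ (fun _ => EuclideanSpace.single (0 : Fin 3) (1 : ℝ)) := by
    apply l2norm_mono_ae hℓ hM (isL2_const _)
    apply ae_of_forall_Ioc
    intro s hs
    simpa using h s hs
  rw [l2norm_const hℓ] at h1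
  simpa [mul_comm] using h1

theorem isL2_of_continuousOn (h : ContinuousOn u (Icc 0 ℓ)) : IsL2 ℓ u := by
  obtain ⟨C, hC⟩ := isCompact_Icc.exists_bound_of_continuousOn h
  refine MemLp.of_bound ((h.mono Ioc_subset_Icc_self).aestronglyMeasurable measurableSet_Ioc) C ?_
  exact ae_of_forall_Ioc fun s hs => hC s (Ioc_subset_Icc_self hs)

theorem isL2_clm_apply {C : ℝ → R3 →L[ℝ] R3} (hC : ContinuousOn C (Icc 0 ℓ)) (hu : IsL2 ℓ u) :
    IsL2 ℓ (fun s => C s (u s)) := by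
  obtain ⟨M, hM⟩ := isCompact_Icc.exists_bound_of_continuousOn hC
  refine MemLp.of_le_mul (c := M) hu ?_ ?_
  · have h1 : AEStronglyMeasurable C (volume.restrict (Ioc 0 ℓ)) :=
      (hC.mono Ioc_subset_Icc_self).aestronglyMeasurable measurableSet_Ioc
    exact (isBoundedBilinearMap_apply.continuous.comp_aestronglyMeasurable
      (h1.prodMk hu.aestronglyMeasurable))
  · apply ae_of_forall_Ioc
    intro s hs
    exact ((C s).le_opNorm _).trans (by gcongr; exact hM s (Ioc_subset_Icc_self hs))

theorem l2norm_clm_apply_le {C : ℝ → R3 →L[ℝ] R3} {M : ℝ} (hℓ : 0 ≤ ℓ) (hM : 0 ≤ M)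
    (hC : ∀ s ∈ Icc 0 ℓ, ‖C s‖ ≤ M) (hu : IsL2 ℓ u) :
    l2norm ℓ (fun s => C s (u s)) ≤ M * l2norm ℓ u := by
  apply l2norm_mono_ae hℓ hM hu
  apply ae_of_forall_Ioc
  intro s hs
  exact ((C s).le_opNorm _).trans (by gcongr; exact hC s (Ioc_subset_Icc_self hs))

/-- Cauchy–Schwarz against a constant; a fixed unit vector turns the scalar function ‖u‖ into a
field to which the vector-valued inequality applies. -/
theorem integral_norm_le_l2norm (hℓ : 0 ≤ ℓ) (hu : IsL2 ℓ u) :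
    ∫ s in (0 : ℝ)..ℓ, ‖u s‖ ≤ √ℓ * l2norm ℓ u := by
  have hv : IsL2 ℓ (fun s => ‖u s‖ • EuclideanSpace.single (0 : Fin 3) (1 : ℝ)) := by
    refine MemLp.of_le hu ?_ ?_
    · exact hu.aestronglyMeasurable.norm.smul_const _
    · exact Filter.Eventually.of_forall fun s => by simp [norm_smul]
  have h := abs_integral_inner_le hℓ
    (isL2_const (ℓ := ℓ) (EuclideanSpace.single (0 : Fin 3) (1 : ℝ))) hv
  rw [l2norm_const hℓ] at h
  have h2 : l2norm ℓ (fun s => ‖u s‖ • EuclideanSpace.single (0 : Fin 3) (1 : ℝ)) = l2norm ℓ u := by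
    simp [l2norm, norm_smul]
  rw [h2] at h
  simp [inner_smul_right] at h
  exact (le_abs_self _).trans h

theorem norm_integral_le_l2norm (hℓ : 0 ≤ ℓ) (hu : IsL2 ℓ u) {s : ℝ} (hs : s ∈ Icc 0 ℓ) :
    ‖∫ τ in (0 : ℝ)..s, u τ‖ ≤ √ℓ * l2norm ℓ u := by
  refine le_trans ?_ (integral_norm_le_l2norm hℓ hu)
  refine (intervalIntegral.norm_integral_le_integral_norm hs.1).trans ?_
  exact intervalIntegral.integral_mono_interval le_rfl hs.1 hs.2
    (Filter.Eventually.of_forall fun _ => norm_nonneg _) (hu.intervalIntegrable hℓ).norm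

theorem continuousOn_integral (hℓ : 0 ≤ ℓ) (hu : IsL2 ℓ u) :
    ContinuousOn (fun s => ∫ τ in (0 : ℝ)..s, u τ) (Icc 0 ℓ) := by
  have := intervalIntegral.continuousOn_primitive_interval
    ((intervalIntegrable_iff_integrableOn_Icc_of_le hℓ).1 (hu.intervalIntegrable hℓ) |>.congr_set_ae
      (by rw [uIcc_of_le hℓ]; exact Filter.EventuallyEq.rfl))
  rwa [uIcc_of_le hℓ] at this

/-- Integration over an element gains a factor ℓ. It raises the order of Taylor expansions and makes
the term z of the moment error small. -/
theorem l2norm_integral_le (hℓ : 0 ≤ ℓ) (hu : IsL2 ℓ u) :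
    l2norm ℓ (fun s => ∫ τ in (0 : ℝ)..s, u τ) ≤ ℓ * l2norm ℓ u := by
  have := l2norm_le_of_bound hℓ (mul_nonneg (Real.sqrt_nonneg _) (l2norm_nonneg _ _))
    fun s hs => norm_integral_le_l2norm hℓ hu (Ioc_subset_Icc_self hs)
  rwa [← mul_assoc, Real.mul_self_sqrt hℓ] at this

theorem integral_clm (hℓ : 0 ≤ ℓ) (L : R3 →L[ℝ] R3) (hu : IsL2 ℓ u) {s : ℝ} (hs : s ∈ Icc 0 ℓ) :
    ∫ τ in (0 : ℝ)..s, L (u τ) = L (∫ τ in (0 : ℝ)..s, u τ) := by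
  apply L.intervalIntegral_comp_comm
  apply (hu.intervalIntegrable hℓ).mono_set
  rw [uIcc_of_le hs.1, uIcc_of_le hℓ]
  exact Icc_subset_Icc_right hs.2

theorem integral_inner_const (hℓ : 0 ≤ ℓ) (hu : IsL2 ℓ u) (c : R3) :
    ∫ s in (0 : ℝ)..ℓ, inner ℝ (u s) c = inner ℝ (∫ s in (0 : ℝ)..ℓ, u s) c := by
  have := ((innerSL ℝ c).intervalIntegral_comp_comm (hu.intervalIntegrable hℓ))
  simp only [innerSL_apply_apply] at this
  simpa [real_inner_comm] using this

theorem integral_const_inner (hℓ : 0 ≤ ℓ) (hu : IsL2 ℓ u) (c : R3) :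
    ∫ s in (0 : ℝ)..ℓ, inner ℝ c (u s) = inner ℝ c (∫ s in (0 : ℝ)..ℓ, u s) := by
  rw [real_inner_comm, ← integral_inner_const hℓ hu]
  simp only [real_inner_comm]

theorem ae_eq_zero_of_l2norm_eq_zero (hℓ : 0 ≤ ℓ) (hu : IsL2 ℓ u)
    (h : ∫ s in (0 : ℝ)..ℓ, inner ℝ (u s) (u s) = 0) :
    ∀ᵐ s ∂volume.restrict (Ioc 0 ℓ), u s = 0 := by
  rw [integral_inner_eq hℓ hu hu, inner_self_eq_zero] at h
  filter_upwards [hu.coeFn_toLp, Lp.eq_zero_iff_ae_eq_zero.1 h] with s h1 h2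
  rw [← h1, h2]; rfl

end L2

/-! ### Primitives of square integrable functions -/

/-- On `[0, ℓ]` the function `Y` is a primitive of the square integrable function `y`. -/
structure IsPrim (ℓ : ℝ) (Y y : ℝ → R3) : Prop where
  mem : IsL2 ℓ y
  eq : ∀ s ∈ Icc 0 ℓ, Y s = Y 0 + ∫ τ in (0 : ℝ)..s, y τ

/-- The product rule for absolutely continuous functions, whose derivatives are almost everywhere
the integrands. -/
theorem integral_mul_primitive {ℓ : ℝ} {y z : ℝ → ℝ} (hy : IntervalIntegrable y volume 0 ℓ)
    (hz : IntervalIntegrable z volume 0 ℓ) (a b : ℝ) :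
    ∫ s in (0 : ℝ)..ℓ, (y s * (b + ∫ τ in (0 : ℝ)..s, z τ) + (a + ∫ τ in (0 : ℝ)..s, y τ) * z s)
      = (a + ∫ τ in (0 : ℝ)..ℓ, y τ) * (b + ∫ τ in (0 : ℝ)..ℓ, z τ) - a * b := by
  have hY := hy.absolutelyContinuousOnInterval_intervalIntegral (c := 0) (by simp)
  have hZ := hz.absolutelyContinuousOnInterval_intervalIntegral (c := 0) (by simp)
  have hcst : ∀ c : ℝ, AbsolutelyContinuousOnInterval (fun _ : ℝ => c) 0 ℓ := fun c =>
    (contDiffOn_const (n := 1)).absolutelyContinuousOnInterval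
  have h := ((hcst a).add hY).integral_deriv_mul_eq_sub ((hcst b).add hZ)
  simp only [Pi.add_apply, intervalIntegral.integral_same, add_zero] at h
  rw [← h]
  apply intervalIntegral.integral_congr_ae
  filter_upwards [hy.ae_hasDerivAt_integral, hz.ae_hasDerivAt_integral] with s h1 h2 hs
  have hs' := uIoc_subset_uIcc hs
  have e1 : deriv ((fun _ => a) + fun x => ∫ τ in (0 : ℝ)..x, y τ) s = y s :=
    ((h1 hs' 0 (by simp)).const_add a).deriv
  have e2 : deriv ((fun _ => b) + fun x => ∫ τ in (0 : ℝ)..x, z τ) s = z s :=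
    ((h2 hs' 0 (by simp)).const_add b).deriv
  rw [e1, e2]

section

variable {ℓ : ℝ} {Y y Z z : ℝ → R3}

theorem isPrim_integral (c : R3) (hy : IsL2 ℓ y) :
    IsPrim ℓ (fun s => c + ∫ τ in (0 : ℝ)..s, y τ) y := ⟨hy, fun s _ => by simp⟩

theorem IsPrim.continuousOn (hℓ : 0 ≤ ℓ) (h : IsPrim ℓ Y y) : ContinuousOn Y (Icc 0 ℓ) :=
  (continuousOn_const.add (continuousOn_integral hℓ h.mem)).congr h.eq

theorem IsPrim.isL2 (hℓ : 0 ≤ ℓ) (h : IsPrim ℓ Y y) : IsL2 ℓ Y :=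
  isL2_of_continuousOn (h.continuousOn hℓ)

theorem IsPrim.add (hℓ : 0 ≤ ℓ) (hY : IsPrim ℓ Y y) (hZ : IsPrim ℓ Z z) :
    IsPrim ℓ (fun s => Y s + Z s) (fun s => y s + z s) := by
  refine ⟨hY.mem.add hZ.mem, fun s hs => ?_⟩
  have hsub : uIcc 0 s ⊆ uIcc 0 ℓ := by
    rw [uIcc_of_le hs.1, uIcc_of_le hℓ]; exact Icc_subset_Icc_right hs.2
  rw [intervalIntegral.integral_add ((hY.mem.intervalIntegrable hℓ).mono_set hsub)
    ((hZ.mem.intervalIntegrable hℓ).mono_set hsub), hY.eq s hs, hZ.eq s hs]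
  abel

theorem IsPrim.clm (hℓ : 0 ≤ ℓ) (L : R3 →L[ℝ] R3) (hY : IsPrim ℓ Y y) :
    IsPrim ℓ (fun s => L (Y s)) (fun s => L (y s)) := by
  refine ⟨hY.mem.clm L, fun s hs => ?_⟩
  rw [integral_clm hℓ L hY.mem hs, hY.eq s hs, map_add]

theorem IsPrim.neg (hℓ : 0 ≤ ℓ) (hY : IsPrim ℓ Y y) :
    IsPrim ℓ (fun s => - Y s) (fun s => - y s) := by
  simpa using hY.clm hℓ (-ContinuousLinearMap.id ℝ R3)

theorem IsPrim.sub (hℓ : 0 ≤ ℓ) (hY : IsPrim ℓ Y y) (hZ : IsPrim ℓ Z z) :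
    IsPrim ℓ (fun s => Y s - Z s) (fun s => y s - z s) := by
  simpa only [sub_eq_add_neg] using hY.add hℓ (hZ.neg hℓ)

theorem IsPrim.congr_ae (h : IsPrim ℓ Y y) (hyz : ∀ᵐ s ∂volume.restrict (Ioc 0 ℓ), y s = z s) :
    IsPrim ℓ Y z := by
  refine ⟨h.mem.congr_ae hyz, fun s hs => ?_⟩
  rw [h.eq s hs]
  congr 1
  exact integral_congr_Ioc hs.1 (ae_restrict_of_ae_restrict_of_subset
    (Ioc_subset_Ioc_right hs.2) hyz)

theorem IsPrim.congr (hℓ : 0 ≤ ℓ) (h : IsPrim ℓ Y y) (hYZ : ∀ s ∈ Icc 0 ℓ, Y s = Z s) :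
    IsPrim ℓ Z y := by
  refine ⟨h.mem, fun s hs => ?_⟩
  rw [← hYZ s hs, ← hYZ 0 ⟨le_rfl, hℓ⟩, h.eq s hs]

theorem IsPrim.of_hasDerivAt (h : ∀ s ∈ Icc 0 ℓ, HasDerivAt Y (y s) s)
    (hy : ContinuousOn y (Icc 0 ℓ)) : IsPrim ℓ Y y := by
  refine ⟨isL2_of_continuousOn hy, fun s hs => ?_⟩
  have hsub : uIcc 0 s ⊆ Icc 0 ℓ := by
    rw [uIcc_of_le hs.1]; exact Icc_subset_Icc_right hs.2
  rw [intervalIntegral.integral_eq_sub_of_hasDerivAt (fun x hx => h x (hsub hx))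
    ((hy.mono hsub).intervalIntegrable)]
  abel

theorem coord_integral (hℓ : 0 ≤ ℓ) (hy : IsL2 ℓ y) {s : ℝ} (hs : s ∈ Icc 0 ℓ) (a : Fin 3) :
    (∫ τ in (0 : ℝ)..s, y τ) a = ∫ τ in (0 : ℝ)..s, y τ a := by
  symm
  apply (EuclideanSpace.proj a : R3 →L[ℝ] ℝ).intervalIntegral_comp_comm
  apply (hy.intervalIntegrable hℓ).mono_set
  rw [uIcc_of_le hs.1, uIcc_of_le hℓ]
  exact Icc_subset_Icc_right hs.2

theorem coord_intervalIntegrable (hℓ : 0 ≤ ℓ) (hy : IsL2 ℓ y) (a : Fin 3) :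
    IntervalIntegrable (fun s => y s a) volume 0 ℓ := by
  rw [intervalIntegrable_iff_integrableOn_Ioc_of_le hℓ]
  exact (EuclideanSpace.proj a : R3 →L[ℝ] ℝ).integrable_comp (hy.intervalIntegrable hℓ).1

/-- Integration by parts. -/
theorem IsPrim.integral_inner (hℓ : 0 ≤ ℓ) (hY : IsPrim ℓ Y y) (hZ : IsPrim ℓ Z z) :
    ∫ s in (0 : ℝ)..ℓ, inner ℝ (Y s) (z s)
      = inner ℝ (Y ℓ) (Z ℓ) - inner ℝ (Y 0) (Z 0) - ∫ s in (0 : ℝ)..ℓ, inner ℝ (y s) (Z s) := by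
  have hcoord : ∀ a : Fin 3, ∫ s in (0 : ℝ)..ℓ, (y s a * Z s a + Y s a * z s a)
      = Y ℓ a * Z ℓ a - Y 0 a * Z 0 a := by
    intro a
    have h := integral_mul_primitive (coord_intervalIntegrable hℓ hY.mem a)
      (coord_intervalIntegrable hℓ hZ.mem a) (Y 0 a) (Z 0 a)
    have e1 : ∀ s ∈ Icc 0 ℓ, Y s a = Y 0 a + ∫ τ in (0 : ℝ)..s, y τ a := fun s hs => by
      rw [← coord_integral hℓ hY.mem hs, ← PiLp.add_apply, ← hY.eq s hs]
    have e2 : ∀ s ∈ Icc 0 ℓ, Z s a = Z 0 a + ∫ τ in (0 : ℝ)..s, z τ a := fun s hs => by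
      rw [← coord_integral hℓ hZ.mem hs, ← PiLp.add_apply, ← hZ.eq s hs]
    rw [← e1 ℓ ⟨hℓ, le_rfl⟩, ← e2 ℓ ⟨hℓ, le_rfl⟩] at h
    rw [← h]
    apply integral_congr_Ioc hℓ
    apply ae_of_forall_Ioc
    intro s hs
    rw [e1 s (Ioc_subset_Icc_self hs), e2 s (Ioc_subset_Icc_self hs)]
  have hint : ∀ a : Fin 3,
      IntervalIntegrable (fun s => y s a * Z s a + Y s a * z s a) volume 0 ℓ := by
    intro a
    have cc : ∀ {X : ℝ → R3}, ContinuousOn X (Icc 0 ℓ) →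
        ContinuousOn (fun s => X s a) (uIcc 0 ℓ) := fun hX => by
      rw [uIcc_of_le hℓ]
      exact (EuclideanSpace.proj a : R3 →L[ℝ] ℝ).continuous.comp_continuousOn hX
    exact ((coord_intervalIntegrable hℓ hY.mem a).mul_continuousOn
        (cc (hZ.continuousOn hℓ))).add
      ((coord_intervalIntegrable hℓ hZ.mem a).continuousOn_mul (cc (hY.continuousOn hℓ)))
  rw [eq_sub_iff_add_eq, ← intervalIntegral.integral_add
    ((hY.isL2 hℓ).intervalIntegrable_inner hℓ hZ.mem)
    (hY.mem.intervalIntegrable_inner hℓ (hZ.isL2 hℓ))]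
  have : ∀ s, inner ℝ (Y s) (z s) + inner ℝ (y s) (Z s) = (y s 0 * Z s 0 + Y s 0 * z s 0)
      + (y s 1 * Z s 1 + Y s 1 * z s 1) + (y s 2 * Z s 2 + Y s 2 * z s 2) := fun s => by
    simp only [inner_R3]; ring
  simp only [this]
  rw [intervalIntegral.integral_add ((hint 0).add (hint 1)) (hint 2),
    intervalIntegral.integral_add (hint 0) (hint 1), hcoord, hcoord, hcoord]
  simp only [inner_R3]; ring

theorem isPrim_test {η : ℝ → ℝ} (hη : ContDiff ℝ ∞ η) (c : R3) :
    IsPrim ℓ (fun s => η s • c) (fun s => deriv η s • c) := by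
  apply IsPrim.of_hasDerivAt
  · intro s _
    exact ((hη.differentiable (by simp)).differentiableAt.hasDerivAt).smul_const c
  · exact ((hη.continuous_deriv (by simp)).smul continuous_const).continuousOn

/-- Integration by parts against the test function; no boundary terms appear because its support
lies in the open interval. -/
theorem IsPrim.hasWeakDeriv (hℓ : 0 ≤ ℓ) (h : IsPrim ℓ Y y) : HasWeakDeriv ℓ Y y := by
  intro η hη _ hsupp
  have hz : ∀ s, s ∉ Ioo 0 ℓ → η s = 0 := fun s hs => by
    by_contra hne
    exact hs (hsupp (subset_tsupport η hne))
  refine ext_inner_right ℝ fun c => ?_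
  have hb : ∃ M, ∀ s ∈ Icc 0 ℓ, ‖η s‖ ≤ M := isCompact_Icc.exists_bound_of_continuousOn
    hη.continuous.continuousOn
  have h1 : IsL2 ℓ (fun s => deriv η s • Y s) := isL2_of_continuousOn
    ((hη.continuous_deriv (by simp)).continuousOn.smul (h.continuousOn hℓ))
  have h2 : IsL2 ℓ (fun s => η s • y s) := by
    have := isL2_clm_apply (C := fun s => η s • ContinuousLinearMap.id ℝ R3) (ℓ := ℓ)
      (hη.continuous.smul continuous_const).continuousOn h.mem
    simpa using this
  rw [inner_neg_left, ← integral_inner_const hℓ h1, ← integral_inner_const hℓ h2]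
  have := h.integral_inner hℓ (isPrim_test hη c)
  rw [hz 0 (by simp), hz ℓ (by simp)] at this
  simpa [inner_smul_left, inner_smul_right] using this

theorem IsPrim.isH1 (hℓ : 0 ≤ ℓ) (h : IsPrim ℓ Y y) : IsH1 ℓ Y y :=
  ⟨h.continuousOn hℓ, h.mem, h.hasWeakDeriv hℓ⟩

theorem ae_eq_zero_of_test (hℓ : 0 ≤ ℓ) (hy : IsL2 ℓ y)
    (h : ∀ η : ℝ → ℝ, ContDiff ℝ ∞ η → HasCompactSupport η → tsupport η ⊆ Ioo 0 ℓ →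
      ∫ s in (0 : ℝ)..ℓ, η s • y s = 0) :
    ∀ᵐ s ∂volume.restrict (Ioc 0 ℓ), y s = 0 := by
  have hi : IntegrableOn y (Ioo 0 ℓ) := (hy.intervalIntegrable hℓ).1.mono_set Ioo_subset_Ioc_self
  have := isOpen_Ioo.ae_eq_zero_of_integral_contDiff_smul_eq_zero hi.locallyIntegrableOn
    (fun η h1 h2 h3 => by
      rw [← intervalIntegral.integral_eq_integral_of_support_subset]
      · exact h η h1 h2 h3
      · exact (Function.support_smul_subset_left _ _).trans
          ((subset_tsupport η).trans (h3.trans Ioo_subset_Ioc_self)))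
  rw [← restrict_Ioo_eq_restrict_Ioc]
  exact (ae_restrict_iff' measurableSet_Ioo).2 this

/-- The primitive from 0 vanishes to the left of the support in any case; the vanishing mean makes
it vanish to the right as well. -/
theorem exists_test_primitive {ζ : ℝ → ℝ} (hζ : ContDiff ℝ ∞ ζ) (hc : HasCompactSupport ζ)
    (hsupp : tsupport ζ ⊆ Ioo 0 ℓ) (h0 : ∫ s in (0 : ℝ)..ℓ, ζ s = 0) :
    ∃ η : ℝ → ℝ, ContDiff ℝ ∞ η ∧ HasCompactSupport η ∧ tsupport η ⊆ Ioo 0 ℓ ∧ deriv η = ζ := by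
  have hderiv : ∀ s, HasDerivAt (fun s => ∫ τ in (0 : ℝ)..s, ζ τ) (ζ s) s := fun s =>
    hζ.continuous.integral_hasStrictDerivAt 0 s |>.hasDerivAt
  have hd : deriv (fun s => ∫ τ in (0 : ℝ)..s, ζ τ) = ζ := funext fun s => (hderiv s).deriv
  rcases (tsupport ζ).eq_empty_or_nonempty with he | hne
  · refine ⟨0, contDiff_const, HasCompactSupport.zero, by simp, ?_⟩
    rw [tsupport_eq_empty_iff.1 he]
    ext s; simp
  obtain ⟨a, ha, hamin⟩ := hc.isCompact.exists_isLeast hne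
  obtain ⟨b, hb, hbmax⟩ := hc.isCompact.exists_isGreatest hne
  have hz : ∀ s, s ∉ Icc a b → ζ s = 0 := fun s hs => by
    by_contra hns
    exact hs ⟨hamin (subset_tsupport ζ hns), hbmax (subset_tsupport ζ hns)⟩
  have hsub : tsupport (fun s => ∫ τ in (0 : ℝ)..s, ζ τ) ⊆ Icc a b := by
    apply closure_minimal _ isClosed_Icc
    intro s hs
    by_contra hns
    apply hs
    rw [mem_Icc, not_and_or, not_le, not_le] at hns
    have ha' := hsupp ha
    have hb' := hsupp hb
    rcases hns with h | h
    · apply intervalIntegral.integral_zero_ae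
      refine Filter.Eventually.of_forall fun τ hτ => hz τ ?_
      rintro ⟨h1, -⟩
      have := uIoc_subset_uIcc hτ
      rw [mem_uIcc] at this
      rcases this with h2 | h2 <;> linarith [ha'.1]
    · have hii : ∀ x y : ℝ, IntervalIntegrable ζ volume x y := fun x y =>
        hζ.continuous.intervalIntegrable x y
      have : ∫ τ in s..ℓ, ζ τ = 0 := by
        apply intervalIntegral.integral_zero_ae
        refine Filter.Eventually.of_forall fun τ hτ => hz τ ?_
        rintro ⟨-, h1⟩
        have := uIoc_subset_uIcc hτ
        rw [mem_uIcc] at this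
        rcases this with h2 | h2 <;> linarith [hb'.2]
      change ∫ τ in (0 : ℝ)..s, ζ τ = 0
      rw [← intervalIntegral.integral_add_adjacent_intervals (hii 0 s) (hii s ℓ), this,
        add_zero] at h0
      exact h0
  refine ⟨_, ?_, isCompact_Icc.of_isClosed_subset (isClosed_tsupport _) hsub,
    hsub.trans fun s hs => ⟨(hsupp ha).1.trans_le hs.1, hs.2.trans_lt (hsupp hb).2⟩, hd⟩
  · rw [contDiff_infty_iff_deriv, hd]
    exact ⟨fun s => (hderiv s).differentiableAt, hζ⟩

/-- The lemma of du Bois-Reymond. If G is the primitive of y, then Y - G has weak derivative zero. A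
test function minus its integral times a fixed bump χ of integral one is the derivative of a test
function, so Y - G minus its χ-average is orthogonal to all test functions. -/
theorem HasWeakDeriv.ae_eq (hℓ : 0 < ℓ) (hY : IsL2 ℓ Y) (hy : IsL2 ℓ y)
    (h : HasWeakDeriv ℓ Y y) :
    ∃ c, ∀ᵐ s ∂volume.restrict (Ioc 0 ℓ), Y s = c + ∫ τ in (0 : ℝ)..s, y τ := by
  have hG := isPrim_integral 0 hy
  have hGw := hG.hasWeakDeriv hℓ.le
  simp only [zero_add] at hGw
  set G : ℝ → R3 := fun s => ∫ τ in (0 : ℝ)..s, y τ with hGdef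
  have hG2 : IsL2 ℓ G := isL2_of_continuousOn (continuousOn_integral hℓ.le hy)
  have hsm : ∀ {η : ℝ → ℝ} {X : ℝ → R3}, Continuous η → IsL2 ℓ X →
      IntervalIntegrable (fun s => η s • X s) volume 0 ℓ := fun hη hX =>
    (hX.intervalIntegrable hℓ.le).continuousOn_smul hη.continuousOn
  have hv : IsL2 ℓ (fun s => Y s - G s) := hY.sub hG2
  have hv0 : ∀ η : ℝ → ℝ, ContDiff ℝ ∞ η → HasCompactSupport η → tsupport η ⊆ Ioo 0 ℓ →
      ∫ s in (0 : ℝ)..ℓ, deriv η s • (Y s - G s) = 0 := by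
    intro η h1 h2 h3
    simp only [smul_sub]
    rw [intervalIntegral.integral_sub (hsm (h1.continuous_deriv (by simp)) hY)
      (hsm (h1.continuous_deriv (by simp)) hG2), h η h1 h2 h3, hGw η h1 h2 h3, sub_self]
  let φ : ContDiffBump (ℓ / 2) := ⟨ℓ / 8, ℓ / 4, by positivity, by linarith⟩
  set χ : ℝ → ℝ := φ.normed volume with hχ
  have hχs : ContDiff ℝ ∞ χ := φ.contDiff_normed
  have hχc : HasCompactSupport χ := φ.hasCompactSupport_normed
  have hχt : tsupport χ ⊆ Ioo 0 ℓ := by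
    rw [hχ, φ.tsupport_normed_eq]
    intro s hs
    rw [Metric.mem_closedBall, Real.dist_eq, abs_le] at hs
    have : φ.rOut = ℓ / 4 := rfl
    rw [this] at hs
    constructor <;> linarith [hs.1, hs.2]
  have hχ1 : ∫ s in (0 : ℝ)..ℓ, χ s = 1 := by
    rw [intervalIntegral.integral_eq_integral_of_support_subset
      ((subset_tsupport χ).trans (hχt.trans Ioo_subset_Ioc_self))]
    exact φ.integral_normed
  refine ⟨∫ s in (0 : ℝ)..ℓ, χ s • (Y s - G s), ?_⟩
  set c := ∫ s in (0 : ℝ)..ℓ, χ s • (Y s - G s) with hc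
  have key := ae_eq_zero_of_test hℓ.le (hv.sub (isL2_const c)) (fun ζ h1 h2 h3 => by
    set I := ∫ s in (0 : ℝ)..ℓ, ζ s with hI
    obtain ⟨η, e1, e2, e3, e4⟩ := exists_test_primitive (ℓ := ℓ) (ζ := fun s => ζ s - I * χ s)
      (h1.sub (contDiff_const.mul hχs)) (h2.sub (hχc.mul_left))
      ((tsupport_sub _ _).trans (union_subset h3
        ((tsupport_mul_subset_right).trans hχt)))
      (by
        rw [intervalIntegral.integral_sub (h1.continuous.intervalIntegrable _ _)
          ((hχs.continuous.intervalIntegrable _ _).const_mul I),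
          intervalIntegral.integral_const_mul, hχ1, mul_one, sub_self])
    have h4 := hv0 η e1 e2 e3
    rw [e4] at h4
    simp only [sub_smul, mul_smul] at h4
    rw [intervalIntegral.integral_sub (g := fun s => I • χ s • (Y s - G s))
      (hsm h1.continuous hv) ((hsm hχs.continuous hv).smul I), intervalIntegral.integral_smul, ← hc] at h4
    simp only [smul_sub _ _ c]
    rw [intervalIntegral.integral_sub _ (hsm h1.continuous (isL2_const c)),
      intervalIntegral.integral_smul_const]
    · exact h4
    · exact hsm h1.continuous hv)
  filter_upwards [key] with s hs
  rw [sub_sub, sub_eq_zero] at hs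
  rw [hs, add_comm]

/-- The identity of du Bois-Reymond holds almost everywhere between two continuous functions, hence
everywhere on the closed interval. Elements of H¹ are handled as primitives from here on. -/
theorem IsH1.isPrim (hℓ : 0 < ℓ) (h : IsH1 ℓ Y y) : IsPrim ℓ Y y := by
  obtain ⟨c, hc⟩ := h.weak.ae_eq hℓ (isL2_of_continuousOn h.cont) h.deriv_mem
  have heq : EqOn Y (fun s => c + ∫ τ in (0 : ℝ)..s, y τ) (Icc 0 ℓ) := by
    apply Measure.eqOn_Icc_of_ae_eq volume hℓ.ne _ h.cont
      (continuousOn_const.add (continuousOn_integral hℓ.le h.deriv_mem))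
    rw [← restrict_Ioc_eq_restrict_Icc]
    exact hc
  refine ⟨h.deriv_mem, fun s hs => ?_⟩
  rw [heq hs, heq ⟨le_rfl, hℓ.le⟩]
  simp

/-- Primitives determine the density. -/
theorem IsPrim.ae_unique (hℓ : 0 ≤ ℓ) (h1 : IsPrim ℓ Y y) (h2 : IsPrim ℓ Y z) :
    ∀ᵐ s ∂volume.restrict (Ioc 0 ℓ), y s = z s := by
  have := ae_eq_zero_of_test hℓ (h1.mem.sub h2.mem) (fun η e1 e2 e3 => by
    have hsm : ∀ {X : ℝ → R3}, IsL2 ℓ X →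
        IntervalIntegrable (fun s => η s • X s) volume 0 ℓ := fun hX =>
      (hX.intervalIntegrable hℓ).continuousOn_smul e1.continuous.continuousOn
    simp only [smul_sub]
    rw [intervalIntegral.integral_sub (hsm h1.mem) (hsm h2.mem), sub_eq_zero]
    have := (h1.hasWeakDeriv hℓ η e1 e2 e3).symm.trans (h2.hasWeakDeriv hℓ η e1 e2 e3)
    exact neg_injective this)
  filter_upwards [this] with s hs
  exact sub_eq_zero.1 hs

end

/-! ### Polynomials with vector coefficients -/

/-- `u` is a polynomial of degree at most `m` with coefficients in `ℝ³`. -/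
def IsVPoly (m : ℕ) (u : ℝ → R3) : Prop :=
  ∃ c : ℕ → R3, ∀ s, u s = ∑ j ∈ Finset.range (m + 1), s ^ j • c j

section Poly

variable {ℓ : ℝ} {m : ℕ} {u v : ℝ → R3}

theorem isPolyOn_of_isVPoly (h : IsVPoly m u) (ℓ : ℝ) : IsPolyOn ℓ m u := by
  obtain ⟨c, hc⟩ := h
  intro a
  refine ⟨∑ j ∈ Finset.range (m + 1), Polynomial.C (c j a) * Polynomial.X ^ j, ?_, ?_⟩
  · apply Polynomial.natDegree_sum_le_of_forall_le
    intro j hj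
    exact (Polynomial.natDegree_C_mul_X_pow_le _ _).trans (Finset.mem_range_succ_iff.1 hj)
  · intro s _
    simp only [hc, Polynomial.eval_finsetSum, WithLp.ofLp_sum, Finset.sum_apply]
    exact Finset.sum_congr rfl fun j _ => by
      rw [Polynomial.eval_mul, Polynomial.eval_C, Polynomial.eval_pow, Polynomial.eval_X, mul_comm]
      rfl

theorem IsPolyOn.exists_isVPoly (h : IsPolyOn ℓ m u) :
    ∃ v, IsVPoly m v ∧ ∀ s ∈ Icc 0 ℓ, u s = v s := by
  choose P hP hu using h
  refine ⟨_, ⟨fun j => WithLp.toLp 2 fun a => (P a).coeff j, fun s => rfl⟩, fun s hs => ?_⟩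
  ext a
  simp [hu a s hs, Polynomial.eval_eq_sum_range' (Nat.lt_succ_of_le (hP a)), mul_comm]

theorem IsVPoly.continuous (h : IsVPoly m u) : Continuous u := by
  obtain ⟨c, hc⟩ := h
  rw [funext hc]
  fun_prop

theorem IsVPoly.isL2 (h : IsVPoly m u) (ℓ : ℝ) : IsL2 ℓ u :=
  isL2_of_continuousOn h.continuous.continuousOn

theorem IsVPoly.add (hu : IsVPoly m u) (hv : IsVPoly m v) : IsVPoly m (fun s => u s + v s) := by
  obtain ⟨c, hc⟩ := hu
  obtain ⟨d, hd⟩ := hv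
  exact ⟨fun j => c j + d j, fun s => by simp [hc, hd, Finset.sum_add_distrib]⟩

theorem IsVPoly.clm (L : R3 →L[ℝ] R3) (hu : IsVPoly m u) : IsVPoly m (fun s => L (u s)) := by
  obtain ⟨c, hc⟩ := hu
  exact ⟨fun j => L (c j), fun s => by simp [hc]⟩

theorem IsVPoly.neg (hu : IsVPoly m u) : IsVPoly m (fun s => - u s) := by
  simpa using hu.clm (-ContinuousLinearMap.id ℝ R3)

theorem IsVPoly.sub (hu : IsVPoly m u) (hv : IsVPoly m v) : IsVPoly m (fun s => u s - v s) := by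
  simpa only [sub_eq_add_neg] using hu.add hv.neg

theorem isVPoly_const (m : ℕ) (c : R3) : IsVPoly m (fun _ => c) := by
  refine ⟨fun j => if j = 0 then c else 0, fun s => ?_⟩
  rw [Finset.sum_eq_single 0] <;> simp +contextual

theorem isVPoly_affine (m : ℕ) (c d : R3) : IsVPoly (m + 1) (fun s => c + s • d) := by
  refine ⟨fun j => if j = 0 then c else if j = 1 then d else 0, fun s => ?_⟩
  rw [Finset.sum_range_succ', Finset.sum_range_succ', Finset.sum_eq_zero]
  · simp [add_comm]
  · simp

theorem IsVPoly.exists_deriv (hu : IsVPoly (m + 1) u) :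
    ∃ v, IsVPoly m v ∧ ∀ s, HasDerivAt u (v s) s := by
  obtain ⟨c, hc⟩ := hu
  refine ⟨_, ⟨fun j => ((j : ℝ) + 1) • c (j + 1), fun s => rfl⟩, fun s => ?_⟩
  rw [funext hc]
  have h := HasDerivAt.fun_sum (u := Finset.range (m + 1 + 1)) (x := s)
    (A := fun j s => s ^ j • c j) (fun j _ => (hasDerivAt_pow j s).smul_const (c j))
  convert! h using 1
  rw [Finset.sum_range_succ' _ (m + 1)]
  simp only [Nat.cast_add, Nat.cast_one, Nat.add_sub_cancel, Nat.cast_zero, zero_mul, zero_smul,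
    add_zero]
  refine Finset.sum_congr rfl fun j _ => ?_
  rw [smul_smul, mul_comm]

theorem IsVPoly.exists_antideriv (hu : IsVPoly m u) :
    ∃ v, IsVPoly (m + 1) v ∧ ∀ s, HasDerivAt v (u s) s := by
  obtain ⟨c, hc⟩ := hu
  -- At `j = 0` the inverse of zero is zero, so the constant coefficient vanishes whatever the
  -- truncated index `j - 1` means.
  refine ⟨_, ⟨fun j => ((j : ℝ)⁻¹) • c (j - 1), fun s => rfl⟩, fun s => ?_⟩
  have h := HasDerivAt.fun_sum (u := Finset.range (m + 1 + 1)) (x := s)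
    (A := fun j s => s ^ j • ((j : ℝ)⁻¹) • c (j - 1))
    (fun j _ => (hasDerivAt_pow j s).smul_const _)
  convert! h using 1
  rw [Finset.sum_range_succ', hc]
  simp only [Nat.cast_add, Nat.cast_one, Nat.add_sub_cancel, Nat.cast_zero, zero_mul, zero_smul,
    add_zero]
  refine Finset.sum_congr rfl fun j _ => ?_
  rw [smul_smul]
  congr 1
  field_simp

theorem IsVPoly.isPrim (hv : IsVPoly m v) (h : ∀ s, HasDerivAt u (v s) s) :
    IsPrim ℓ u v :=
  IsPrim.of_hasDerivAt (fun s _ => h s) hv.continuous.continuousOn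

end Poly

/-! ### Taylor expansions in `L²` -/

/-- `g` has on `[0, ℓ]` a Taylor expansion of order `m` with remainder measured in `L²`; all terms
are controlled by `B`. -/
def TaylorL2 (ℓ : ℝ) (m : ℕ) (B : ℝ) (g : ℝ → R3) : Prop :=
  IsL2 ℓ g ∧ ∃ a : ℕ → R3, (∀ j < m, √ℓ * ‖a j‖ ≤ B) ∧
    l2norm ℓ (fun s => g s - ∑ j ∈ Finset.range m, s ^ j • a j) ≤ ℓ ^ m * B

section Taylor

variable {ℓ B B' : ℝ} {m : ℕ} {g g' : ℝ → R3}

theorem isL2_monomials (ℓ : ℝ) (m : ℕ) (a : ℕ → R3) :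
    IsL2 ℓ (fun s => ∑ j ∈ Finset.range m, s ^ j • a j) :=
  isL2_of_continuousOn (by fun_prop)

theorem taylorL2_zero (hg : IsL2 ℓ g) (h : l2norm ℓ g ≤ B) : TaylorL2 ℓ 0 B g :=
  ⟨hg, 0, by simp, by simpa using h⟩

theorem TaylorL2.mono (hℓ : 0 ≤ ℓ) (h : TaylorL2 ℓ m B g) (hB : B ≤ B') : TaylorL2 ℓ m B' g := by
  obtain ⟨h1, a, h2, h3⟩ := h
  exact ⟨h1, a, fun j hj => (h2 j hj).trans hB, h3.trans (by gcongr)⟩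

theorem TaylorL2.add (hℓ : 0 ≤ ℓ) (h : TaylorL2 ℓ m B g) (h' : TaylorL2 ℓ m B' g') :
    TaylorL2 ℓ m (B + B') (fun s => g s + g' s) := by
  obtain ⟨h1, a, h2, h3⟩ := h
  obtain ⟨h1', a', h2', h3'⟩ := h'
  refine ⟨h1.add h1', fun j => a j + a' j, fun j hj => ?_, ?_⟩
  · calc √ℓ * ‖a j + a' j‖ ≤ √ℓ * (‖a j‖ + ‖a' j‖) := by gcongr; exact norm_add_le _ _
      _ ≤ B + B' := by rw [mul_add]; exact add_le_add (h2 j hj) (h2' j hj)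
  · have := l2norm_add_le hℓ (h1.sub (isL2_monomials ℓ m a)) (h1'.sub (isL2_monomials ℓ m a'))
    rw [mul_add]
    refine le_trans (le_of_eq ?_) (this.trans (add_le_add h3 h3'))
    congr 1
    ext1 s
    simp only [smul_add, Finset.sum_add_distrib]
    abel

theorem TaylorL2.clm (hℓ : 0 ≤ ℓ) (L : R3 →L[ℝ] R3) (h : TaylorL2 ℓ m B g) :
    TaylorL2 ℓ m (‖L‖ * B) (fun s => L (g s)) := by
  obtain ⟨h1, a, h2, h3⟩ := h
  refine ⟨h1.clm L, fun j => L (a j), fun j hj => ?_, ?_⟩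
  · calc √ℓ * ‖L (a j)‖ ≤ √ℓ * (‖L‖ * ‖a j‖) := by gcongr; exact L.le_opNorm _
      _ = ‖L‖ * (√ℓ * ‖a j‖) := by ring
      _ ≤ ‖L‖ * B := by gcongr; exact h2 j hj
  · have := l2norm_clm_apply_le (C := fun _ => L) hℓ (norm_nonneg L) (fun _ _ => le_rfl)
      (h1.sub (isL2_monomials ℓ m a))
    calc _ = l2norm ℓ (fun s => L (g s - ∑ j ∈ Finset.range m, s ^ j • a j)) := by simp
      _ ≤ ‖L‖ * (ℓ ^ m * B) := this.trans (by gcongr)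
      _ = ℓ ^ m * (‖L‖ * B) := by ring

theorem TaylorL2.neg (h : TaylorL2 ℓ m B g) : TaylorL2 ℓ m B (fun s => - g s) := by
  obtain ⟨h1, a, h2, h3⟩ := h
  refine ⟨h1.neg, fun j => - a j, fun j hj => by simpa using h2 j hj, ?_⟩
  rw [← l2norm_neg] at h3
  simpa [neg_add_eq_sub] using h3

theorem taylorL2_const (hℓ : 0 ≤ ℓ) (m : ℕ) (hB : 0 ≤ B) {c : R3} (h : √ℓ * ‖c‖ ≤ B) :
    TaylorL2 ℓ m B (fun _ => c) := by
  rcases m with _ | m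
  · exact taylorL2_zero (isL2_const c) (by rwa [l2norm_const hℓ])
  · refine ⟨isL2_const c, fun j => if j = 0 then c else 0, fun j _ => ?_, ?_⟩
    · dsimp only
      split_ifs <;> simp [h, hB]
    · have : ∀ s : ℝ, ∑ j ∈ Finset.range (m + 1), s ^ j • (if j = 0 then c else 0) = c := by
        intro s
        rw [Finset.sum_eq_single 0] <;> simp +contextual
      simp only [this, sub_self]
      simp [l2norm]
      positivity

theorem TaylorL2.congr_ae (hℓ : 0 ≤ ℓ) (h : TaylorL2 ℓ m B g)
    (hg : ∀ᵐ s ∂volume.restrict (Ioc 0 ℓ), g s = g' s) : TaylorL2 ℓ m B g' := by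
  obtain ⟨h1, a, h2, h3⟩ := h
  refine ⟨h1.congr_ae hg, a, h2, le_of_eq_of_le (l2norm_congr_ae hℓ ?_) h3⟩
  filter_upwards [hg] with s hs
  rw [hs]

theorem l2norm_monomial_le (hℓ : 0 ≤ ℓ) (j : ℕ) (c : R3) :
    l2norm ℓ (fun s => s ^ j • c) ≤ ℓ ^ j * (√ℓ * ‖c‖) := by
  have := l2norm_le_of_bound (u := fun s => s ^ j • c) hℓ (M := ℓ ^ j * ‖c‖) (by positivity)
    (fun s hs => by
      rw [norm_smul, norm_pow, Real.norm_of_nonneg hs.1.le]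
      gcongr
      · exact hs.1.le
      · exact hs.2)
  linarith

/-- The last Taylor term joins the remainder: its L² norm is at most ℓ^m · √ℓ ‖a m‖. This is why the
coefficients are measured with the weight √ℓ. -/
theorem TaylorL2.of_succ (hℓ : 0 ≤ ℓ) {Λ : ℝ} (hΛ : ℓ ≤ Λ) (hB : 0 ≤ B)
    (h : TaylorL2 ℓ (m + 1) B g) : TaylorL2 ℓ m ((1 + Λ) * B) g := by
  obtain ⟨h1, a, h2, h3⟩ := h
  have hΛ0 := hℓ.trans hΛ
  refine ⟨h1, a, fun j hj => (h2 j (by omega)).trans (by nlinarith), ?_⟩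
  have e : (fun s => g s - ∑ j ∈ Finset.range m, s ^ j • a j)
      = fun s => (g s - ∑ j ∈ Finset.range (m + 1), s ^ j • a j) + s ^ m • a m := by
    ext1 s; rw [Finset.sum_range_succ]; abel
  rw [e]
  refine (l2norm_add_le hℓ (h1.sub (isL2_monomials ℓ (m + 1) a))
    (isL2_of_continuousOn (by fun_prop))).trans ?_
  have h4 := l2norm_monomial_le hℓ m (a m)
  have h5 := h2 m (by omega)
  calc _ ≤ ℓ ^ (m + 1) * B + ℓ ^ m * B := add_le_add h3 (h4.trans (by gcongr))
    _ = ℓ ^ m * ((ℓ + 1) * B) := by ring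
    _ ≤ ℓ ^ m * ((1 + Λ) * B) := by gcongr ?_ * (?_ * _); linarith

/-- Termwise integration: the remainder gains a factor ℓ and the value at 0 becomes the new constant
term. -/
theorem TaylorL2.prim (hℓ : 0 ≤ ℓ) (hg : IsPrim ℓ g g') (h0 : √ℓ * ‖g 0‖ ≤ B)
    (h : TaylorL2 ℓ m B g') : TaylorL2 ℓ (m + 1) B g := by
  obtain ⟨h1, a, h2, h3⟩ := h
  refine ⟨hg.isL2 hℓ, fun j => if j = 0 then g 0 else ((j : ℝ)⁻¹) • a (j - 1),
    fun j hj => ?_, ?_⟩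
  · rcases j with _ | j
    · simpa using h0
    · simp only [Nat.add_eq_zero_iff, one_ne_zero, and_false, if_false, Nat.add_sub_cancel]
      refine le_trans ?_ (h2 j (by omega))
      rw [norm_smul, norm_inv, RCLike.norm_natCast]
      gcongr
      apply mul_le_of_le_one_left (norm_nonneg _)
      apply inv_le_one_of_one_le₀
      simp
  · have hr := h1.sub (isL2_monomials ℓ m a)
    have hmono : IsPrim ℓ (fun s => ∑ j ∈ Finset.range (m + 1),
        s ^ j • (if j = 0 then g 0 else ((j : ℝ)⁻¹) • a (j - 1)))
        (fun s => ∑ j ∈ Finset.range m, s ^ j • a j) := by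
      apply IsPrim.of_hasDerivAt _ (by fun_prop)
      intro s _
      have h := HasDerivAt.fun_sum (u := Finset.range (m + 1)) (x := s)
        (A := fun j s => s ^ j • (if j = 0 then g 0 else ((j : ℝ)⁻¹) • a (j - 1)))
        (fun j _ => (hasDerivAt_pow j s).smul_const _)
      convert! h using 1
      rw [Finset.sum_range_succ']
      simp only [Nat.cast_add, Nat.cast_one, Nat.add_sub_cancel, Nat.cast_zero, zero_mul,
        zero_smul, add_zero, Nat.add_eq_zero_iff, one_ne_zero, and_false, if_false]
      refine Finset.sum_congr rfl fun j _ => ?_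
      rw [smul_smul]
      congr 1
      field_simp
    have hd := hg.sub hℓ hmono
    have e : l2norm ℓ (fun s => g s - ∑ j ∈ Finset.range (m + 1),
        s ^ j • (if j = 0 then g 0 else ((j : ℝ)⁻¹) • a (j - 1)))
        = l2norm ℓ (fun s => ∫ τ in (0 : ℝ)..s, (g' τ - ∑ j ∈ Finset.range m, τ ^ j • a j)) := by
      apply l2norm_congr_ae hℓ
      apply ae_of_forall_Ioc
      intro s hs
      rw [hd.eq s (Ioc_subset_Icc_self hs)]
      simp [Finset.sum_range_succ']
    rw [e, pow_succ', mul_assoc]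
    exact (l2norm_integral_le hℓ hr).trans (by gcongr)

theorem TaylorL2.sum (hℓ : 0 ≤ ℓ) {ι : Type*} (I : Finset ι) {b : ι → ℝ} {F : ι → ℝ → R3}
    (h : ∀ i ∈ I, TaylorL2 ℓ m (b i) (F i)) :
    TaylorL2 ℓ m (∑ i ∈ I, b i) (fun s => ∑ i ∈ I, F i s) := by
  classical
  induction I using Finset.induction_on with
  | empty => simpa using taylorL2_const hℓ m le_rfl (c := 0) (by simp)
  | insert a I ha ih =>
    simp only [Finset.sum_insert ha]
    exact (h a (Finset.mem_insert_self a I)).add hℓ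
      (ih fun j hj => h j (Finset.mem_insert_of_mem hj))

/-- Multiplication with an operator-valued function that has uniform Taylor expansions. -/
theorem TaylorL2.clm_apply (hℓ : 0 ≤ ℓ) {M : ℝ} (hM : 0 ≤ M) {C : ℝ → R3 →L[ℝ] R3}
    (hC : ContinuousOn C (Icc 0 ℓ)) {c : ℕ → R3 →L[ℝ] R3} (hc : ∀ i < m, ‖c i‖ ≤ M)
    (hCc : ∀ s ∈ Icc 0 ℓ, ∀ m' ≤ m, ‖C s - ∑ i ∈ Finset.range m', s ^ i • c i‖ ≤ M * s ^ m')
    (hB : 0 ≤ B) (h : TaylorL2 ℓ m B g) :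
    TaylorL2 ℓ m ((m + 1) * (M * B)) (fun s => C s (g s)) := by
  obtain ⟨h1, a, h2, h3⟩ := h
  have hC0 : ∀ s ∈ Icc 0 ℓ, ‖C s‖ ≤ M := fun s hs => by simpa using hCc s hs 0 (by simp)
  -- The monomial of degree `j` meets the expansion of `C` truncated at order `m - j`, hence the
  -- hypothesis for all orders up to `m`. The `m` monomials and the remainder contribute `M * B`
  -- each.
  have hmon : ∀ j ∈ Finset.range m, TaylorL2 ℓ m (M * B) (fun s => C s (s ^ j • a j)) := by
    intro j hj
    rw [Finset.mem_range] at hj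
    refine ⟨isL2_clm_apply hC (isL2_of_continuousOn (by fun_prop)),
      fun l => if j ≤ l then c (l - j) (a j) else 0, fun l hl => ?_, ?_⟩
    · dsimp only
      split_ifs with hjl
      · calc √ℓ * ‖c (l - j) (a j)‖ ≤ √ℓ * (M * ‖a j‖) := by
              gcongr
              exact ((c (l - j)).le_opNorm _).trans (by gcongr; exact hc _ (by omega))
          _ = M * (√ℓ * ‖a j‖) := by ring
          _ ≤ M * B := by gcongr; exact h2 j hj
      · simp; positivity
    · have hsum : ∀ s : ℝ, ∑ l ∈ Finset.range m, s ^ l • (if j ≤ l then c (l - j) (a j) else 0)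
          = s ^ j • (∑ i ∈ Finset.range (m - j), s ^ i • c i) (a j) := by
        intro s
        have hm : m = j + (m - j) := by omega
        conv_lhs => rw [hm]
        rw [Finset.sum_range_add, Finset.sum_eq_zero, zero_add]
        · simp [Finset.smul_sum, smul_smul, pow_add]
        · intro l hl
          rw [Finset.mem_range] at hl
          simp [hl]
      have hb : ∀ s ∈ Ioc 0 ℓ, ‖C s (s ^ j • a j)
          - ∑ l ∈ Finset.range m, s ^ l • (if j ≤ l then c (l - j) (a j) else 0)‖
          ≤ ℓ ^ m * (M * ‖a j‖) := by
        intro s hs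
        rw [hsum, map_smul, ← smul_sub, ← sub_apply, norm_smul, norm_pow,
          Real.norm_of_nonneg hs.1.le]
        calc _ ≤ s ^ j * (M * s ^ (m - j) * ‖a j‖) := by
              have := hs.1.le
              gcongr
              refine (ContinuousLinearMap.le_opNorm _ _).trans ?_
              gcongr
              exact hCc s (Ioc_subset_Icc_self hs) _ (by omega)
          _ = s ^ m * (M * ‖a j‖) := by
              have : s ^ m = s ^ j * s ^ (m - j) := by rw [← pow_add]; congr 1; omega
              rw [this]; ring
          _ ≤ _ := by
              have := hs.1.le
              gcongr
              exact hs.2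
      refine (l2norm_le_of_bound hℓ (by positivity) hb).trans ?_
      calc _ = ℓ ^ m * (M * (√ℓ * ‖a j‖)) := by ring
        _ ≤ _ := by gcongr; exact h2 j hj
  have hrem : TaylorL2 ℓ m (M * B)
      (fun s => C s (g s - ∑ j ∈ Finset.range m, s ^ j • a j)) := by
    have hr := h1.sub (isL2_monomials ℓ m a)
    refine ⟨isL2_clm_apply hC hr, fun _ => 0, fun l _ => by simp; positivity, ?_⟩
    simp only [smul_zero, Finset.sum_const_zero, sub_zero]
    calc _ ≤ M * (ℓ ^ m * B) := (l2norm_clm_apply_le hℓ hM hC0 hr).trans (by gcongr)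
      _ = _ := by ring
  have := (TaylorL2.sum hℓ _ hmon).add hℓ hrem
  refine TaylorL2.congr_ae hℓ ?_ (Filter.Eventually.of_forall (f := ae _) fun s => ?_)
    (g := fun s => ∑ j ∈ Finset.range m, C s (s ^ j • a j)
      + C s (g s - ∑ j ∈ Finset.range m, s ^ j • a j))
  · convert this using 1
    simp
    ring
  · simp [map_sub, map_sum]

theorem TaylorL2.exists_approx {k : ℕ} (h : TaylorL2 ℓ m B g) (hm : m ≤ k + 1) :
    ∃ π, IsVPoly k π ∧ l2norm ℓ (fun s => g s - π s) ≤ ℓ ^ m * B := by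
  obtain ⟨-, a, -, h3⟩ := h
  refine ⟨_, ⟨fun j => if j < m then a j else 0, fun s => rfl⟩, ?_⟩
  convert h3 using 4
  rw [← Finset.sum_subset (Finset.range_subset_range.2 hm)]
  · refine Finset.sum_congr rfl fun j hj => ?_
    simp only [if_pos (Finset.mem_range.1 hj)]
  · intro j _ hj
    have : ¬ j < m := by simpa using hj
    simp [this]

/-- The initial value is itself a polynomial and goes into the approximant, so no bound on `g 0` is
needed. Applied to the rotation, this spares an a priori bound of it. -/
theorem TaylorL2.exists_approx_prim (hℓ : 0 ≤ ℓ) (hB : 0 ≤ B) {k : ℕ} (hg : IsPrim ℓ g g')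
    (h : TaylorL2 ℓ m B g') (hm : m ≤ k) :
    ∃ π, IsVPoly k π ∧ l2norm ℓ (fun s => g s - π s) ≤ ℓ ^ (m + 1) * B := by
  have h1 : IsPrim ℓ (fun s => g s - g 0) g' := by
    refine ⟨hg.mem, fun s hs => ?_⟩
    rw [hg.eq s hs]; simp
  obtain ⟨π, h2, h3⟩ := (TaylorL2.prim hℓ h1 (by simpa using hB) h).exists_approx
    (Nat.succ_le_succ hm)
  refine ⟨fun s => g 0 + π s, (isVPoly_const k _).add h2, ?_⟩
  simpa only [sub_add_eq_sub_sub] using h3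

/-- Each derivative is almost everywhere a primitive of the next one. Its value at 0 is the
difference of the derivative and an integral of the next one, which bounds it by (1 + ℓ) B in the
weighted norm. -/
theorem IsHr.taylorL2 (hℓ : 0 < ℓ) {Λ : ℝ} (hΛ : ℓ ≤ Λ) {r : ℕ} {D : ℕ → ℝ → R3}
    (h : IsHr ℓ r g D) (hB : 0 ≤ B) (hD : ∀ j ≤ r, l2norm ℓ (D j) ≤ B) (m j : ℕ) (hj : j + m ≤ r) :
    TaylorL2 ℓ m ((1 + Λ) * B) (D j) := by
  have hΛ0 := hℓ.le.trans hΛ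
  have hB1 : B ≤ (1 + Λ) * B := by nlinarith
  induction m generalizing j with
  | zero => exact taylorL2_zero (h.mem j (by omega)) ((hD j (by omega)).trans hB1)
  | succ m ih =>
    have hm0 := h.mem j (by omega)
    have hm1 := h.mem (j + 1) (by omega)
    obtain ⟨c, hc⟩ := (h.weak j (by omega)).ae_eq hℓ hm0 hm1
    have hp := isPrim_integral c hm1
    refine (TaylorL2.prim hℓ.le hp ?_ (ih (j + 1) (by omega))).congr_ae hℓ.le ?_
    · simp only [intervalIntegral.integral_same, add_zero]
      rw [← l2norm_const hℓ.le c]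
      have : l2norm ℓ (fun _ => c) = l2norm ℓ (fun s => D j s - ∫ τ in (0 : ℝ)..s, D (j + 1) τ) := by
        apply l2norm_congr_ae hℓ.le
        filter_upwards [hc] with s hs
        rw [hs]; abel
      rw [this]
      refine (l2norm_sub_le hℓ.le hm0
        (isL2_of_continuousOn (continuousOn_integral hℓ.le hm1))).trans ?_
      have h1 := l2norm_integral_le hℓ.le hm1
      have h2 := hD j (by omega)
      have h3 := hD (j + 1) (by omega)
      nlinarith [l2norm_nonneg ℓ (D (j + 1))]
    · filter_upwards [hc] with s hs
      rw [hs]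

end Taylor

/-- Uniform Taylor expansions of a smooth function on an interval, at arbitrary base points. -/
theorem exists_uniform_taylor {F : Type*} [NormedAddCommGroup F] [NormedSpace ℝ F] {L : ℝ}
    (hL : 0 < L) (m : ℕ) {c : ℝ → F} (hc : ContDiffOn ℝ ∞ c (Icc 0 L)) :
    ∃ M, 0 ≤ M ∧ ∀ x ∈ Icc 0 L, ∃ a : ℕ → F, (∀ i < m, ‖a i‖ ≤ M) ∧
      ∀ s, 0 ≤ s → x + s ≤ L → ∀ m' ≤ m,
        ‖c (x + s) - ∑ i ∈ Finset.range m', s ^ i • a i‖ ≤ M * s ^ m' := by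
  obtain ⟨M₀, hM₀⟩ := isCompact_Icc.exists_bound_of_continuousOn hc.continuousOn
  have hM₀0 : 0 ≤ M₀ := (norm_nonneg _).trans (hM₀ 0 ⟨le_rfl, hL.le⟩)
  -- The derivative takes the place of `c`; its expansion is integrated by the mean value
  -- inequality, with bounds that do not depend on the base point `x`.
  induction m generalizing c M₀ with
  | zero =>
    refine ⟨M₀, hM₀0, fun x hx => ⟨0, by simp, fun s hs hxs m' hm' => ?_⟩⟩
    rw [Nat.le_zero.1 hm']
    simpa using hM₀ (x + s) ⟨add_nonneg hx.1 hs, hxs⟩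
  | succ m ih =>
    have hd := ((contDiffOn_infty_iff_derivWithin (uniqueDiffOn_Icc hL)).1 hc).2
    have hdiff := ((contDiffOn_infty_iff_derivWithin (uniqueDiffOn_Icc hL)).1 hc).1
    obtain ⟨M₁, hM₁⟩ := isCompact_Icc.exists_bound_of_continuousOn hd.continuousOn
    obtain ⟨M, hM, h⟩ := ih hd M₁ hM₁ ((norm_nonneg _).trans (hM₁ 0 ⟨le_rfl, hL.le⟩))
    refine ⟨M₀ + M, by positivity, fun x hx => ?_⟩
    obtain ⟨a, ha, hax⟩ := h x hx
    refine ⟨fun j => if j = 0 then c x else ((j : ℝ)⁻¹) • a (j - 1), fun j hj => ?_,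
      fun s hs hxs m' hm' => ?_⟩
    · rcases j with _ | j
      · simpa using (hM₀ x hx).trans (by linarith)
      · simp only [Nat.add_eq_zero_iff, one_ne_zero, and_false, if_false, Nat.add_sub_cancel]
        rw [norm_smul, norm_inv, RCLike.norm_natCast]
        have h1 := ha j (by omega)
        have h2 : ((j + 1 : ℕ) : ℝ)⁻¹ ≤ 1 := inv_le_one_of_one_le₀ (by simp)
        have h3 := mul_le_mul h2 h1 (norm_nonneg _) zero_le_one
        linarith
    · rcases m' with _ | m'
      · have := hM₀ (x + s) ⟨add_nonneg hx.1 hs, hxs⟩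
        simp; linarith
      · have hder : ∀ τ ∈ Icc 0 s, HasDerivWithinAt (fun τ => c (x + τ)
            - ∑ j ∈ Finset.range (m' + 1),
              τ ^ j • (if j = 0 then c x else ((j : ℝ)⁻¹) • a (j - 1)))
            (derivWithin c (Icc 0 L) (x + τ) - ∑ j ∈ Finset.range m', τ ^ j • a j)
            (Icc 0 s) τ := by
          intro τ hτ
          apply HasDerivWithinAt.sub
          · have h1 := (hdiff (x + τ) ⟨add_nonneg hx.1 hτ.1, by linarith [hτ.2]⟩).hasDerivWithinAt
            have h2 : HasDerivWithinAt (fun τ => x + τ) 1 (Icc 0 s) τ :=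
              (hasDerivWithinAt_id τ _).const_add x
            have h3 : MapsTo (fun τ => x + τ) (Icc 0 s) (Icc 0 L) := fun σ hσ =>
              ⟨add_nonneg hx.1 hσ.1, by linarith [hσ.2]⟩
            simpa [Function.comp_def] using HasDerivWithinAt.scomp τ h1 h2 h3
          · have h := HasDerivAt.fun_sum (u := Finset.range (m' + 1)) (x := τ)
              (A := fun j τ => τ ^ j • (if j = 0 then c x else ((j : ℝ)⁻¹) • a (j - 1)))
              (fun j _ => (hasDerivAt_pow j τ).smul_const _)
            convert! h.hasDerivWithinAt using 1
            rw [Finset.sum_range_succ']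
            simp only [Nat.cast_add, Nat.cast_one, Nat.add_sub_cancel, Nat.cast_zero, zero_mul,
              zero_smul, add_zero, Nat.add_eq_zero_iff, one_ne_zero, and_false, if_false]
            refine Finset.sum_congr rfl fun j _ => ?_
            rw [smul_smul]
            congr 1
            field_simp
        have hbound : ∀ τ ∈ Ico 0 s, ‖derivWithin c (Icc 0 L) (x + τ)
            - ∑ j ∈ Finset.range m', τ ^ j • a j‖ ≤ M * s ^ m' := by
          intro τ hτ
          refine (hax τ hτ.1 (by linarith [hτ.2]) m' (by omega)).trans ?_
          have := hτ.1
          gcongr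
          exact hτ.2.le
        have := norm_image_sub_le_of_norm_deriv_le_segment' hder hbound s ⟨hs, le_rfl⟩
        simp only [Finset.sum_range_succ' _ m'] at this
        simp [Finset.sum_range_succ' _ m'] at this ⊢
        refine this.trans ?_
        rw [pow_succ, ← mul_assoc]
        gcongr
        linarith

/-! ### Equilibrium of one strut -/

/-- The weak form, tested with `(v, v') = (v, ξ)`, of `p' + α = -f`, `p 0 = Pm`, `p ℓ = Pp`. -/
def EdgeEq (ℓ : ℝ) (p f : ℝ → R3) (Pp Pm α : R3) (v ξ : ℝ → R3) : Prop :=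
  -(∫ s in (0 : ℝ)..ℓ, inner ℝ (p s) (ξ s)) + (inner ℝ Pp (v ℓ) - inner ℝ Pm (v 0))
    + inner ℝ α (∫ s in (0 : ℝ)..ℓ, v s) = -(∫ s in (0 : ℝ)..ℓ, inner ℝ (f s) (v s))

/-- P is found by integrating the equation from the value `Pm`. Constant test functions then give
the value at the other end, and the primitive of p - P as test function shows p = P almost
everywhere. -/
theorem exists_prim_of_edgeEq {ℓ : ℝ} (hℓ : 0 ≤ ℓ) {p f : ℝ → R3} {Pp Pm α : R3}
    (hp : IsL2 ℓ p) (hf : IsL2 ℓ f) (h : ∀ v ξ, IsPrim ℓ v ξ → EdgeEq ℓ p f Pp Pm α v ξ) :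
    ∃ P, IsPrim ℓ P (fun s => -(f s + α)) ∧ P 0 = Pm ∧ P ℓ = Pp ∧
      ∀ᵐ s ∂volume.restrict (Ioc 0 ℓ), p s = P s := by
  have hP := isPrim_integral Pm (hf.add (isL2_const α)).neg
  set P : ℝ → R3 := fun s => Pm + ∫ τ in (0 : ℝ)..s, -(f τ + α) with hPdef
  have hP0 : P 0 = Pm := by simp [hPdef]
  have key : ∀ v ξ, IsPrim ℓ v ξ →
      ∫ s in (0 : ℝ)..ℓ, inner ℝ (p s - P s) (ξ s) = inner ℝ (Pp - P ℓ) (v ℓ) := by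
    intro v ξ hv
    have h1 := h v ξ hv
    have h2 := hP.integral_inner hℓ hv
    have h3 : ∫ s in (0 : ℝ)..ℓ, inner ℝ (-(f s + α)) (v s)
        = -(∫ s in (0 : ℝ)..ℓ, inner ℝ (f s) (v s)) - inner ℝ α (∫ s in (0 : ℝ)..ℓ, v s) := by
      rw [← integral_const_inner hℓ (hv.isL2 hℓ)]
      simp only [inner_neg_left, inner_add_left]
      rw [intervalIntegral.integral_neg, intervalIntegral.integral_add
        (hf.intervalIntegrable_inner hℓ (hv.isL2 hℓ))
        ((isL2_const α).intervalIntegrable_inner hℓ (hv.isL2 hℓ))]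
      ring
    simp only [inner_sub_left]
    rw [intervalIntegral.integral_sub (hp.intervalIntegrable_inner hℓ hv.mem)
      ((hP.isL2 hℓ).intervalIntegrable_inner hℓ hv.mem), h2, h3, hP0]
    unfold EdgeEq at h1
    linarith
  have hℓP : P ℓ = Pp := by
    have h1 := key (fun _ => Pp - P ℓ) (fun _ => 0) ⟨isL2_const 0, fun s _ => by simp⟩
    simp only [inner_zero_right, intervalIntegral.integral_zero] at h1
    exact (sub_eq_zero.1 (inner_self_eq_zero.1 h1.symm)).symm
  refine ⟨P, hP, hP0, hℓP, ?_⟩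
  have hpP := hp.sub (hP.isL2 hℓ)
  have h1 := key _ _ (isPrim_integral 0 hpP)
  rw [hℓP, sub_self, inner_zero_left] at h1
  filter_upwards [ae_eq_zero_of_l2norm_eq_zero hℓ hpP h1] with s hs
  exact sub_eq_zero.1 hs

/-- Orthogonality of the error of the equilibrium in one strut. -/
theorem edge_galerkin {ℓ : ℝ} (hℓ : 0 ≤ ℓ) {k : ℕ} {p f p' f' : ℝ → R3} {Pp Pm Pp' Pm' α : R3}
    (hp : IsL2 ℓ p) (hf : IsL2 ℓ f) (hp' : IsL2 ℓ p') (hf' : IsL2 ℓ f')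
    (h : ∀ v ξ, IsVPoly (k + 1) v → IsVPoly k ξ → (∀ s, HasDerivAt v (ξ s) s) →
      EdgeEq ℓ p f Pp Pm α v ξ)
    (h' : ∀ v ξ, IsVPoly (k + 1) v → IsVPoly k ξ → (∀ s, HasDerivAt v (ξ s) s) →
      EdgeEq ℓ p' f' Pp' Pm' α v ξ) :
    (Pm - Pm') + ∫ s in (0 : ℝ)..ℓ, (f' s - f s) = Pp - Pp' ∧
    ∀ ξ, IsVPoly k ξ → ∫ s in (0 : ℝ)..ℓ, inner ℝ
      (p s - p' s - ((Pm - Pm') + ∫ τ in (0 : ℝ)..s, (f' τ - f τ))) (ξ s) = 0 := by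
  have hR := isPrim_integral (Pm - Pm') (hf'.sub hf)
  set R : ℝ → R3 := fun s => (Pm - Pm') + ∫ τ in (0 : ℝ)..s, (f' τ - f τ) with hRdef
  have hR0 : R 0 = Pm - Pm' := by simp [hRdef]
  have hpp := hp.sub hp'
  have key : ∀ v ξ, IsVPoly (k + 1) v → IsVPoly k ξ → (∀ s, HasDerivAt v (ξ s) s) →
      ∫ s in (0 : ℝ)..ℓ, inner ℝ (p s - p' s - R s) (ξ s) = inner ℝ (Pp - Pp' - R ℓ) (v ℓ) := by
    intro v ξ hv hξ hd
    have h1 := h v ξ hv hξ hd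
    have h1' := h' v ξ hv hξ hd
    have hvp := hξ.isPrim (ℓ := ℓ) hd
    have hv2 := hv.isL2 ℓ
    have hξ2 := hξ.isL2 ℓ
    have h2 := hR.integral_inner hℓ hvp
    simp only [inner_sub_left] at h2 ⊢
    rw [intervalIntegral.integral_sub (hf'.intervalIntegrable_inner hℓ hv2)
      (hf.intervalIntegrable_inner hℓ hv2), hR0] at h2
    rw [intervalIntegral.integral_sub, intervalIntegral.integral_sub
      (hp.intervalIntegrable_inner hℓ hξ2) (hp'.intervalIntegrable_inner hℓ hξ2), h2]
    · unfold EdgeEq at h1 h1'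
      simp only [inner_sub_left]
      linarith
    · exact (hp.intervalIntegrable_inner hℓ hξ2).sub (hp'.intervalIntegrable_inner hℓ hξ2)
    · exact (hR.isL2 hℓ).intervalIntegrable_inner hℓ hξ2
  have hRℓ : R ℓ = Pp - Pp' := by
    have h1 := key (fun _ => Pp - Pp' - R ℓ) (fun _ => 0) (isVPoly_const _ _) (isVPoly_const _ _)
      (fun s => hasDerivAt_const s _)
    simp only [inner_zero_right, intervalIntegral.integral_zero] at h1
    exact (sub_eq_zero.1 (inner_self_eq_zero.1 h1.symm)).symm
  refine ⟨hRℓ, fun ξ hξ => ?_⟩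
  -- The choice n = k + 1 enters here: every polynomial of degree `k` is the derivative of an
  -- admissible test function.
  obtain ⟨v, hv, hd⟩ := hξ.exists_antideriv
  rw [key v ξ hv hξ hd, hRℓ, sub_self, inner_zero_left]

/-- Quasi-optimality of a discrete approximation with perturbed orthogonality. -/
theorem l2norm_le_of_orthogonal {ℓ : ℝ} (hℓ : 0 ≤ ℓ) {k : ℕ} {e y a ρ π : ℝ → R3}
    (hy : IsL2 ℓ y) (ha : IsL2 ℓ a) (hρ : IsVPoly k ρ) (hπ : IsVPoly k π)
    (heq : ∀ᵐ s ∂volume.restrict (Ioc 0 ℓ), e s = a s - ρ s)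
    (hort : ∀ ξ, IsVPoly k ξ → ∫ s in (0 : ℝ)..ℓ, inner ℝ (e s + y s) (ξ s) = 0) :
    l2norm ℓ e ≤ 2 * l2norm ℓ (fun s => a s - π s) + l2norm ℓ y := by
  have hd := hπ.sub hρ
  have hd2 := hd.isL2 ℓ
  have hb := ha.sub (hπ.isL2 ℓ)
  have hby := hb.add hy
  -- Write e = (a - π) + (π - ρ). The second part is an admissible test function, and testing with
  -- it bounds it by a - π and y.
  have h1 := hort _ hd
  have h2 : ∫ s in (0 : ℝ)..ℓ, inner ℝ (e s + y s) (π s - ρ s)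
      = ∫ s in (0 : ℝ)..ℓ, (inner ℝ (π s - ρ s) (π s - ρ s)
        + inner ℝ (a s - π s + y s) (π s - ρ s)) := by
    apply integral_congr_Ioc hℓ
    filter_upwards [heq] with s hs
    rw [hs, ← inner_add_left]
    congr 1
    abel
  rw [h2, intervalIntegral.integral_add (hd2.intervalIntegrable_inner hℓ hd2)
    (hby.intervalIntegrable_inner hℓ hd2)] at h1
  have h3 := abs_integral_inner_le hℓ hby hd2
  have h4 := l2norm_add_le hℓ hb hy
  have h5 : l2norm ℓ (fun s => π s - ρ s) ^ 2 = ∫ s in (0 : ℝ)..ℓ,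
      inner ℝ (π s - ρ s) (π s - ρ s) := by
    rw [sq_l2norm hℓ]; simp
  have h6 : l2norm ℓ (fun s => π s - ρ s)
      ≤ l2norm ℓ (fun s => a s - π s) + l2norm ℓ y := by
    have h7 := l2norm_nonneg ℓ (fun s => π s - ρ s)
    have h8 := neg_abs_le (∫ s in (0 : ℝ)..ℓ, inner ℝ (a s - π s + y s) (π s - ρ s))
    by_contra hlt
    push Not at hlt
    nlinarith [l2norm_nonneg ℓ (fun s => a s - π s + y s)]
  have h9 : l2norm ℓ e = l2norm ℓ (fun s => (a s - π s) + (π s - ρ s)) := by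
    apply l2norm_congr_ae hℓ
    filter_upwards [heq] with s hs
    rw [hs]; abel
  rw [h9]
  linarith [l2norm_add_le hℓ hb hd2]

/-! ### The forms on a network, strut by strut -/

namespace StrutNetwork

variable {V E : Type*} (N : StrutNetwork V E)

/-- Every edge enters one vertex and leaves one vertex, so the sum over the vertices can be
rearranged as a sum over the edges. -/
theorem sum_inner_balance [Fintype V] [Fintype E] (A B : E → R3) (U : V → R3) :
    ∑ j, inner ℝ (N.balance A B j) (U j)
      = ∑ i, (inner ℝ (A i) (U (N.tgt i)) - inner ℝ (B i) (U (N.src i))) := by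
  classical
  have h : ∀ (A : E → R3) (g : E → V),
      ∑ j, inner ℝ (∑ i with g i = j, A i) (U j) = ∑ i, inner ℝ (A i) (U (g i)) := by
    intro A g
    simp only [sum_inner]
    rw [← Finset.sum_fiberwise Finset.univ g fun i => inner ℝ (A i) (U (g i))]
    refine Finset.sum_congr rfl fun j _ => Finset.sum_congr rfl fun i hi => ?_
    rw [(Finset.mem_filter.1 hi).2]
  simp only [balance, inner_sub_left, Finset.sum_sub_distrib]
  rw [← h A N.tgt, ← h B N.src]

/-- The contribution of one strut to the form `b`, without the multipliers. -/
def edgeB (i : E) (S : ForceField E) (ψ : MotionField V E) : ℝ :=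
  (∫ s in (0 : ℝ)..N.len i,
      (- inner ℝ (S.p i s) (ψ.du i s + cross (N.tangent i) (ψ.w i s))
        - inner ℝ (S.q i s) (ψ.dw i s)))
    + (inner ℝ (S.Pp i) (ψ.u i (N.len i) - ψ.U (N.tgt i))
      - inner ℝ (S.Pm i) (ψ.u i 0 - ψ.U (N.src i)))
    + (inner ℝ (S.Qp i) (ψ.w i (N.len i) - ψ.W (N.tgt i))
      - inner ℝ (S.Qm i) (ψ.w i 0 - ψ.W (N.src i)))

/-- Once the balances are moved to the edges, the vertex values appear as jumps between the ends of
the struts and the vertices, and b becomes a sum of contributions of single struts. -/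
theorem formB_eq [Fintype V] [Fintype E] (S : ForceField E) (ψ : MotionField V E) :
    N.formB S ψ = ∑ i, N.edgeB i S ψ
      + inner ℝ S.α (∑ i, ∫ s in (0 : ℝ)..N.len i, ψ.u i s)
      + inner ℝ S.β (∑ i, ∫ s in (0 : ℝ)..N.len i, ψ.w i s) := by
  simp only [formB, edgeB, sum_inner_balance, Finset.sum_add_distrib, Finset.sum_sub_distrib,
    inner_sub_right]
  ring

open Classical in
/-- A motion of a single strut. -/
def _root_.MotionField.single (i : E) (v dv w dw : ℝ → R3) : MotionField V E where
  u := Pi.single i v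
  du := Pi.single i dv
  w := Pi.single i w
  dw := Pi.single i dw
  U := 0
  W := 0

open Classical in
/-- Forces in a single strut. -/
def _root_.ForceField.single (i : E) (q p : ℝ → R3) (Pp Pm Qp Qm : R3) : ForceField E where
  q := Pi.single i q
  p := Pi.single i p
  Pp := Pi.single i Pp
  Pm := Pi.single i Pm
  Qp := Pi.single i Qp
  Qm := Pi.single i Qm
  α := 0
  β := 0

theorem formB_single [Fintype V] [Fintype E] (S : ForceField E) (i : E) (v dv w dw : ℝ → R3) :
    N.formB S (MotionField.single i v dv w dw) =
      (∫ s in (0 : ℝ)..N.len i, (- inner ℝ (S.p i s) (dv s + cross (N.tangent i) (w s))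
        - inner ℝ (S.q i s) (dw s)))
      + (inner ℝ (S.Pp i) (v (N.len i)) - inner ℝ (S.Pm i) (v 0))
      + (inner ℝ (S.Qp i) (w (N.len i)) - inner ℝ (S.Qm i) (w 0))
      + inner ℝ S.α (∫ s in (0 : ℝ)..N.len i, v s)
      + inner ℝ S.β (∫ s in (0 : ℝ)..N.len i, w s) := by
  rw [formB_eq, Finset.sum_eq_single i, Finset.sum_eq_single i, Finset.sum_eq_single i]
  · simp [edgeB, MotionField.single]
  all_goals simp +contextual [edgeB, MotionField.single]

theorem formF_single [Fintype E] (f : E → ℝ → R3) (i : E) (v dv w dw : ℝ → R3) :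
    N.formF f (MotionField.single i v dv w dw) =
      - ∫ s in (0 : ℝ)..N.len i, inner ℝ (f i s) (v s) := by
  rw [formF, Finset.sum_eq_single i]
  · simp [MotionField.single]
  all_goals simp +contextual [MotionField.single]

theorem formB_single_left [Fintype V] [Fintype E] (i : E) (q p : ℝ → R3) (Pp Pm Qp Qm : R3) (ψ : MotionField V E) :
    N.formB (ForceField.single i q p Pp Pm Qp Qm) ψ =
      (∫ s in (0 : ℝ)..N.len i,
        (- inner ℝ (p s) (ψ.du i s + cross (N.tangent i) (ψ.w i s)) - inner ℝ (q s) (ψ.dw i s)))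
      + (inner ℝ Pp (ψ.u i (N.len i) - ψ.U (N.tgt i)) - inner ℝ Pm (ψ.u i 0 - ψ.U (N.src i)))
      + (inner ℝ Qp (ψ.w i (N.len i) - ψ.W (N.tgt i))
        - inner ℝ Qm (ψ.w i 0 - ψ.W (N.src i))) := by
  rw [formB_eq, Finset.sum_eq_single i]
  · simp [edgeB, ForceField.single]
  all_goals simp +contextual [edgeB, ForceField.single]

theorem formA_single [Fintype E] (S : ForceField E) (i : E) (q p : ℝ → R3) (Pp Pm Qp Qm : R3) :
    N.formA S (ForceField.single i q p Pp Pm Qp Qm) =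
      ∫ s in (0 : ℝ)..N.len i, inner ℝ (matVec (N.compliance i s) (S.q i s)) (q s) := by
  rw [formA, Finset.sum_eq_single i]
  · simp [ForceField.single]
  all_goals simp +contextual [ForceField.single]

theorem formB_vertex [Fintype V] [Fintype E] (S : ForceField E) (U W : V → R3) :
    N.formB S ⟨0, 0, 0, 0, U, W⟩
      = - ∑ j, inner ℝ (N.balance S.Pp S.Pm j) (U j)
        - ∑ j, inner ℝ (N.balance S.Qp S.Qm j) (W j) := by
  simp [formB]

theorem formF_vertex [Fintype E] (f : E → ℝ → R3) (U W : V → R3) :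
    N.formF f ⟨0, 0, 0, 0, U, W⟩ = 0 := by
  simp [formF]

theorem _root_.isPrim_zero {ℓ : ℝ} : IsPrim ℓ 0 0 := ⟨isL2_const 0, fun s _ => by simp⟩

theorem _root_.isPolyOn_zero (ℓ : ℝ) (n : ℕ) : IsPolyOn ℓ n 0 := isPolyOn_of_isVPoly (isVPoly_const n 0) ℓ

variable {N}

theorem memM_single (hlen : ∀ i, 0 < N.len i) (i : E) {v dv w dw : ℝ → R3}
    (hv : IsPrim (N.len i) v dv) (hw : IsPrim (N.len i) w dw) :
    N.MemM (MotionField.single (V := V) i v dv w dw) := by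
  classical
  constructor <;> intro e <;> rcases eq_or_ne e i with rfl | hne
  · simpa [MotionField.single] using hv.isH1 (hlen e).le
  · simpa [MotionField.single, hne] using isPrim_zero.isH1 (hlen e).le
  · simpa [MotionField.single] using hw.isH1 (hlen e).le
  · simpa [MotionField.single, hne] using isPrim_zero.isH1 (hlen e).le

theorem memMh_single (hlen : ∀ i, 0 < N.len i) (i : E) {n : ℕ} {v dv w dw : ℝ → R3}
    (hv : IsPrim (N.len i) v dv) (hw : IsPrim (N.len i) w dw) (hvn : IsVPoly n v)
    (hwn : IsVPoly n w) : N.MemMh n (MotionField.single (V := V) i v dv w dw) := by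
  classical
  refine ⟨memM_single hlen i hv hw, ?_, ?_⟩ <;> intro e <;> rcases eq_or_ne e i with rfl | hne
  · simpa [MotionField.single] using isPolyOn_of_isVPoly hvn _
  · simpa [MotionField.single, hne] using isPolyOn_zero _ _
  · simpa [MotionField.single] using isPolyOn_of_isVPoly hwn _
  · simpa [MotionField.single, hne] using isPolyOn_zero _ _

theorem memV_single (i : E) {q p : ℝ → R3} (Pp Pm Qp Qm : R3)
    (hq : IsL2 (N.len i) q) (hp : IsL2 (N.len i) p) :
    N.MemV (ForceField.single i q p Pp Pm Qp Qm) := by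
  classical
  constructor <;> intro e <;> rcases eq_or_ne e i with rfl | hne
  · simpa [ForceField.single] using hq
  · simpa [ForceField.single, hne] using isPrim_zero.mem
  · simpa [ForceField.single] using hp
  · simpa [ForceField.single, hne] using isPrim_zero.mem

theorem memVh_single (i : E) {k : ℕ} {q p : ℝ → R3} (Pp Pm Qp Qm : R3)
    (hq : IsVPoly k q) (hp : IsVPoly k p) :
    N.MemVh k (ForceField.single i q p Pp Pm Qp Qm) := by
  classical
  refine ⟨memV_single i Pp Pm Qp Qm (hq.isL2 _) (hp.isL2 _), ?_, ?_⟩ <;> intro e <;>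
    rcases eq_or_ne e i with rfl | hne
  · simpa [ForceField.single] using isPolyOn_of_isVPoly hq _
  · simpa [ForceField.single, hne] using isPolyOn_zero _ _
  · simpa [ForceField.single] using isPolyOn_of_isVPoly hp _
  · simpa [ForceField.single, hne] using isPolyOn_zero _ _

theorem memMh_vertex (hlen : ∀ i, 0 < N.len i) (n : ℕ) (U W : V → R3) :
    N.MemMh n ⟨0, 0, 0, 0, U, W⟩ :=
  ⟨⟨fun i => isPrim_zero.isH1 (hlen i).le, fun i => isPrim_zero.isH1 (hlen i).le⟩,
    fun _ => isPolyOn_zero _ _,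
    fun _ => isPolyOn_zero _ _⟩

/-- Testing with translations of single struts. -/
theorem edgeEq_force [Fintype V] [Fintype E] {f : E → ℝ → R3} {S : ForceField E} {i : E} {v ξ : ℝ → R3}
    (h : N.formB S (MotionField.single (V := V) i v ξ 0 0)
      = N.formF f (MotionField.single (V := V) i v ξ 0 0)) :
    EdgeEq (N.len i) (S.p i) (f i) (S.Pp i) (S.Pm i) S.α v ξ := by
  rw [formB_single, formF_single] at h
  simpa [EdgeEq] using h

/-- Testing with rotations of single struts. -/
theorem edgeEq_moment [Fintype V] [Fintype E] {f : E → ℝ → R3} {S : ForceField E} {i : E} {w ξ : ℝ → R3}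
    (hℓ : 0 ≤ N.len i) (hp : IsL2 (N.len i) (S.p i)) (hq : IsL2 (N.len i) (S.q i))
    (hw : IsPrim (N.len i) w ξ)
    (h : N.formB S (MotionField.single (V := V) i 0 0 w ξ)
      = N.formF f (MotionField.single (V := V) i 0 0 w ξ)) :
    EdgeEq (N.len i) (S.q i) (fun s => - cross (S.p i s) (N.tangent i)) (S.Qp i) (S.Qm i) S.β
      w ξ := by
  rw [formB_single, formF_single] at h
  have h1 : ∫ s in (0 : ℝ)..N.len i, (- inner ℝ (S.p i s) (cross (N.tangent i) (w s))
      - inner ℝ (S.q i s) (ξ s)) = -(∫ s in (0 : ℝ)..N.len i,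
        inner ℝ (cross (S.p i s) (N.tangent i)) (w s))
      - ∫ s in (0 : ℝ)..N.len i, inner ℝ (S.q i s) (ξ s) := by
    simp only [inner_cross]
    have h2 : IsL2 (N.len i) (fun s => cross (S.p i s) (N.tangent i)) := by
      simpa using hp.clm (crossR (N.tangent i))
    rw [intervalIntegral.integral_sub
      (f := fun s => - inner ℝ (cross (S.p i s) (N.tangent i)) (w s))
      (h2.intervalIntegrable_inner hℓ (hw.isL2 hℓ)).neg
      (hq.intervalIntegrable_inner hℓ hw.mem), intervalIntegral.integral_neg]
  simp only [Pi.zero_apply, zero_add, inner_zero_right, intervalIntegral.integral_zero,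
    sub_self, add_zero, neg_zero, h1] at h
  simp only [EdgeEq, inner_neg_left, intervalIntegral.integral_neg, neg_neg]
  linarith

theorem balance_eq_zero_of_tests [Fintype V] [Fintype E] {S : ForceField E}
    (h : ∀ U W : V → R3, N.formB S ⟨0, 0, 0, 0, U, W⟩ = 0) (j : V) :
    N.balance S.Pp S.Pm j = 0 ∧ N.balance S.Qp S.Qm j = 0 := by
  classical
  constructor
  · have := h (Pi.single j (N.balance S.Pp S.Pm j)) 0
    rw [formB_vertex, Finset.sum_eq_single j] at this
    · simpa using this
    · intro b _ hb; simp [hb]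
    · simp
  · have := h 0 (Pi.single j (N.balance S.Qp S.Qm j))
    rw [formB_vertex, Finset.sum_eq_single (f := fun j_1 => inner ℝ (N.balance S.Qp S.Qm j_1) _) j]
      at this
    · simpa using this
    · intro b _ hb; simp [hb]
    · simp

end StrutNetwork

/-! ### ### The equations contained in the continuous and the discrete problem -/

namespace StrutNetwork

variable {V E : Type*} {N : StrutNetwork V E}

/-- The compliance as an operator. -/
def complianceOp (N : StrutNetwork V E) (i : E) (s : ℝ) : R3 →L[ℝ] R3 := matCLM (N.compliance i s)

theorem memVh_multipliers (N : StrutNetwork V E) (k : ℕ) (α β : R3) :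
    N.MemVh k ⟨0, 0, 0, 0, 0, 0, α, β⟩ :=
  ⟨⟨fun _ => isPrim_zero.mem, fun _ => isPrim_zero.mem⟩,
    fun _ => isPolyOn_zero _ _, fun _ => isPolyOn_zero _ _⟩

section Tests

variable [Fintype V] [Fintype E] {S : ForceField E} {φ : MotionField V E} {k : ℕ}

/-- The end forces and moments are multipliers for the continuity at the vertices. They are
unrestricted in every discrete space, and the test fields have q = p = 0, so this applies to exact
and discrete motions alike. -/
theorem nodal_of_tests (h : ∀ G, N.MemVh k G → N.formA S G + N.formB G φ = 0) (i : E) :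
    φ.u i (N.len i) = φ.U (N.tgt i) ∧ φ.u i 0 = φ.U (N.src i) ∧
      φ.w i (N.len i) = φ.W (N.tgt i) ∧ φ.w i 0 = φ.W (N.src i) := by
  have hz : IsVPoly k 0 := isVPoly_const k 0
  have key : ∀ Pp Pm Qp Qm : R3,
      (inner ℝ Pp (φ.u i (N.len i) - φ.U (N.tgt i)) - inner ℝ Pm (φ.u i 0 - φ.U (N.src i)))
      + (inner ℝ Qp (φ.w i (N.len i) - φ.W (N.tgt i))
        - inner ℝ Qm (φ.w i 0 - φ.W (N.src i))) = 0 := by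
    intro Pp Pm Qp Qm
    have h1 := h _ (memVh_single i Pp Pm Qp Qm hz hz)
    rw [formB_single_left, formA_single] at h1
    simpa only [Pi.zero_apply, inner_zero_left, inner_zero_right, neg_zero, sub_zero,
      intervalIntegral.integral_zero, zero_add] using h1
  refine ⟨?_, ?_, ?_, ?_⟩ <;> rw [← sub_eq_zero, ← inner_self_eq_zero (𝕜 := ℝ)]
  · simpa using key (φ.u i (N.len i) - φ.U (N.tgt i)) 0 0 0
  · simpa using key 0 (φ.u i 0 - φ.U (N.src i)) 0 0
  · simpa using key 0 0 (φ.w i (N.len i) - φ.W (N.tgt i)) 0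
  · simpa using key 0 0 0 (φ.w i 0 - φ.W (N.src i))

theorem mean_of_tests (h : ∀ G, N.MemVh k G → N.formA S G + N.formB G φ = 0) :
    ∑ i, ∫ s in (0 : ℝ)..N.len i, φ.u i s = 0 ∧ ∑ i, ∫ s in (0 : ℝ)..N.len i, φ.w i s = 0 := by
  have key : ∀ α β : R3, inner ℝ α (∑ i, ∫ s in (0 : ℝ)..N.len i, φ.u i s)
      + inner ℝ β (∑ i, ∫ s in (0 : ℝ)..N.len i, φ.w i s) = 0 := by
    intro α β
    have h1 := h _ (memVh_multipliers N k α β)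
    simpa [formA, formB, balance] using h1
  refine ⟨?_, ?_⟩ <;> rw [← inner_self_eq_zero (𝕜 := ℝ)]
  · simpa using key (∑ i, ∫ s in (0 : ℝ)..N.len i, φ.u i s) 0
  · simpa using key 0 (∑ i, ∫ s in (0 : ℝ)..N.len i, φ.w i s)

theorem strain_test {i : E} {ξ : ℝ → R3}
    (h : N.formA S (ForceField.single i 0 ξ 0 0 0 0)
      + N.formB (ForceField.single i 0 ξ 0 0 0 0) φ = 0) :
    ∫ s in (0 : ℝ)..N.len i, inner ℝ (φ.du i s + cross (N.tangent i) (φ.w i s)) (ξ s) = 0 := by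
  rw [formB_single_left, formA_single] at h
  simp only [Pi.zero_apply, inner_zero_left, inner_zero_right, sub_zero,
    intervalIntegral.integral_zero, zero_add, add_zero, intervalIntegral.integral_neg,
    neg_eq_zero] at h
  simpa only [real_inner_comm] using h

theorem curvature_test {i : E} {ξ : ℝ → R3} (hℓ : 0 ≤ N.len i) (hξ : IsL2 (N.len i) ξ)
    (hdw : IsL2 (N.len i) (φ.dw i))
    (hCq : IsL2 (N.len i) (fun s => N.complianceOp i s (S.q i s)))
    (h : N.formA S (ForceField.single i ξ 0 0 0 0 0)
      + N.formB (ForceField.single i ξ 0 0 0 0 0) φ = 0) :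
    ∫ s in (0 : ℝ)..N.len i, inner ℝ (φ.dw i s - N.complianceOp i s (S.q i s)) (ξ s) = 0 := by
  rw [formB_single_left, formA_single] at h
  simp only [Pi.zero_apply, inner_zero_left, neg_zero, zero_sub,
    add_zero, sub_zero, intervalIntegral.integral_neg, matVec_eq] at h
  simp only [inner_sub_left]
  rw [intervalIntegral.integral_sub (hdw.intervalIntegrable_inner hℓ hξ)
    (hCq.intervalIntegrable_inner hℓ hξ)]
  simp only [real_inner_comm] at h ⊢
  unfold complianceOp
  linarith

end Tests

section Solves

variable [Fintype V] [Fintype E] {f : E → ℝ → R3} {S : ForceField E} {φ : MotionField V E}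

theorem Solves.exists_force (hlen : ∀ i, 0 < N.len i) (hf : ∀ i, IsL2 (N.len i) (f i))
    (h : N.Solves f S φ) (i : E) :
    ∃ P, IsPrim (N.len i) P (fun s => -(f i s + S.α)) ∧ P 0 = S.Pm i ∧ P (N.len i) = S.Pp i ∧
      ∀ᵐ s ∂volume.restrict (Ioc 0 (N.len i)), S.p i s = P s :=
  exists_prim_of_edgeEq (hlen i).le (h.mem_V.p_mem i) (hf i) fun _ _ hv =>
    edgeEq_force (h.eq_M _ (memM_single hlen i hv isPrim_zero))

theorem Solves.exists_moment (hlen : ∀ i, 0 < N.len i)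
    (h : N.Solves f S φ) (i : E) :
    ∃ Q, IsPrim (N.len i) Q (fun s => -(-cross (S.p i s) (N.tangent i) + S.β)) ∧
      Q 0 = S.Qm i ∧ Q (N.len i) = S.Qp i ∧
      ∀ᵐ s ∂volume.restrict (Ioc 0 (N.len i)), S.q i s = Q s := by
  refine exists_prim_of_edgeEq (hlen i).le (h.mem_V.q_mem i) ?_ fun _ _ hv =>
    edgeEq_moment (hlen i).le (h.mem_V.p_mem i) (h.mem_V.q_mem i) hv
      (h.eq_M _ (memM_single hlen i isPrim_zero hv))
  simpa using ((h.mem_V.p_mem i).clm (crossR (N.tangent i))).neg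

theorem Solves.balance_eq_zero (hlen : ∀ i, 0 < N.len i) (h : N.Solves f S φ) (j : V) :
    N.balance S.Pp S.Pm j = 0 ∧ N.balance S.Qp S.Qm j = 0 :=
  balance_eq_zero_of_tests (fun U W => by
    rw [h.eq_M _ (memMh_vertex hlen 0 U W).mem, formF_vertex]) j

/-- The strain of the solution is square integrable, hence an admissible test force; testing with it
makes it vanish. -/
theorem Solves.isPrim_u (hlen : ∀ i, 0 < N.len i) (h : N.Solves f S φ) (i : E) :
    IsPrim (N.len i) (φ.u i) (fun s => -cross (N.tangent i) (φ.w i s)) ∧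
      ∀ᵐ s ∂volume.restrict (Ioc 0 (N.len i)), φ.du i s = -cross (N.tangent i) (φ.w i s) := by
  have h1 := (h.mem_M.u_mem i).isPrim (hlen i)
  have h2 := (h.mem_M.w_mem i).isPrim (hlen i)
  have h3 : IsL2 (N.len i) (fun s => φ.du i s + cross (N.tangent i) (φ.w i s)) :=
    h1.mem.add ((h2.isL2 (hlen i).le).clm (crossL (N.tangent i)))
  have h4 := ae_eq_zero_of_l2norm_eq_zero (hlen i).le h3
    (strain_test (h.eq_V _ (memV_single i 0 0 0 0 isPrim_zero.mem h3)))
  have h5 : ∀ᵐ s ∂volume.restrict (Ioc 0 (N.len i)),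
      φ.du i s = -cross (N.tangent i) (φ.w i s) := by
    filter_upwards [h4] with s hs
    exact eq_neg_of_add_eq_zero_left hs
  exact ⟨h1.congr_ae h5, h5⟩

theorem Solves.isPrim_w (hlen : ∀ i, 0 < N.len i)
    (hC : ∀ i, ContinuousOn (N.complianceOp i) (Icc 0 (N.len i)))
    (h : N.Solves f S φ) (i : E) :
    IsPrim (N.len i) (φ.w i) (fun s => N.complianceOp i s (S.q i s)) ∧
      ∀ᵐ s ∂volume.restrict (Ioc 0 (N.len i)), φ.dw i s = N.complianceOp i s (S.q i s) := by
  have h2 := (h.mem_M.w_mem i).isPrim (hlen i)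
  have hq := isL2_clm_apply (hC i) (h.mem_V.q_mem i)
  have h3 := h2.mem.sub hq
  have h4 := ae_eq_zero_of_l2norm_eq_zero (hlen i).le h3
    (curvature_test (hlen i).le h3 h2.mem hq
      (h.eq_V _ (memV_single i 0 0 0 0 h3 isPrim_zero.mem)))
  have h5 : ∀ᵐ s ∂volume.restrict (Ioc 0 (N.len i)),
      φ.dw i s = N.complianceOp i s (S.q i s) := by
    filter_upwards [h4] with s hs
    exact sub_eq_zero.1 hs
  exact ⟨h2.congr_ae h5, h5⟩

end Solves

/-- The fields `du` and `dw` are weak derivatives and determined only almost everywhere; they are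
identified with the derivatives of the polynomials by uniqueness of densities. -/
theorem MemMh.exists_poly (hlen : ∀ i, 0 < N.len i) {k : ℕ} {φ : MotionField V E}
    (h : N.MemMh (k + 1) φ) (i : E) :
    (∃ v, IsVPoly k v ∧ ∀ᵐ s ∂volume.restrict (Ioc 0 (N.len i)), φ.du i s = v s) ∧
    ∃ v, IsVPoly k v ∧ ∀ᵐ s ∂volume.restrict (Ioc 0 (N.len i)), φ.dw i s = v s := by
  have key : ∀ u du, IsH1 (N.len i) u du → IsPolyOn (N.len i) (k + 1) u →
      ∃ v, IsVPoly k v ∧ ∀ᵐ s ∂volume.restrict (Ioc 0 (N.len i)), du s = v s := by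
    intro u du h1 h2
    obtain ⟨p, hp, hup⟩ := h2.exists_isVPoly
    obtain ⟨v, hv, hd⟩ := hp.exists_deriv
    refine ⟨v, hv, (h1.isPrim (hlen i)).ae_unique (hlen i).le ?_⟩
    exact (hv.isPrim hd).congr (hlen i).le fun s hs => (hup s hs).symm
  exact ⟨key _ _ (h.mem.u_mem i) (h.u_poly i), key _ _ (h.mem.w_mem i) (h.w_poly i)⟩

section Balance

variable [Fintype E]

theorem balance_add (A A' B B' : E → R3) (j : V) :
    N.balance (fun i => A i + A' i) (fun i => B i + B' i) j
      = N.balance A B j + N.balance A' B' j := by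
  simp only [balance, Finset.sum_add_distrib]
  abel

theorem balance_smul (c : ℝ) (A B : E → R3) (j : V) :
    N.balance (fun i => c • A i) (fun i => c • B i) j = c • N.balance A B j := by
  simp only [balance, ← Finset.smul_sum, smul_sub]

theorem balance_sub (A A' B B' : E → R3) (j : V) :
    N.balance (fun i => A i - A' i) (fun i => B i - B' i) j
      = N.balance A B j - N.balance A' B' j := by
  simp only [balance, Finset.sum_sub_distrib]
  abel

theorem norm_balance_le (A B : E → R3) (j : V) :
    ‖N.balance A B j‖ ≤ ∑ i, ‖A i‖ + ∑ i, ‖B i‖ := by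
  classical
  refine (norm_sub_le _ _).trans (add_le_add ?_ ?_) <;>
  exact (norm_sum_le _ _).trans (Finset.sum_le_sum_of_subset_of_nonneg (Finset.filter_subset _ _)
    fun _ _ _ => norm_nonneg _)

end Balance

/-! ### Subdivisions -/

theorem norm_tangent (hN : ∀ i, N.pos (N.src i) ≠ N.pos (N.tgt i)) (i : E) :
    ‖N.tangent i‖ = 1 := by
  have h : 0 < N.len i := dist_pos.2 (hN i)
  rw [tangent, norm_smul, ← dist_eq_norm, dist_comm, norm_inv, Real.norm_of_nonneg h.le]
  exact inv_mul_cancel₀ h.ne'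

theorem len_smul_tangent (hN : ∀ i, N.pos (N.src i) ≠ N.pos (N.tgt i)) (i : E) :
    N.len i • N.tangent i = N.pos (N.tgt i) - N.pos (N.src i) := by
  have h : 0 < N.len i := dist_pos.2 (hN i)
  rw [tangent, smul_smul, mul_inv_cancel₀ h.ne', one_smul]

namespace Subdivision

variable (T : N.Subdivision)

/-- The vertices of the subdivision on the strut `i`, in their order. -/
def nodeVertex (i : E) : Fin (T.m i + 2) → V ⊕ (Σ i, Fin (T.m i)) :=
  Fin.cases (motive := fun _ => V ⊕ (Σ i, Fin (T.m i))) (Sum.inl (N.src i))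
    (Fin.lastCases (motive := fun _ => V ⊕ (Σ i, Fin (T.m i))) (Sum.inl (N.tgt i))
      fun j => Sum.inr ⟨i, j⟩)

@[simp] theorem nodeVertex_zero (i : E) : T.nodeVertex i 0 = Sum.inl (N.src i) := rfl

@[simp] theorem nodeVertex_last (i : E) :
    T.nodeVertex i (Fin.last (T.m i + 1)) = Sum.inl (N.tgt i) := by
  change T.nodeVertex i (Fin.last (T.m i)).succ = _
  rw [nodeVertex, Fin.cases_succ, Fin.lastCases_last]

@[simp] theorem nodeVertex_interior (i : E) (j : Fin (T.m i)) :
    T.nodeVertex i j.castSucc.succ = Sum.inr ⟨i, j⟩ := by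
  simp [nodeVertex]

theorem refine_tgt (e : Σ i, Fin (T.m i + 1)) :
    T.refine.tgt e = T.nodeVertex e.1 e.2.succ := rfl

theorem refine_src (e : Σ i, Fin (T.m i + 1)) :
    T.refine.src e = T.nodeVertex e.1 e.2.castSucc := by
  obtain ⟨i, j⟩ := e
  induction j using Fin.cases with
  | zero => rfl
  | succ j =>
    rw [← Fin.succ_castSucc, nodeVertex_interior]
    rfl

theorem pos_nodeVertex (hN : ∀ i, N.pos (N.src i) ≠ N.pos (N.tgt i)) (i : E)
    (j : Fin (T.m i + 2)) :
    T.refine.pos (T.nodeVertex i j) = N.pos (N.src i) + T.node i j • N.tangent i := by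
  induction j using Fin.cases with
  | zero => rw [T.first]; simp [refine]
  | succ j =>
    induction j using Fin.lastCases with
    | last =>
      rw [Fin.succ_last, T.last, len_smul_tangent hN, nodeVertex_last]
      simp [refine]
    | cast j =>
      rw [nodeVertex_interior, Fin.succ_castSucc]
      rfl

/-- The arc length at which an element starts. -/
def start (e : Σ i, Fin (T.m i + 1)) : ℝ := T.node e.1 e.2.castSucc

theorem node_lt (e : Σ i, Fin (T.m i + 1)) : T.start e < T.node e.1 e.2.succ :=
  T.mono e.1 Fin.castSucc_lt_succ

theorem refine_len (hN : ∀ i, N.pos (N.src i) ≠ N.pos (N.tgt i)) (e : Σ i, Fin (T.m i + 1)) :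
    T.refine.len e = T.node e.1 e.2.succ - T.start e := by
  have h := T.node_lt e
  rw [len, refine_tgt, refine_src, pos_nodeVertex T hN, pos_nodeVertex T hN, dist_add_left,
    dist_eq_norm, ← sub_smul, norm_smul, norm_tangent hN, mul_one, norm_sub_rev]
  exact Real.norm_of_nonneg (sub_nonneg.2 h.le)

theorem refine_len_pos (hN : ∀ i, N.pos (N.src i) ≠ N.pos (N.tgt i))
    (e : Σ i, Fin (T.m i + 1)) : 0 < T.refine.len e := by
  rw [T.refine_len hN]
  exact sub_pos.2 (T.node_lt e)

theorem refine_tangent (hN : ∀ i, N.pos (N.src i) ≠ N.pos (N.tgt i))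
    (e : Σ i, Fin (T.m i + 1)) : T.refine.tangent e = N.tangent e.1 := by
  have h := T.refine_len_pos hN e
  rw [tangent, refine_tgt, refine_src, pos_nodeVertex T hN, pos_nodeVertex T hN,
    add_sub_add_left_eq_sub, ← sub_smul]
  change _ • (T.node e.1 e.2.succ - T.start e) • _ = _
  rw [← T.refine_len hN, smul_smul, inv_mul_cancel₀ h.ne', one_smul]

theorem refine_complianceOp (e : Σ i, Fin (T.m i + 1)) (s : ℝ) :
    T.refine.complianceOp e s = N.complianceOp e.1 (T.start e + s) := rfl

theorem node_mem (i : E) (j : Fin (T.m i + 2)) : T.node i j ∈ Icc 0 (N.len i) := by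
  have h := (T.mono i).monotone
  constructor
  · rw [← T.first i]; exact h (Fin.zero_le j)
  · rw [← T.last i]; exact h (Fin.le_last j)

theorem start_nonneg (e : Σ i, Fin (T.m i + 1)) : 0 ≤ T.start e := (T.node_mem _ _).1

theorem start_add_len_le (hN : ∀ i, N.pos (N.src i) ≠ N.pos (N.tgt i))
    (e : Σ i, Fin (T.m i + 1)) : T.start e + T.refine.len e ≤ N.len e.1 := by
  rw [T.refine_len hN]
  linarith [(T.node_mem e.1 e.2.succ).2]

variable [Fintype E]

theorem balance_inr (A B : (Σ i, Fin (T.m i + 1)) → R3) (i : E) (j : Fin (T.m i)) :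
    T.refine.balance A B (Sum.inr ⟨i, j⟩) = A ⟨i, j.castSucc⟩ - B ⟨i, j.succ⟩ := by
  classical
  have h1 : ∀ e : Σ i, Fin (T.m i + 1),
      T.refine.tgt e = Sum.inr ⟨i, j⟩ ↔ e = ⟨i, j.castSucc⟩ := by
    rintro ⟨i', j'⟩
    rw [refine_tgt]
    induction j' using Fin.lastCases with
    | last =>
      rw [Fin.succ_last, nodeVertex_last]
      simp only [reduceCtorEq, false_iff]
      intro h
      obtain rfl := congrArg Sigma.fst h
      simp [Fin.ext_iff] at h
      omega
    | cast j' =>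
      rw [nodeVertex_interior]
      constructor
      · intro h; cases h; rfl
      · intro h
        obtain rfl := congrArg Sigma.fst h
        simpa [Fin.ext_iff] using h
  have h2 : ∀ e : Σ i, Fin (T.m i + 1),
      T.refine.src e = Sum.inr ⟨i, j⟩ ↔ e = ⟨i, j.succ⟩ := by
    rintro ⟨i', j'⟩
    rw [refine_src]
    induction j' using Fin.cases with
    | zero =>
      simp only [Fin.castSucc_zero, nodeVertex_zero, reduceCtorEq, false_iff]
      intro h
      obtain rfl := congrArg Sigma.fst h
      simp [Fin.ext_iff] at h
    | succ j' =>
      rw [← Fin.succ_castSucc, nodeVertex_interior]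
      constructor
      · intro h; cases h; rfl
      · intro h
        obtain rfl := congrArg Sigma.fst h
        simpa [Fin.ext_iff] using h
  simp only [balance, h1, h2]
  rw [Finset.sum_filter, Finset.sum_filter, Finset.sum_ite_eq', Finset.sum_ite_eq']
  simp

theorem balance_inl (A B : (Σ i, Fin (T.m i + 1)) → R3) (a : V) :
    T.refine.balance A B (Sum.inl a)
      = N.balance (fun i => A ⟨i, Fin.last (T.m i)⟩) (fun i => B ⟨i, 0⟩) a := by
  classical
  simp only [balance, Finset.sum_filter]
  rw [Fintype.sum_sigma, Fintype.sum_sigma]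
  congr 1
  · refine Finset.sum_congr rfl fun i _ => ?_
    rw [Fin.sum_univ_castSucc, Finset.sum_eq_zero, zero_add]
    · rw [refine_tgt, Fin.succ_last, nodeVertex_last]
      simp
    · intro j _
      rw [refine_tgt, nodeVertex_interior]
      simp
  · refine Finset.sum_congr rfl fun i _ => ?_
    rw [Fin.sum_univ_succ, Finset.sum_eq_zero, add_zero]
    · rw [refine_src, Fin.castSucc_zero, nodeVertex_zero]
      simp
    · intro j _
      rw [refine_src, ← Fin.succ_castSucc, nodeVertex_interior]
      simp

end Subdivision

end StrutNetwork

theorem norm_sub_zero_le_sum {G : Type*} [SeminormedAddCommGroup G] {n : ℕ} (X : Fin (n + 1) → G)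
    (j : Fin (n + 1)) : ‖X j - X 0‖ ≤ ∑ l : Fin n, ‖X l.succ - X l.castSucc‖ := by
  induction n with
  | zero => rw [Fin.fin_one_eq_zero j]; simp
  | succ n ih =>
    rw [Fin.sum_univ_castSucc]
    induction j using Fin.lastCases with
    | last =>
      have h := ih (fun l => X l.castSucc) (Fin.last n)
      have h2 : X (Fin.last (n + 1)) - X 0
          = (X (Fin.last n).castSucc - X 0) + (X (Fin.last n).succ - X (Fin.last n).castSucc) := by
        rw [Fin.succ_last]; abel
      rw [h2]
      refine (norm_add_le _ _).trans ?_
      gcongr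
      exact h
    | cast j =>
      refine (ih (fun l => X l.castSucc) j).trans ?_
      exact le_add_of_nonneg_right (norm_nonneg _)

theorem sum_integral_nodes {G : ℝ → ℝ} (hG : Continuous G) {n : ℕ} (x : Fin (n + 1) → ℝ) :
    ∑ j : Fin n, ∫ s in (0 : ℝ)..(x j.succ - x j.castSucc), G (x j.castSucc + s)
      = ∫ s in (x 0)..(x (Fin.last n)), G s := by
  simp only [intervalIntegral.integral_comp_add_left (fun s => G s), add_zero, add_sub_cancel]
  induction n with
  | zero => simp
  | succ n ih =>
    rw [Fin.sum_univ_castSucc]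
    have := ih (fun j => x j.castSucc)
    simp only [Fin.succ_castSucc, Fin.castSucc_zero] at this ⊢
    rw [this, Fin.succ_last]
    exact intervalIntegral.integral_add_adjacent_intervals (hG.intervalIntegrable _ _)
      (hG.intervalIntegrable _ _)

/-! ### The compliance -/

theorem matCLM_coord (A : Matrix (Fin 3) (Fin 3) ℝ) (x : R3) (a : Fin 3) :
    matCLM A x a = A a 0 * x 0 + A a 1 * x 1 + A a 2 * x 2 := by
  rw [← matVec_eq]
  simp [matVec, Matrix.mulVec, dotProduct, Fin.sum_univ_three]

theorem inner_matCLM (A : Matrix (Fin 3) (Fin 3) ℝ) (x y : R3) :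
    inner ℝ (matCLM A x) y = inner ℝ x (matCLM Aᵀ y) := by
  simp only [inner_R3, matCLM_coord, Matrix.transpose_apply]
  ring

theorem matCLM_mul (A B : Matrix (Fin 3) (Fin 3) ℝ) (x : R3) :
    matCLM (A * B) x = matCLM A (matCLM B x) := by
  simp [matCLM]

namespace StrutNetwork

variable {V E : Type*} {N : StrutNetwork V E}

theorem IsStent.len_pos (hN : N.IsStent) (i : E) : 0 < N.len i := dist_pos.2 (hN.nondegenerate i)

/-- The inverses of the stiffnesses. -/
def softness (N : StrutNetwork V E) (i : E) : Fin 3 → ℝ :=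
  ![(N.shear i * N.torsion i)⁻¹, (N.young i * N.inertiaN i)⁻¹, (N.young i * N.inertiaB i)⁻¹]

theorem IsStent.softness_pos (hN : N.IsStent) (i : E) (a : Fin 3) : 0 < N.softness i a := by
  have h1 := hN.shear_pos i
  have h2 := hN.torsion_pos i
  have h3 := hN.young_pos i
  have h4 := hN.inertiaN_pos i
  have h5 := hN.inertiaB_pos i
  fin_cases a <;> simp [softness] <;> positivity

theorem IsStent.inv_stiffness (hN : N.IsStent) (i : E) :
    (N.stiffness i)⁻¹ = Matrix.diagonal (N.softness i) := by
  have h1 := (hN.shear_pos i).ne'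
  have h2 := (hN.torsion_pos i).ne'
  have h3 := (hN.young_pos i).ne'
  have h4 := (hN.inertiaN_pos i).ne'
  have h5 := (hN.inertiaB_pos i).ne'
  apply Matrix.inv_eq_right_inv
  rw [stiffness, Matrix.diagonal_mul_diagonal, ← Matrix.diagonal_one]
  congr 1
  ext a
  fin_cases a <;> simp [softness] <;> field_simp

theorem IsStent.complianceOp_symm (hN : N.IsStent) (i : E) (s : ℝ) (x y : R3) :
    inner ℝ (N.complianceOp i s x) y = inner ℝ x (N.complianceOp i s y) := by
  rw [complianceOp, inner_matCLM]
  congr 3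
  rw [compliance, hN.inv_stiffness, Matrix.transpose_mul, Matrix.transpose_mul,
    Matrix.transpose_transpose, Matrix.diagonal_transpose, Matrix.mul_assoc]

/-- In the rotated frame the compliance is diagonal with positive entries; γ is the smallest of them
over the finitely many struts. -/
theorem IsStent.exists_coercive [Fintype E] (hN : N.IsStent) :
    ∃ γ, 0 < γ ∧ ∀ i, ∀ s ∈ Icc 0 (N.len i), ∀ x : R3,
      γ * ‖x‖ ^ 2 ≤ inner ℝ (N.complianceOp i s x) x := by
  have := hN.nonempty
  obtain ⟨⟨i₀, a₀⟩, h₀⟩ := Finite.exists_min (fun p : E × Fin 3 => N.softness p.1 p.2)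
  refine ⟨N.softness i₀ a₀, hN.softness_pos i₀ a₀, fun i s hs x => ?_⟩
  have hR := (Matrix.mem_specialOrthogonalGroup_iff.1 (hN.frame_rotation i s hs)).1
  have hR2 : N.frame i s * (N.frame i s)ᵀ = 1 := by
    have := (Matrix.mem_orthogonalGroup_iff (Fin 3) ℝ).1 hR
    simpa [Matrix.star_eq_conjTranspose] using this
  set y := matCLM (N.frame i s)ᵀ x with hy
  have h1 : inner ℝ (N.complianceOp i s x) x = inner ℝ (matCLM (Matrix.diagonal (N.softness i)) y) y := by
    rw [complianceOp, compliance, hN.inv_stiffness, matCLM_mul, matCLM_mul, inner_matCLM]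
  have h2 : ‖y‖ ^ 2 = ‖x‖ ^ 2 := by
    rw [← real_inner_self_eq_norm_sq, ← real_inner_self_eq_norm_sq, hy, inner_matCLM,
      Matrix.transpose_transpose, ← matCLM_mul, hR2]
    simp [matCLM]
  rw [h1, ← h2, norm_sq_R3, inner_R3]
  simp only [matCLM_coord, Matrix.diagonal_apply, Fin.isValue]
  norm_num [Fin.ext_iff]
  have k0 := h₀ (i, 0)
  have k1 := h₀ (i, 1)
  have k2 := h₀ (i, 2)
  simp only at k0 k1 k2
  nlinarith [mul_nonneg (sub_nonneg.2 k0) (sq_nonneg (y 0)),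
    mul_nonneg (sub_nonneg.2 k1) (sq_nonneg (y 1)), mul_nonneg (sub_nonneg.2 k2) (sq_nonneg (y 2))]

theorem IsStent.contDiffOn_complianceOp (hN : N.IsStent) (i : E) :
    ContDiffOn ℝ ∞ (N.complianceOp i) (Icc 0 (N.len i)) := by
  have h1 : ∀ A : Matrix (Fin 3) (Fin 3) ℝ,
      matCLM A = ∑ a, ∑ b, A a b • matCLM (Matrix.single a b 1) := by
    intro A
    conv_lhs => rw [Matrix.matrix_eq_sum_single A]
    unfold matCLM
    simp only [map_sum]
    refine Finset.sum_congr rfl fun a _ => Finset.sum_congr rfl fun b _ => ?_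
    rw [← map_smul, Matrix.smul_single, smul_eq_mul, mul_one]
  have h2 : ∀ a b, ContDiffOn ℝ ∞ (fun s => N.compliance i s a b) (Icc 0 (N.len i)) := by
    intro a b
    have hf := hN.frame_smooth i
    simp only [compliance, hN.inv_stiffness, Matrix.mul_apply, Matrix.transpose_apply,
      Matrix.diagonal_apply, mul_ite, mul_zero, Finset.sum_ite_eq', Finset.mem_univ, if_true]
    exact ContDiffOn.sum fun l _ => ((hf a l).mul contDiffOn_const).mul (hf b l)
  unfold complianceOp
  rw [show (fun s => matCLM (N.compliance i s)) = fun s => ∑ a, ∑ b,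
    N.compliance i s a b • matCLM (Matrix.single a b 1) from funext fun s => h1 _]
  exact ContDiffOn.sum fun a _ => ContDiffOn.sum fun b _ => (h2 a b).smul contDiffOn_const

/-- Uniform Taylor expansions of the compliance. -/
theorem IsStent.exists_taylor [Fintype E] (hN : N.IsStent) (m : ℕ) :
    ∃ M, 0 ≤ M ∧ ∀ i, ∀ x ∈ Icc 0 (N.len i), ∃ a : ℕ → R3 →L[ℝ] R3, (∀ j < m, ‖a j‖ ≤ M) ∧
      ∀ s, 0 ≤ s → x + s ≤ N.len i → ∀ m' ≤ m,
        ‖N.complianceOp i (x + s) - ∑ j ∈ Finset.range m', s ^ j • a j‖ ≤ M * s ^ m' := by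
  choose M hM h using fun i =>
    exists_uniform_taylor (hN.len_pos i) m (hN.contDiffOn_complianceOp i)
  refine ⟨∑ i, M i, Finset.sum_nonneg fun i _ => hM i, fun i x hx => ?_⟩
  have hle : M i ≤ ∑ i, M i :=
    Finset.single_le_sum (f := M) (fun i _ => hM i) (Finset.mem_univ i)
  obtain ⟨a, h1, h2⟩ := h i x hx
  exact ⟨a, fun j hj => (h1 j hj).trans hle, fun s hs hxs m' hm' =>
    (h2 s hs hxs m' hm').trans (by gcongr)⟩

/-! ### Self-equilibrated stresses -/

/-- The bending moment at arc length `x` of the strut `i` that is in equilibrium with the constant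
force `(κ i).1` and has the value `(κ i).2` at the start. -/
def momentAt (N : StrutNetwork V E) (κ : E → R3 × R3) (i : E) (x : ℝ) : R3 :=
  (κ i).2 + x • cross (κ i).1 (N.tangent i)

theorem momentAt_add (κ : E → R3 × R3) (i : E) (x y : ℝ) :
    N.momentAt κ i (x + y) = N.momentAt κ i x + y • cross (κ i).1 (N.tangent i) := by
  simp only [momentAt, add_smul, add_assoc]

section

variable [Fintype E]

/-- The residual at the vertices of constant forces and affine moments. -/
def residual (N : StrutNetwork V E) : (E → R3 × R3) →ₗ[ℝ] (V → R3 × R3) where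
  toFun κ j := (N.balance (fun i => (κ i).1) (fun i => (κ i).1) j,
    N.balance (fun i => N.momentAt κ i (N.len i)) (fun i => N.momentAt κ i 0) j)
  map_add' κ κ' := by
    ext1 j
    simp only [Pi.add_apply, Prod.fst_add, Prod.mk_add_mk, ← balance_add]
    congr! 3 <;> simp only [momentAt, Pi.add_apply, Prod.fst_add, Prod.snd_add, add_cross',
      smul_add] <;> abel
  map_smul' c κ := by
    ext1 j
    simp only [Pi.smul_apply, Prod.smul_fst, Prod.smul_mk, ← balance_smul,
      RingHom.id_apply]
    congr! 3 <;> simp only [momentAt, Pi.smul_apply, Prod.smul_fst, Prod.smul_snd, smul_cross',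
      smul_add, smul_comm c]

theorem residual_eq_zero_iff {κ : E → R3 × R3} :
    N.residual κ = 0 ↔ ∀ j, N.balance (fun i => (κ i).1) (fun i => (κ i).1) j = 0 ∧
      N.balance (fun i => N.momentAt κ i (N.len i)) (fun i => N.momentAt κ i 0) j = 0 := by
  simp only [funext_iff, residual, LinearMap.coe_mk, AddHom.coe_mk, Pi.zero_apply,
    Prod.mk_eq_zero]

open Classical in
/-- The moments at the middle of the struts, and the slopes of the moments in the struts of `I`. -/
def probe (N : StrutNetwork V E) (I : Finset E) : (E → R3 × R3) →ₗ[ℝ] (E → R3 × R3) where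
  toFun κ i := (N.momentAt κ i (N.len i / 2), if i ∈ I then cross (κ i).1 (N.tangent i) else 0)
  map_add' κ κ' := by
    ext1 i
    simp only [momentAt, Pi.add_apply, Prod.fst_add, Prod.snd_add, Prod.mk_add_mk, add_cross',
      smul_add]
    congr 1
    · abel
    · split_ifs <;> simp
  map_smul' c κ := by
    ext1 i
    simp only [momentAt, Pi.smul_apply, Prod.smul_fst, Prod.smul_snd, Prod.smul_mk, smul_cross',
      smul_add, smul_comm c, RingHom.id_apply]
    congr 1
    split_ifs <;> simp

/-- A linear map that is injective on a finite-dimensional space is bounded below there. Injectivity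
is a premise inside the statement, so that a constant is available for every `I` before any
subdivision is chosen; where it fails the constant 0 serves. -/
theorem exists_bound_of_probe_injective (N : StrutNetwork V E) (I : Finset E) :
    ∃ c, 0 ≤ c ∧ ((∀ κ, N.residual κ = 0 → N.probe I κ = 0 → κ = 0) →
      ∀ κ, N.residual κ = 0 → ‖κ‖ ≤ c * ‖N.probe I κ‖) := by
  by_cases h : ∀ κ, N.residual κ = 0 → N.probe I κ = 0 → κ = 0
  · set f := (N.probe I).domRestrict (LinearMap.ker N.residual) with hf
    have hker : LinearMap.ker f = ⊥ := by
      rw [LinearMap.ker_eq_bot']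
      rintro ⟨κ, hκ⟩ h0
      simpa using h κ hκ h0
    obtain ⟨K, -, hK⟩ := f.exists_antilipschitzWith hker
    refine ⟨K, K.2, fun _ κ hκ => ?_⟩
    exact hK.le_mul_norm (map_zero f) ⟨κ, hκ⟩
  · exact ⟨0, le_rfl, fun h' => absurd h' h⟩

/-- A linear right inverse of the residual on its range is bounded, by finite dimension, and
produces the correction. -/
theorem exists_residual_correction [Fintype V] (N : StrutNetwork V E) :
    ∃ c, 0 ≤ c ∧ ∀ X, ∃ κ, N.residual κ = 0 ∧ ‖X - κ‖ ≤ c * ‖N.residual X‖ := by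
  obtain ⟨g, hg⟩ := N.residual.rangeRestrict.exists_rightInverse_of_surjective
    N.residual.range_rangeRestrict
  refine ⟨‖LinearMap.toContinuousLinearMap g‖, ContinuousLinearMap.opNorm_nonneg _, fun X =>
    ⟨X - g (N.residual.rangeRestrict X), ?_, ?_⟩⟩
  · have h1 := LinearMap.congr_fun hg (N.residual.rangeRestrict X)
    have h2 := congrArg Subtype.val h1
    simp at h2
    rw [map_sub, h2, sub_self]
  · rw [sub_sub_cancel]
    exact (LinearMap.toContinuousLinearMap g).le_opNorm (N.residual.rangeRestrict X)

/-- Without axial self-stress, a self-equilibrated stress is determined by its moments. -/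
theorem eq_zero_of_probe_univ (hN : N.IsStent) (hgeo : N.NoAxialSelfStress) {κ : E → R3 × R3}
    (h0 : N.residual κ = 0) (h : N.probe Finset.univ κ = 0) : κ = 0 := by
  rw [residual_eq_zero_iff] at h0
  have hc : ∀ i, cross (κ i).1 (N.tangent i) = 0 := fun i => by
    simpa [probe] using congrArg Prod.snd (congrFun h i)
  have hm : ∀ i, (κ i).2 = 0 := fun i => by
    simpa [probe, momentAt, hc] using congrArg Prod.fst (congrFun h i)
  -- A constant force whose moment has no slope is axial, and balanced axial forces are excluded by
  -- the geometric assumption.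
  have hd := fun i => eq_smul_of_cross_eq_zero (norm_tangent hN.nondegenerate i) (hc i)
  have hα := hgeo (fun i => inner ℝ (κ i).1 (N.tangent i)) fun j => by
    have := (h0 j).1
    simpa only [← hd] using this
  ext1 i
  have h1 : (κ i).1 = 0 := by rw [hd i, hα i, zero_smul]
  exact Prod.ext h1 (hm i)

end

end StrutNetwork

/-- The midpoint value and the deviation from it are orthogonal in L², so no mixed term remains. The
formula is used for whole struts as well as for their elements. -/
theorem integral_norm_sq_affine (ℓ : ℝ) (a b : R3) :
    ∫ s in (0 : ℝ)..ℓ, ‖a + s • b‖ ^ 2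
      = ℓ * ‖a + (ℓ / 2) • b‖ ^ 2 + ℓ ^ 3 / 12 * ‖b‖ ^ 2 := by
  have h : ∀ s : ℝ, ‖a + s • b‖ ^ 2 = ‖a‖ ^ 2 + 2 * inner ℝ a b * s + ‖b‖ ^ 2 * s ^ 2 := by
    intro s
    rw [norm_add_sq_real, inner_smul_right, norm_smul, mul_pow, Real.norm_eq_abs, sq_abs]
    ring
  simp only [h]
  rw [intervalIntegral.integral_add, intervalIntegral.integral_add,
    intervalIntegral.integral_const_mul, intervalIntegral.integral_const_mul]
  · simp [integral_pow]
    ring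
  all_goals exact Continuous.intervalIntegrable (by fun_prop) _ _

namespace StrutNetwork

variable {V E : Type*} {N : StrutNetwork V E}

section

variable [Fintype E]

theorem norm_slope_le (hN : ∀ i, N.pos (N.src i) ≠ N.pos (N.tgt i)) (κ : E → R3 × R3) (i : E) :
    ‖cross (κ i).1 (N.tangent i)‖ ≤ ‖κ‖ := by
  refine (norm_cross_le _ _).trans ?_
  rw [norm_tangent hN, mul_one]
  exact (norm_fst_le _).trans (norm_le_pi_norm κ i)

theorem norm_momentAt_le (hN : ∀ i, N.pos (N.src i) ≠ N.pos (N.tgt i)) (κ : E → R3 × R3) (i : E)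
    {x Λ : ℝ} (hx : 0 ≤ x) (hxΛ : x ≤ Λ) : ‖N.momentAt κ i x‖ ≤ (1 + Λ) * ‖κ‖ := by
  refine (norm_add_le _ _).trans ?_
  rw [add_mul, one_mul, norm_smul, Real.norm_of_nonneg hx]
  have := norm_slope_le hN κ i
  gcongr
  · exact (norm_snd_le _).trans (norm_le_pi_norm κ i)
  · exact hx.trans hxΛ

end

namespace Subdivision

variable (T : N.Subdivision)

/-- The `L²` projection of the affine moment to polynomials of degree at most `k` on an element. -/
def projMoment (k : ℕ) (κ : E → R3 × R3) (e : Σ i, Fin (T.m i + 1)) (s : ℝ) : R3 :=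
  N.momentAt κ e.1 (T.start e + if k = 0 then T.refine.len e / 2 else s)

theorem isVPoly_projMoment (k : ℕ) (κ : E → R3 × R3) (e : Σ i, Fin (T.m i + 1)) :
    IsVPoly k (T.projMoment k κ e) := by
  rcases k with _ | k
  · unfold projMoment
    simp only [if_true]
    exact isVPoly_const 0 _
  · unfold projMoment
    simp only [Nat.add_eq_zero_iff, one_ne_zero, and_false, if_false, momentAt_add]
    exact isVPoly_affine k _ _

/-- For `k = 0` the midpoint value of an affine function is its mean; for `k ≥ 1` an affine moment
is already in the space. -/
theorem integral_projMoment_sub (hN : ∀ i, N.pos (N.src i) ≠ N.pos (N.tgt i)) (k : ℕ)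
    (κ : E → R3 × R3) (e : Σ i, Fin (T.m i + 1)) {ξ : ℝ → R3} (hξ : IsVPoly k ξ) :
    ∫ s in (0 : ℝ)..T.refine.len e,
      inner ℝ (N.momentAt κ e.1 (T.start e + s) - T.projMoment k κ e s) (ξ s) = 0 := by
  have hℓ := (T.refine_len_pos hN e).le
  rcases k with _ | k
  · obtain ⟨c, hc⟩ := hξ
    have hc' : ∀ s, ξ s = c 0 := fun s => by simp [hc]
    simp only [hc']
    have h1 : ∀ s, N.momentAt κ e.1 (T.start e + s) - T.projMoment 0 κ e s
        = (s - T.refine.len e / 2) • cross (κ e.1).1 (N.tangent e.1) := by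
      intro s
      simp only [projMoment, if_true, momentAt_add, sub_smul]
      abel
    simp only [h1, inner_smul_left]
    rw [intervalIntegral.integral_mul_const]
    simp
    left
    ring
  · simp [projMoment]

theorem norm_projMoment_sub_le [Fintype E] (hN : ∀ i, N.pos (N.src i) ≠ N.pos (N.tgt i)) (k : ℕ)
    (κ : E → R3 × R3) (e : Σ i, Fin (T.m i + 1)) {s : ℝ} (hs : s ∈ Icc 0 (T.refine.len e)) :
    ‖T.projMoment k κ e s - N.momentAt κ e.1 (T.start e + s)‖ ≤ T.refine.len e * ‖κ‖ := by
  have h1 := norm_slope_le hN κ e.1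
  have hle : 0 ≤ T.refine.len e := (T.refine_len_pos hN e).le
  unfold projMoment
  split_ifs
  · rw [momentAt_add, momentAt_add, add_sub_add_left_eq_sub, ← sub_smul, norm_smul]
    gcongr
    rw [Real.norm_eq_abs, abs_le]
    constructor <;> linarith [hs.1, hs.2]
  · simp; positivity

theorem norm_projMoment_sub_zero_le [Fintype E] (hN : ∀ i, N.pos (N.src i) ≠ N.pos (N.tgt i))
    (k : ℕ) (κ : E → R3 × R3) (e : Σ i, Fin (T.m i + 1)) {s : ℝ}
    (hs : s ∈ Icc 0 (T.refine.len e)) :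
    ‖T.projMoment k κ e s - T.projMoment k κ e 0‖ ≤ T.refine.len e * ‖κ‖ := by
  have h1 := norm_slope_le hN κ e.1
  have hle : 0 ≤ T.refine.len e := (T.refine_len_pos hN e).le
  unfold projMoment
  split_ifs
  · simp; positivity
  · rw [momentAt_add, momentAt_add, add_sub_add_left_eq_sub, ← sub_smul, norm_smul, sub_zero]
    gcongr
    rw [Real.norm_eq_abs, abs_le]
    constructor <;> linarith [hs.1, hs.2]

theorem norm_projMoment_le [Fintype E] (hN : ∀ i, N.pos (N.src i) ≠ N.pos (N.tgt i)) {Λ : ℝ}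
    (hΛ : ∀ i, N.len i ≤ Λ) (k : ℕ) (κ : E → R3 × R3) (e : Σ i, Fin (T.m i + 1)) {s : ℝ}
    (hs : s ∈ Icc 0 (T.refine.len e)) : ‖T.projMoment k κ e s‖ ≤ (1 + Λ) * ‖κ‖ := by
  have h1 := T.start_nonneg e
  have h2 := T.start_add_len_le hN e
  have h3 := hΛ e.1
  have h4 := T.refine_len_pos hN e
  apply norm_momentAt_le hN
  · split_ifs <;> linarith [hs.1]
  · split_ifs <;> linarith [hs.2]

/-- The self-equilibrated stress on the elements of a subdivision. -/
def stressField (κ : E → R3 × R3) (q : (Σ i, Fin (T.m i + 1)) → ℝ → R3) :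
    ForceField (Σ i, Fin (T.m i + 1)) where
  q := q
  p := fun e _ => (κ e.1).1
  Pp := fun e => (κ e.1).1
  Pm := fun e => (κ e.1).1
  Qp := fun e => N.momentAt κ e.1 (T.node e.1 e.2.succ)
  Qm := fun e => N.momentAt κ e.1 (T.start e)
  α := 0
  β := 0

theorem balance_stressField [Fintype E] {κ : E → R3 × R3} (hκ : N.residual κ = 0)
    (q : (Σ i, Fin (T.m i + 1)) → ℝ → R3) (j : V ⊕ (Σ i, Fin (T.m i))) :
    T.refine.balance (T.stressField κ q).Pp (T.stressField κ q).Pm j = 0 ∧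
      T.refine.balance (T.stressField κ q).Qp (T.stressField κ q).Qm j = 0 := by
  rw [residual_eq_zero_iff] at hκ
  rcases j with a | ⟨i, j⟩
  · rw [balance_inl, balance_inl]
    simp only [stressField, start, Fin.succ_last, T.last, Fin.castSucc_zero, T.first]
    exact hκ a
  · rw [balance_inr, balance_inr]
    simp [stressField, start]

/-- The force is constant and its moment is the slope of the affine moment, so integration by parts
cancels the interior terms against the end terms on every element, and self-equilibrium removes the
vertex terms. The interior moment `q` need only agree with the affine one when tested against ψ.dw;
this freedom admits the projected moment in the discrete problem. -/
theorem formB_stressField [Fintype E] [Fintype V] (hN : ∀ i, N.pos (N.src i) ≠ N.pos (N.tgt i))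
    {κ : E → R3 × R3} (hκ : N.residual κ = 0) {q : (Σ i, Fin (T.m i + 1)) → ℝ → R3}
    (hq : ∀ e, IsL2 (T.refine.len e) (q e))
    {ψ : MotionField (V ⊕ (Σ i, Fin (T.m i))) (Σ i, Fin (T.m i + 1))} (hψ : T.refine.MemM ψ)
    (hqψ : ∀ e, ∫ s in (0 : ℝ)..T.refine.len e,
      inner ℝ (N.momentAt κ e.1 (T.start e + s) - q e s) (ψ.dw e s) = 0) :
    T.refine.formB (T.stressField κ q) ψ = 0 := by
  have hbal := T.balance_stressField hκ q
  simp only [formB, hbal]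
  have key : ∀ e, (∫ s in (0 : ℝ)..T.refine.len e,
      (- inner ℝ ((T.stressField κ q).p e s) (ψ.du e s + cross (T.refine.tangent e) (ψ.w e s))
        - inner ℝ ((T.stressField κ q).q e s) (ψ.dw e s)))
      + (inner ℝ ((T.stressField κ q).Pp e) (ψ.u e (T.refine.len e))
        - inner ℝ ((T.stressField κ q).Pm e) (ψ.u e 0))
      + (inner ℝ ((T.stressField κ q).Qp e) (ψ.w e (T.refine.len e))
        - inner ℝ ((T.stressField κ q).Qm e) (ψ.w e 0)) = 0 := by
    intro e
    have hpos := T.refine_len_pos hN e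
    have hℓ := hpos.le
    have hu := (hψ.u_mem e).isPrim hpos
    have hw := (hψ.w_mem e).isPrim hpos
    have hw2 := hw.isL2 hℓ
    set d := (κ e.1).1 with hd
    set t := N.tangent e.1 with ht
    set ℓ := T.refine.len e with hℓdef
    have hg : IsPrim ℓ (fun s => N.momentAt κ e.1 (T.start e + s)) (fun _ => cross d t) := by
      apply IsPrim.of_hasDerivAt
      · intro s _
        simp only [momentAt_add]
        have := ((hasDerivAt_id s).smul_const (cross d t)).const_add
          (N.momentAt κ e.1 (T.start e))
        simpa using this
      · exact continuousOn_const
    have h1 : ∫ s in (0 : ℝ)..ℓ, inner ℝ d (ψ.du e s)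
        = inner ℝ d (ψ.u e ℓ) - inner ℝ d (ψ.u e 0) := by
      rw [integral_const_inner hℓ hu.mem, hu.eq ℓ ⟨hℓ, le_rfl⟩, inner_add_right]
      ring
    have h2 := hg.integral_inner hℓ hw
    have h3 := hqψ e
    simp only [inner_sub_left] at h3
    rw [intervalIntegral.integral_sub ((hg.isL2 hℓ).intervalIntegrable_inner hℓ hw.mem)
      ((hq e).intervalIntegrable_inner hℓ hw.mem), h2] at h3
    have h4 : T.start e + ℓ = T.node e.1 e.2.succ := by
      rw [hℓdef, T.refine_len hN]; ring
    simp only [stressField, T.refine_tangent hN, ← hd, ← ht, inner_add_right, inner_cross d]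
    simp only [h4, add_zero] at h3
    have i1 := (isL2_const (ℓ := ℓ) d).intervalIntegrable_inner hℓ hu.mem
    have i2 := (isL2_const (ℓ := ℓ) (cross d t)).intervalIntegrable_inner hℓ hw2
    have i3 := (hq e).intervalIntegrable_inner hℓ hw.mem
    rw [intervalIntegral.integral_sub
      (f := fun s => -(inner ℝ d (ψ.du e s) + inner ℝ (cross d t) (ψ.w e s)))
      (i1.add i2).neg i3, intervalIntegral.integral_neg,
      intervalIntegral.integral_add i1 i2, h1]
    linarith
  simp only [stressField, inner_zero_left, add_zero, Finset.sum_const_zero, sub_zero] at key ⊢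
  rw [← Finset.sum_add_distrib, ← Finset.sum_add_distrib]
  exact Finset.sum_eq_zero fun e _ => key e

/-- The curvatures of discrete motions are polynomials of degree `k`, to which the projection error
of the moment is orthogonal. -/
theorem formB_stressField_projMoment [Fintype E] [Fintype V]
    (hN : ∀ i, N.pos (N.src i) ≠ N.pos (N.tgt i))
    {κ : E → R3 × R3} (hκ : N.residual κ = 0) {k : ℕ}
    {ψ : MotionField (V ⊕ (Σ i, Fin (T.m i))) (Σ i, Fin (T.m i + 1))}
    (hψ : T.refine.MemMh (k + 1) ψ) :
    T.refine.formB (T.stressField κ (T.projMoment k κ)) ψ = 0 := by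
  refine T.formB_stressField hN hκ (fun e => (T.isVPoly_projMoment k κ e).isL2 _) hψ.mem
    fun e => ?_
  obtain ⟨-, v, hv, hdw⟩ := hψ.exists_poly (T.refine_len_pos hN) e
  refine Eq.trans ?_ (T.integral_projMoment_sub hN k κ e hv)
  apply integral_congr_Ioc (T.refine_len_pos hN e).le
  filter_upwards [hdw] with s hs
  rw [hs]

theorem memVh_stressField (κ : E → R3 × R3) (k : ℕ) :
    T.refine.MemVh k (T.stressField κ (T.projMoment k κ)) :=
  ⟨⟨fun e => (T.isVPoly_projMoment k κ e).isL2 _, fun _ => isL2_const _⟩,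
    fun e => isPolyOn_of_isVPoly (T.isVPoly_projMoment k κ e) _,
    fun _ => isPolyOn_of_isVPoly (isVPoly_const k _) _⟩

/-! ### Uniform coercivity on self-equilibrated stresses -/

theorem sum_len (hN : ∀ i, N.pos (N.src i) ≠ N.pos (N.tgt i)) (i : E) :
    ∑ j : Fin (T.m i + 1), T.refine.len ⟨i, j⟩ = N.len i := by
  have := sum_integral_nodes (G := fun _ => 1) continuous_const (T.node i)
  simp only [intervalIntegral.integral_const, smul_eq_mul, mul_one, sub_zero, T.first, T.last]
    at this
  rw [← this]
  exact Finset.sum_congr rfl fun j _ => T.refine_len hN _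

/-- The square integral of the moment over a strut, evaluated by the midpoint formula once on the
elements and once on the whole strut. -/
theorem sum_len_mul_sq_mid (hN : ∀ i, N.pos (N.src i) ≠ N.pos (N.tgt i)) (κ : E → R3 × R3)
    (i : E) :
    ∑ j : Fin (T.m i + 1), (T.refine.len ⟨i, j⟩
      * ‖N.momentAt κ i (T.start ⟨i, j⟩ + T.refine.len ⟨i, j⟩ / 2)‖ ^ 2
      + T.refine.len ⟨i, j⟩ ^ 3 / 12 * ‖cross (κ i).1 (N.tangent i)‖ ^ 2)
    = N.len i * ‖N.momentAt κ i (N.len i / 2)‖ ^ 2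
      + N.len i ^ 3 / 12 * ‖cross (κ i).1 (N.tangent i)‖ ^ 2 := by
  have := sum_integral_nodes (G := fun x => ‖N.momentAt κ i x‖ ^ 2)
    (by unfold momentAt; fun_prop) (T.node i)
  rw [T.first, T.last] at this
  simp only [momentAt_add] at this ⊢
  simp only [momentAt, integral_norm_sq_affine] at this ⊢
  rw [← this]
  refine Finset.sum_congr rfl fun j _ => ?_
  rw [T.refine_len hN]
  rfl

theorem l2_projMoment (k : ℕ) (κ : E → R3 × R3)
    (e : Σ i, Fin (T.m i + 1)) :
    ∫ s in (0 : ℝ)..T.refine.len e, ‖T.projMoment k κ e s‖ ^ 2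
      = T.refine.len e * ‖N.momentAt κ e.1 (T.start e + T.refine.len e / 2)‖ ^ 2
        + if k = 0 then 0
          else T.refine.len e ^ 3 / 12 * ‖cross (κ e.1).1 (N.tangent e.1)‖ ^ 2 := by
  unfold projMoment
  split_ifs
  · simp
  · simp only [momentAt_add]
    exact integral_norm_sq_affine _ _ _

theorem sum_len_cube_le (hN : ∀ i, N.pos (N.src i) ≠ N.pos (N.tgt i)) {ρ : ℝ} (i : E)
    (h : ∀ j, T.refine.len ⟨i, j⟩ ≤ ρ * N.len i) :
    ∑ j : Fin (T.m i + 1), T.refine.len ⟨i, j⟩ ^ 3 ≤ ρ ^ 2 * N.len i ^ 3 := by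
  have hpos := fun j => T.refine_len_pos hN ⟨i, j⟩
  calc ∑ j : Fin (T.m i + 1), T.refine.len ⟨i, j⟩ ^ 3
      ≤ ∑ j : Fin (T.m i + 1), (ρ * N.len i) ^ 2 * T.refine.len ⟨i, j⟩ := by
        refine Finset.sum_le_sum fun j _ => ?_
        rw [pow_succ]
        have := (hpos j).le
        gcongr
        exact h j
    _ = ρ ^ 2 * N.len i ^ 3 := by rw [← Finset.mul_sum, T.sum_len hN]; ring

/-- The strut has a second element, of length at least ℓ / σ, so ℓ (1 + 1/σ) does not exceed the
length of the strut. -/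
theorem len_le_of_quasiUniform (hN : ∀ i, N.pos (N.src i) ≠ N.pos (N.tgt i)) {σ : ℝ} (hσ : 0 < σ)
    (hT : T.QuasiUniform σ) {i : E} (hi : T.m i ≠ 0) (j : Fin (T.m i + 1)) :
    T.refine.len ⟨i, j⟩ ≤ σ / (1 + σ) * N.len i := by
  obtain ⟨j', hj'⟩ : ∃ j' : Fin (T.m i + 1), j' ≠ j := by
    have : Nontrivial (Fin (T.m i + 1)) := Fin.nontrivial_iff_two_le.2 (by omega)
    exact exists_ne j
  have h1 := hT ⟨i, j⟩ ⟨i, j'⟩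
  have h2 : T.refine.len ⟨i, j⟩ + T.refine.len ⟨i, j'⟩ ≤ N.len i := by
    rw [← T.sum_len hN i, ← Finset.sum_pair (f := fun j => T.refine.len ⟨i, j⟩) hj'.symm]
    exact Finset.sum_le_sum_of_subset_of_nonneg (Finset.subset_univ _)
      fun l _ _ => (T.refine_len_pos hN ⟨i, l⟩).le
  rw [div_mul_eq_mul_div, le_div_iff₀ (by positivity)]
  nlinarith

open Classical in
/-- The struts on which the projected moment determines the slope. -/
def slopeStruts [Fintype E] (k : ℕ) : Finset E := {i | k ≠ 0 ∨ T.m i ≠ 0}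

/-- For `k = 0` the projection drops the slope terms of the elements, whose weights are ℓ³/12. On a
divided strut no element exceeds the fraction σ/(1+σ) of the strut length L, so the slope keeps at
least the weight (1 - (σ/(1+σ))²) L³/12. On an undivided strut the slope term is lost completely,
which is why `slopeStruts` omits such struts for `k = 0`. -/
theorem norm_probe_sq_le [Fintype E] (hN : ∀ i, N.pos (N.src i) ≠ N.pos (N.tgt i)) {σ : ℝ} (hσ : 0 < σ)
    (hT : T.QuasiUniform σ) {δ : ℝ} (hδ : 0 ≤ δ) (hδL : ∀ i, δ ≤ N.len i)
    (hδσ : ∀ i, δ ≤ (1 - (σ / (1 + σ)) ^ 2) * N.len i ^ 3 / 12) (k : ℕ) (κ : E → R3 × R3) :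
    δ * ‖N.probe (T.slopeStruts k) κ‖ ^ 2
      ≤ ∑ e, ∫ s in (0 : ℝ)..T.refine.len e, ‖T.projMoment k κ e s‖ ^ 2 := by
  classical
  have hstrut : ∀ i, δ * ‖N.momentAt κ i (N.len i / 2)‖ ^ 2
      + (if i ∈ T.slopeStruts k then δ * ‖cross (κ i).1 (N.tangent i)‖ ^ 2 else 0)
      ≤ ∑ j : Fin (T.m i + 1), ∫ s in (0 : ℝ)..T.refine.len ⟨i, j⟩,
        ‖T.projMoment k κ ⟨i, j⟩ s‖ ^ 2 := by
    intro i
    have h1 := T.sum_len_mul_sq_mid hN κ i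
    have hL : 0 < N.len i := dist_pos.2 (hN i)
    rw [Finset.sum_add_distrib, ← Finset.sum_mul, ← Finset.sum_div] at h1
    simp only [T.l2_projMoment]
    have h2 : δ * ‖N.momentAt κ i (N.len i / 2)‖ ^ 2
        ≤ N.len i * ‖N.momentAt κ i (N.len i / 2)‖ ^ 2 := by gcongr; exact hδL i
    set b2 := ‖cross (κ i).1 (N.tangent i)‖ ^ 2 with hb2
    have hb : 0 ≤ b2 := by positivity
    have hρ : 0 ≤ (σ / (1 + σ)) ^ 2 := by positivity
    have h3 : δ * b2 ≤ (1 - (σ / (1 + σ)) ^ 2) * N.len i ^ 3 / 12 * b2 := by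
      gcongr; exact hδσ i
    have hL3 : 0 ≤ (σ / (1 + σ)) ^ 2 * N.len i ^ 3 * b2 := by positivity
    rcases eq_or_ne k 0 with hk | hk
    · simp only [hk, if_true, add_zero]
      split_ifs with hi
      · have hi' : T.m i ≠ 0 := by simpa [slopeStruts, hk] using hi
        have h4 := T.sum_len_cube_le hN i (T.len_le_of_quasiUniform hN hσ hT hi')
        have h5 := mul_le_mul_of_nonneg_right h4 hb
        linarith
      · have h4 := T.sum_len_cube_le hN (ρ := 1) i fun j => by
          rw [one_mul, ← T.sum_len hN i]
          exact Finset.single_le_sum (f := fun j => T.refine.len ⟨i, j⟩)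
            (fun l _ => (T.refine_len_pos hN ⟨i, l⟩).le) (Finset.mem_univ j)
        have h5 := mul_le_mul_of_nonneg_right h4 hb
        linarith
    · have hi : i ∈ T.slopeStruts k := by simp [slopeStruts, hk]
      rw [if_pos hi, Finset.sum_add_distrib]
      simp only [hk, if_false]
      rw [← Finset.sum_mul, ← Finset.sum_div]
      linarith
  rw [Fintype.sum_sigma]
  have hnn : ∀ i, 0 ≤ ∑ j : Fin (T.m i + 1), ∫ s in (0 : ℝ)..T.refine.len ⟨i, j⟩,
      ‖T.projMoment k κ ⟨i, j⟩ s‖ ^ 2 := fun i =>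
    Finset.sum_nonneg fun j _ => integral_norm_sq_nonneg (T.refine_len_pos hN _).le _
  set R := ∑ i, ∑ j : Fin (T.m i + 1), ∫ s in (0 : ℝ)..T.refine.len ⟨i, j⟩,
      ‖T.projMoment k κ ⟨i, j⟩ s‖ ^ 2 with hR
  have hR0 : 0 ≤ R := Finset.sum_nonneg fun i _ => hnn i
  -- The norm of the probe is a maximum over struts and components, so each component is compared
  -- with the whole sum.
  have hcomp : √δ * ‖N.probe (T.slopeStruts k) κ‖ ≤ √R := by
    rw [← Real.norm_of_nonneg (Real.sqrt_nonneg δ), ← norm_smul,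
      pi_norm_le_iff_of_nonneg (Real.sqrt_nonneg _)]
    intro i
    have h1 := (hstrut i).trans
      (Finset.single_le_sum (fun i _ => hnn i) (Finset.mem_univ i) : _ ≤ R)
    have hd1 : 0 ≤ δ * ‖N.momentAt κ i (N.len i / 2)‖ ^ 2 := by positivity
    have hd2 : 0 ≤ δ * ‖cross (κ i).1 (N.tangent i)‖ ^ 2 := by positivity
    rw [Pi.smul_apply, Prod.norm_def, max_le_iff]
    simp only [Prod.smul_fst, Prod.smul_snd, norm_smul, Real.norm_of_nonneg (Real.sqrt_nonneg δ)]
    constructor <;> apply Real.le_sqrt_of_sq_le <;> rw [mul_pow, Real.sq_sqrt hδ]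
    · simp only [probe, LinearMap.coe_mk, AddHom.coe_mk]
      split_ifs at h1 <;> linarith
    · simp only [probe, LinearMap.coe_mk, AddHom.coe_mk]
      split_ifs at h1 ⊢
      · linarith
      · simpa using hR0
  have := pow_le_pow_left₀ (by positivity) hcomp 2
  rwa [mul_pow, Real.sq_sqrt hδ, Real.sq_sqrt hR0] at this

/-- The projected moment of such a κ vanishes, so its stress field together with the zero motion
solves the unloaded discrete problem. Uniqueness makes the nodal forces and moments vanish, and κ is
among them. -/
theorem eq_zero_of_discreteUnique [Fintype E] [Fintype V] (hN : ∀ i, N.pos (N.src i) ≠ N.pos (N.tgt i))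
    (hT : T.refine.DiscreteUnique 0 1) {κ : E → R3 × R3} (hκ : N.residual κ = 0)
    (h : N.probe (T.slopeStruts 0) κ = 0) : κ = 0 := by
  classical
  have hmid : ∀ i, N.momentAt κ i (N.len i / 2) = 0 := fun i => congrArg Prod.fst (congrFun h i)
  have hslope : ∀ i, T.m i ≠ 0 → cross (κ i).1 (N.tangent i) = 0 := by
    intro i hi
    have := congrArg Prod.snd (congrFun h i)
    have hmem : i ∈ T.slopeStruts 0 := by simp [slopeStruts, hi]
    simpa [probe, hmem] using this
  have hproj : T.projMoment 0 κ = 0 := by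
    funext e s
    obtain ⟨i, j⟩ := e
    simp only [projMoment, if_true, Pi.zero_apply]
    -- On an undivided strut the projected moment is the midpoint value of the strut; on a divided
    -- one the slope vanishes, so the moment is constant and equal to that value.
    rcases eq_or_ne (T.m i) 0 with hi | hi
    · have h1 : T.start ⟨i, j⟩ = 0 := by
        rw [← T.first i, start]
        congr 1
        ext; simp; omega
      have h2 : T.refine.len ⟨i, j⟩ = N.len i := by
        rw [T.refine_len hN, h1, sub_zero, ← T.last i]
        congr 1
        ext; simp; omega
      rw [h1, h2, zero_add]
      exact hmid i
    · have := hmid i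
      simpa [momentAt, hslope i hi] using this
  have hsol : T.refine.SolvesDiscrete 0 1 0 (T.stressField κ (T.projMoment 0 κ))
      ⟨0, 0, 0, 0, 0, 0⟩ := by
    refine ⟨T.memVh_stressField κ 0, memMh_vertex (T.refine_len_pos hN) 1 0 0, fun G _ => ?_,
      fun ψ hψ => ?_⟩
    · rw [formB_vertex]
      have hcomp : ∀ e s, matVec (T.refine.compliance e s) 0 = 0 :=
        fun e s => by rw [matVec_eq]; simp
      simp [formA, stressField, hproj, hcomp]
    · rw [T.formB_stressField_projMoment hN hκ hψ]
      simp [formF]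
  have hz := (hT _ _ hsol).1
  have hnn : ∀ u : ℝ → R3, ∀ e, 0 ≤ ∫ s in (0 : ℝ)..T.refine.len e, ‖u s‖ ^ 2 := fun u e =>
    integral_norm_sq_nonneg (T.refine_len_pos hN e).le u
  set S := T.stressField κ (T.projMoment 0 κ) with hS
  have h1 : 0 ≤ ∑ e, ∫ s in (0 : ℝ)..T.refine.len e, ‖S.q e s‖ ^ 2 :=
    Finset.sum_nonneg fun e _ => hnn _ e
  have h2 : 0 ≤ ∑ e, ∫ s in (0 : ℝ)..T.refine.len e, ‖S.p e s‖ ^ 2 :=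
    Finset.sum_nonneg fun e _ => hnn _ e
  have h3 : ∀ e ∈ Finset.univ,
      0 ≤ ‖S.Pp e‖ ^ 2 + ‖S.Pm e‖ ^ 2 + ‖S.Qp e‖ ^ 2 + ‖S.Qm e‖ ^ 2 := fun e _ => by positivity
  have h4 := Finset.sum_nonneg h3
  have hα : S.α = 0 := rfl
  have hβ : S.β = 0 := rfl
  rw [normV, hα, hβ, norm_zero, Real.sqrt_eq_zero (by positivity)] at hz
  have h5 : ∑ e, (‖S.Pp e‖ ^ 2 + ‖S.Pm e‖ ^ 2 + ‖S.Qp e‖ ^ 2 + ‖S.Qm e‖ ^ 2) = 0 := by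
    linarith
  rw [Finset.sum_eq_zero_iff_of_nonneg h3] at h5
  funext i
  have h6 := h5 ⟨i, 0⟩ (Finset.mem_univ _)
  have hP : S.Pp ⟨i, 0⟩ = (κ i).1 := rfl
  have hQ : S.Qm ⟨i, 0⟩ = (κ i).2 := by
    simp [hS, stressField, start, T.first, momentAt]
  rw [hP, hQ] at h6
  have hPm : 0 ≤ ‖S.Pm ⟨i, 0⟩‖ ^ 2 := by positivity
  have hQp : 0 ≤ ‖S.Qp ⟨i, 0⟩‖ ^ 2 := by positivity
  have h7 : ‖(κ i).1‖ ^ 2 = 0 := by linarith [sq_nonneg ‖(κ i).1‖, sq_nonneg ‖(κ i).2‖, hPm, hQp]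
  have h8 : ‖(κ i).2‖ ^ 2 = 0 := by linarith [sq_nonneg ‖(κ i).1‖, sq_nonneg ‖(κ i).2‖, hPm, hQp]
  exact Prod.ext (by simpa using h7) (by simpa using h8)

end Subdivision

/-- The moments of a self-equilibrated stress, projected to the finite element space, control the
stress uniformly for all quasi-uniform subdivisions. -/
theorem exists_stress_bound [Fintype V] [Fintype E] (hN : N.IsStent)
    (hgeo : N.NoAxialSelfStress) {σ : ℝ} (hσ : 0 < σ) :
    ∃ c, 0 < c ∧ ∀ (k : ℕ) (T : N.Subdivision), T.QuasiUniform σ →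
      (k = 0 → T.refine.DiscreteUnique k (k + 1)) → ∀ κ, N.residual κ = 0 →
        ‖κ‖ ^ 2 ≤ c * ∑ e, ∫ s in (0 : ℝ)..T.refine.len e, ‖T.projMoment k κ e s‖ ^ 2 := by
  classical
  have := hN.nonempty
  have hnd := hN.nondegenerate
  obtain ⟨i₀, hi₀⟩ := Finite.exists_min
    (fun i => min (N.len i) ((1 - (σ / (1 + σ)) ^ 2) * N.len i ^ 3 / 12))
  set δ := min (N.len i₀) ((1 - (σ / (1 + σ)) ^ 2) * N.len i₀ ^ 3 / 12) with hδ
  have hρ : (σ / (1 + σ)) ^ 2 < 1 := by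
    rw [sq_lt_one_iff₀ (by positivity), div_lt_one (by positivity)]
    linarith
  have hδ0 : 0 < δ := by
    have := hN.len_pos i₀
    have h2 : 0 < 1 - (σ / (1 + σ)) ^ 2 := by linarith
    exact lt_min this (by positivity)
  -- A subdivision enters only through a set of struts, and there are finitely many sets, so the sum
  -- of their constants is uniform.
  choose c hc0 hc using N.exists_bound_of_probe_injective
  set C := ∑ I, c I with hC
  have hC0 : 0 ≤ C := Finset.sum_nonneg fun I _ => hc0 I
  refine ⟨C ^ 2 / δ + 1, by positivity, fun k T hT hu κ hκ => ?_⟩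
  have hinj : ∀ κ, N.residual κ = 0 → N.probe (T.slopeStruts k) κ = 0 → κ = 0 := by
    rcases eq_or_ne k 0 with rfl | hk
    · exact fun κ h1 h2 => T.eq_zero_of_discreteUnique hnd (hu rfl) h1 h2
    · have : T.slopeStruts k = Finset.univ := by simp [Subdivision.slopeStruts, hk]
      rw [this]
      exact fun κ h1 h2 => eq_zero_of_probe_univ hN hgeo h1 h2
  have h1 := hc _ hinj κ hκ
  have h2 : c (T.slopeStruts k) ≤ C :=
    Finset.single_le_sum (fun I _ => hc0 I) (Finset.mem_univ _)
  have h3 : ‖κ‖ ≤ C * ‖N.probe (T.slopeStruts k) κ‖ := h1.trans (by gcongr)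
  have h4 := T.norm_probe_sq_le hnd hσ hT hδ0.le (fun i => (hi₀ i).trans (min_le_left _ _))
    (fun i => (hi₀ i).trans (min_le_right _ _)) k κ
  set R := ∑ e, ∫ s in (0 : ℝ)..T.refine.len e, ‖T.projMoment k κ e s‖ ^ 2 with hR
  have hR0 : 0 ≤ R := le_trans (by positivity) h4
  calc ‖κ‖ ^ 2 ≤ (C * ‖N.probe (T.slopeStruts k) κ‖) ^ 2 := by gcongr
    _ = C ^ 2 / δ * (δ * ‖N.probe (T.slopeStruts k) κ‖ ^ 2) := by field_simp
    _ ≤ C ^ 2 / δ * R := by gcongr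
    _ ≤ _ := by nlinarith

end StrutNetwork

namespace StrutNetwork

variable {V E : Type*} {N : StrutNetwork V E}

/-! ### Rigid motions and the multipliers -/

/-- The infinitesimal rigid motion `x ↦ c + ρ × x`. -/
def rigidMotion (N : StrutNetwork V E) (c ρ : R3) : MotionField V E where
  u := fun i s => c + cross ρ (N.pos (N.src i) + s • N.tangent i)
  du := fun i _ => cross ρ (N.tangent i)
  w := fun _ _ => ρ
  dw := fun _ _ => 0
  U := fun j => c + cross ρ (N.pos j)
  W := fun _ => ρ

theorem memMh_rigidMotion (n : ℕ) (c ρ : R3) :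
    N.MemMh (n + 1) (N.rigidMotion c ρ) := by
  have hu : ∀ i s, c + cross ρ (N.pos (N.src i) + s • N.tangent i)
      = (c + cross ρ (N.pos (N.src i))) + s • cross ρ (N.tangent i) := fun i s => by
    rw [cross_add', cross_smul', add_assoc]
  refine ⟨⟨fun i => ?_, fun i => ?_⟩, fun i => ?_, fun i => ?_⟩
  · refine IsPrim.isH1 dist_nonneg (IsPrim.of_hasDerivAt (fun s _ => ?_)
      continuousOn_const)
    simp only [rigidMotion, hu]
    simpa using ((hasDerivAt_id s).smul_const (cross ρ (N.tangent i))).const_add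
      (c + cross ρ (N.pos (N.src i)))
  · exact IsPrim.isH1 dist_nonneg ⟨isL2_const 0, fun s _ => by simp [rigidMotion]⟩
  · simp only [rigidMotion, hu]
    exact isPolyOn_of_isVPoly (isVPoly_affine n _ _) _
  · exact isPolyOn_of_isVPoly (isVPoly_const (n + 1) ρ) _

/-- A rigid motion has no strain and no curvature and takes the correct values at the vertices, so
only the multiplier terms survive. -/
theorem formB_rigidMotion [Fintype V] [Fintype E]
    (hN : ∀ i, N.pos (N.src i) ≠ N.pos (N.tgt i)) (S : ForceField E) (c ρ : R3) :
    N.formB S (N.rigidMotion c ρ)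
      = inner ℝ S.α (∑ i, ∫ s in (0 : ℝ)..N.len i, (N.rigidMotion c ρ).u i s)
        + (∑ i, N.len i) * inner ℝ S.β ρ := by
  rw [formB_eq, Finset.sum_eq_zero, zero_add]
  · congr 1
    simp [rigidMotion, ← Finset.sum_smul, inner_smul_right]
  · intro i _
    have h1 : cross ρ (N.tangent i) + cross (N.tangent i) ρ = 0 := by
      rw [cross_swap]; simp
    simp [edgeB, rigidMotion, len_smul_tangent hN, h1]

/-- Translations isolate the difference of the α; once these agree, rotations isolate the difference
of the β. -/
theorem multipliers_unique [Fintype V] [Fintype E] [Nonempty E]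
    (hN : ∀ i, N.pos (N.src i) ≠ N.pos (N.tgt i)) {S S' : ForceField E}
    (h : ∀ c ρ, N.formB S (N.rigidMotion c ρ) = N.formB S' (N.rigidMotion c ρ)) :
    S.α = S'.α ∧ S.β = S'.β := by
  have hL : 0 < ∑ i, N.len i :=
    Finset.sum_pos (fun i _ => dist_pos.2 (hN i)) Finset.univ_nonempty
  simp only [formB_rigidMotion hN] at h
  have hα : S.α = S'.α := by
    have h1 := h (S.α - S'.α) 0
    simp only [rigidMotion, zero_cross', add_zero, intervalIntegral.integral_const, sub_zero,
      ← Finset.sum_smul, inner_smul_right, inner_zero_right, mul_zero] at h1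
    have h2 := mul_left_cancel₀ hL.ne' h1
    rw [← sub_eq_zero, ← inner_sub_left, inner_self_eq_zero] at h2
    exact sub_eq_zero.1 h2
  refine ⟨hα, ?_⟩
  have h1 := h 0 (S.β - S'.β)
  rw [hα] at h1
  have h2 := mul_left_cancel₀ hL.ne' (add_left_cancel h1)
  rw [← sub_eq_zero, ← inner_sub_left, inner_self_eq_zero] at h2
  exact sub_eq_zero.1 h2

/-- A bound for the total load. -/
def loadNorm [Fintype E] (N : StrutNetwork V E) (f : E → ℝ → R3) : ℝ :=
  ∑ i, √(N.len i) * l2norm (N.len i) (f i)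

theorem loadNorm_nonneg [Fintype E] (f : E → ℝ → R3) : 0 ≤ N.loadNorm f :=
  Finset.sum_nonneg fun _ _ => mul_nonneg (Real.sqrt_nonneg _) (l2norm_nonneg _ _)

theorem abs_formF_le [Fintype E] {f : E → ℝ → R3} (hf : ∀ i, IsL2 (N.len i) (f i))
    {ψ : MotionField V E} {M : ℝ} (hM : 0 ≤ M) (hψ : ∀ i, IsL2 (N.len i) (ψ.u i))
    (hb : ∀ i, ∀ s ∈ Icc 0 (N.len i), ‖ψ.u i s‖ ≤ M) : |N.formF f ψ| ≤ M * N.loadNorm f := by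
  rw [formF, abs_neg, loadNorm, Finset.mul_sum]
  refine (Finset.abs_sum_le_sum_abs _ _).trans (Finset.sum_le_sum fun i _ => ?_)
  have hℓ : 0 ≤ N.len i := dist_nonneg
  refine (abs_integral_inner_le hℓ (hf i) (hψ i)).trans ?_
  have := l2norm_le_of_bound hℓ hM fun s hs => hb i s (Ioc_subset_Icc_self hs)
  calc _ ≤ l2norm (N.len i) (f i) * (√(N.len i) * M) := by
        gcongr; exact l2norm_nonneg _ _
    _ = _ := by ring

/-- The total force of the load bounds α. A rotation then bounds β; one X comes from the moment of
the load and the other from the moment of α. -/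
theorem norm_multipliers_le [Fintype V] [Fintype E] [Nonempty E]
    (hN : ∀ i, N.pos (N.src i) ≠ N.pos (N.tgt i)) {f : E → ℝ → R3}
    (hf : ∀ i, IsL2 (N.len i) (f i)) {X : ℝ} (hX0 : 0 ≤ X)
    (hX : ∀ i, ∀ s ∈ Icc 0 (N.len i), ‖N.pos (N.src i) + s • N.tangent i‖ ≤ X) {S : ForceField E}
    (h : ∀ c ρ, N.formB S (N.rigidMotion c ρ) = N.formF f (N.rigidMotion c ρ)) :
    (∑ i, N.len i) * ‖S.α‖ ≤ N.loadNorm f ∧ (∑ i, N.len i) * ‖S.β‖ ≤ 2 * X * N.loadNorm f := by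
  have hL : 0 < ∑ i, N.len i :=
    Finset.sum_pos (fun i _ => dist_pos.2 (hN i)) Finset.univ_nonempty
  have hmem : ∀ c ρ i, IsL2 (N.len i) ((N.rigidMotion c ρ).u i) := fun c ρ i =>
    isL2_of_continuousOn ((memMh_rigidMotion 0 c ρ).mem.u_mem i).cont
  have hα : (∑ i, N.len i) * ‖S.α‖ ≤ N.loadNorm f := by
    have h1 := h S.α 0
    have h2 := abs_formF_le hf (ψ := N.rigidMotion S.α 0) (M := ‖S.α‖) (norm_nonneg _)
      (hmem _ _) (fun i s _ => by simp [rigidMotion])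
    rw [← h1, formB_rigidMotion hN] at h2
    simp only [rigidMotion, zero_cross', add_zero, intervalIntegral.integral_const, sub_zero,
      ← Finset.sum_smul, inner_smul_right, inner_zero_right, mul_zero,
      real_inner_self_eq_norm_sq] at h2
    rcases (norm_nonneg S.α).eq_or_lt with h0 | h0
    · rw [← h0, mul_zero]; exact loadNorm_nonneg f
    · have h3 := (le_abs_self _).trans h2
      nlinarith
  refine ⟨hα, ?_⟩
  have h1 := h 0 S.β
  have hb : ∀ i, ∀ s ∈ Icc 0 (N.len i), ‖(N.rigidMotion 0 S.β).u i s‖ ≤ ‖S.β‖ * X := by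
    intro i s hs
    simp only [rigidMotion, zero_add]
    exact (norm_cross_le _ _).trans (by gcongr; exact hX i s hs)
  have h2 := abs_formF_le hf (by positivity) (hmem 0 S.β) hb
  rw [← h1, formB_rigidMotion hN, real_inner_self_eq_norm_sq] at h2
  have h3 : ‖∑ i, ∫ s in (0 : ℝ)..N.len i, (N.rigidMotion 0 S.β).u i s‖
      ≤ (∑ i, N.len i) * (‖S.β‖ * X) := by
    rw [Finset.sum_mul]
    refine (norm_sum_le _ _).trans (Finset.sum_le_sum fun i _ => ?_)
    have hℓ : 0 ≤ N.len i := dist_nonneg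
    have := intervalIntegral.norm_integral_le_of_norm_le_const (a := 0) (b := N.len i)
      (f := (N.rigidMotion 0 S.β).u i) (C := ‖S.β‖ * X) (fun s hs => by
        rw [uIoc_of_le hℓ] at hs
        exact hb i s (Ioc_subset_Icc_self hs))
    rw [sub_zero, abs_of_nonneg hℓ] at this
    linarith
  have h4 := (abs_real_inner_le_norm S.α
    (∑ i, ∫ s in (0 : ℝ)..N.len i, (N.rigidMotion 0 S.β).u i s))
  have h5 : ‖S.α‖ * ‖∑ i, ∫ s in (0 : ℝ)..N.len i, (N.rigidMotion 0 S.β).u i s‖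
      ≤ N.loadNorm f * (‖S.β‖ * X) := by
    calc _ ≤ ‖S.α‖ * ((∑ i, N.len i) * (‖S.β‖ * X)) := by gcongr
      _ = ((∑ i, N.len i) * ‖S.α‖) * (‖S.β‖ * X) := by ring
      _ ≤ _ := by gcongr
  rcases (norm_nonneg S.β).eq_or_lt with h0 | h0
  · rw [← h0, mul_zero]
    have := loadNorm_nonneg (N := N) f
    positivity
  · have h6 := (abs_le.1 h2).2
    have h7 := (abs_le.1 h4).1
    have h8 : ‖S.β‖ * ((∑ i, N.len i) * ‖S.β‖) ≤ ‖S.β‖ * (2 * X * N.loadNorm f) := by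
      nlinarith
    exact le_of_mul_le_mul_left h8 h0

end StrutNetwork

/-! ### Nodal values along a strut -/

/-- Nodal values that are continuous across interior nodes vary at most by the sum of their
increments. -/
theorem norm_chain_le {G : Type*} [SeminormedAddCommGroup G] {m : ℕ} (A B : Fin (m + 1) → G)
    (h : ∀ j : Fin m, A j.castSucc = B j.succ) (j : Fin (m + 1)) :
    ‖B j - B 0‖ ≤ ∑ l, ‖A l - B l‖ ∧ ‖A j - B 0‖ ≤ ∑ l, ‖A l - B l‖ := by
  set X : Fin (m + 2) → G := Fin.lastCases (motive := fun _ => G) (A (Fin.last m)) B with hX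
  have h1 : ∀ j, X j.castSucc = B j := fun j => by rw [hX, Fin.lastCases_castSucc]
  have h2 : ∀ j, X j.succ = A j := by
    intro j
    induction j using Fin.lastCases with
    | last => rw [Fin.succ_last, hX, Fin.lastCases_last]
    | cast j => rw [Fin.succ_castSucc, h1, h]
  have h0 : X 0 = B 0 := by rw [← h1 0]; rfl
  have h3 := norm_sub_zero_le_sum X j.castSucc
  have h4 := norm_sub_zero_le_sum X j.succ
  simp only [h0, h1, h2] at h3 h4
  exact ⟨h3, h4⟩

theorem IsPrim.norm_sub_le {ℓ : ℝ} {Y y : ℝ → R3} (hℓ : 0 ≤ ℓ) (h : IsPrim ℓ Y y) {s : ℝ}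
    (hs : s ∈ Icc 0 ℓ) : ‖Y s - Y 0‖ ≤ √ℓ * l2norm ℓ y := by
  rw [h.eq s hs, add_sub_cancel_left]
  exact norm_integral_le_l2norm hℓ h.mem hs

theorem l2norm_le_of_ae_bound {ℓ : ℝ} {u : ℝ → R3} (hℓ : 0 ≤ ℓ) {M : ℝ} (hM : 0 ≤ M)
    (h : ∀ᵐ s ∂volume.restrict (Ioc 0 ℓ), ‖u s‖ ≤ M) : l2norm ℓ u ≤ √ℓ * M := by
  have h1 := l2norm_mono_ae hℓ zero_le_one
    (isL2_const (ℓ := ℓ) (EuclideanSpace.single (0 : Fin 3) M)) (u := u) (by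
      filter_upwards [h] with s hs
      simpa [abs_of_nonneg hM] using hs)
  simpa [l2norm_const hℓ, abs_of_nonneg hM] using h1

/-! ### ### Stability of the exact solution, uniform in the subdivision -/

namespace StrutNetwork

variable {V E : Type*} {N : StrutNetwork V E}

/-- The total length of a network. -/
def totalLen [Fintype E] (N : StrutNetwork V E) : ℝ := ∑ i, N.len i

theorem len_le_totalLen [Fintype E] (i : E) : N.len i ≤ N.totalLen :=
  Finset.single_le_sum (f := N.len) (fun _ _ => dist_nonneg) (Finset.mem_univ i)

theorem totalLen_nonneg [Fintype E] : 0 ≤ N.totalLen := Finset.sum_nonneg fun _ _ => dist_nonneg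

theorem IsStent.totalLen_pos [Fintype E] (hN : N.IsStent) : 0 < N.totalLen :=
  have := hN.nonempty
  Finset.sum_pos (fun i _ => hN.len_pos i) Finset.univ_nonempty

/-- A bound for the distance of the points of a network to the origin. -/
def radius [Fintype E] (N : StrutNetwork V E) : ℝ := (∑ i, ‖N.pos (N.src i)‖) + N.totalLen

theorem radius_nonneg [Fintype E] : 0 ≤ N.radius :=
  add_nonneg (Finset.sum_nonneg fun _ _ => norm_nonneg _) totalLen_nonneg

theorem IsStent.exists_norm_complianceOp_le [Fintype E] (hN : N.IsStent) :
    ∃ M, 0 ≤ M ∧ ∀ i, ∀ s ∈ Icc 0 (N.len i), ‖N.complianceOp i s‖ ≤ M := by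
  obtain ⟨M, hM, h⟩ := hN.exists_taylor 0
  refine ⟨M, hM, fun i s hs => ?_⟩
  obtain ⟨a, -, h2⟩ := h i 0 ⟨le_rfl, (hN.len_pos i).le⟩
  simpa using h2 s hs.1 (by simpa using hs.2) 0 le_rfl

namespace Subdivision

variable (T : N.Subdivision)

theorem add_mem_Icc (hN : ∀ i, N.pos (N.src i) ≠ N.pos (N.tgt i)) (e : Σ i, Fin (T.m i + 1))
    {s : ℝ} (hs : s ∈ Icc 0 (T.refine.len e)) : T.start e + s ∈ Icc 0 (N.len e.1) :=
  ⟨add_nonneg (T.start_nonneg e) hs.1, by linarith [hs.2, T.start_add_len_le hN e]⟩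

theorem totalLen_refine [Fintype E] (hN : ∀ i, N.pos (N.src i) ≠ N.pos (N.tgt i)) :
    T.refine.totalLen = N.totalLen := by
  rw [totalLen, totalLen, Fintype.sum_sigma]
  exact Finset.sum_congr rfl fun i _ => T.sum_len hN i

theorem norm_point_le [Fintype E] (hN : ∀ i, N.pos (N.src i) ≠ N.pos (N.tgt i))
    (e : Σ i, Fin (T.m i + 1)) {s : ℝ} (hs : s ∈ Icc 0 (T.refine.len e)) :
    ‖T.refine.pos (T.refine.src e) + s • T.refine.tangent e‖ ≤ N.radius := by
  have h := T.add_mem_Icc hN e hs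
  rw [T.refine_src, T.pos_nodeVertex hN, T.refine_tangent hN, add_assoc, ← add_smul]
  refine (norm_add_le _ _).trans (add_le_add ?_ ?_)
  · exact Finset.single_le_sum (f := fun i => ‖N.pos (N.src i)‖) (fun _ _ => norm_nonneg _)
      (Finset.mem_univ e.1)
  · rw [norm_smul, norm_tangent hN, mul_one]
    refine le_trans (le_of_eq (Real.norm_of_nonneg h.1)) (h.2.trans (len_le_totalLen _))

/-- A function on the struts whose increments on the elements are summable to at most `D`. -/
theorem norm_sub_le_of_chain [Fintype E] (hN : ∀ i, N.pos (N.src i) ≠ N.pos (N.tgt i))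
    {Y : (Σ i, Fin (T.m i + 1)) → ℝ → R3} {δ : (Σ i, Fin (T.m i + 1)) → ℝ} {D : ℝ}
    (hstep : ∀ e, ∀ s ∈ Icc 0 (T.refine.len e), ‖Y e s - Y e 0‖ ≤ δ e)
    (hcont : ∀ i (j : Fin (T.m i)),
      Y ⟨i, j.castSucc⟩ (T.refine.len ⟨i, j.castSucc⟩) = Y ⟨i, j.succ⟩ 0)
    (hD : ∑ e, δ e ≤ D) (e : Σ i, Fin (T.m i + 1)) {s : ℝ} (hs : s ∈ Icc 0 (T.refine.len e)) :
    ‖Y e s - Y ⟨e.1, 0⟩ 0‖ ≤ 2 * D := by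
  have hδ : ∀ e, 0 ≤ δ e := fun e =>
    (norm_nonneg _).trans (hstep e 0 ⟨le_rfl, (T.refine_len_pos hN e).le⟩)
  obtain ⟨i, j⟩ := e
  have h1 := (norm_chain_le (fun j => Y ⟨i, j⟩ (T.refine.len ⟨i, j⟩)) (fun j => Y ⟨i, j⟩ 0)
    (hcont i) j).1
  have h2 : ∑ l, ‖Y ⟨i, l⟩ (T.refine.len ⟨i, l⟩) - Y ⟨i, l⟩ 0‖ ≤ ∑ l, δ ⟨i, l⟩ :=
    Finset.sum_le_sum fun l _ => hstep ⟨i, l⟩ _ ⟨(T.refine_len_pos hN _).le, le_rfl⟩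
  have h3 : ∑ l, δ ⟨i, l⟩ ≤ D := by
    rw [Fintype.sum_sigma] at hD
    exact (Finset.single_le_sum (f := fun i => ∑ l, δ ⟨i, l⟩)
      (fun i _ => Finset.sum_nonneg fun l _ => hδ _) (Finset.mem_univ i)).trans hD
  have h4 : δ ⟨i, j⟩ ≤ D :=
    (Finset.single_le_sum (fun e _ => hδ e) (Finset.mem_univ _)).trans hD
  have h5 := hstep ⟨i, j⟩ s hs
  calc ‖Y ⟨i, j⟩ s - Y ⟨i, 0⟩ 0‖
      ≤ ‖Y ⟨i, j⟩ s - Y ⟨i, j⟩ 0‖ + ‖Y ⟨i, j⟩ 0 - Y ⟨i, 0⟩ 0‖ := norm_sub_le_norm_sub_add_norm_sub ..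
    _ ≤ 2 * D := by linarith

@[simp] theorem start_zero (i : E) : T.start ⟨i, 0⟩ = 0 := T.first i

theorem start_castSucc_add_len (hN : ∀ i, N.pos (N.src i) ≠ N.pos (N.tgt i)) (i : E)
    (j : Fin (T.m i)) :
    T.start ⟨i, j.castSucc⟩ + T.refine.len ⟨i, j.castSucc⟩ = T.start ⟨i, j.succ⟩ := by
  rw [T.refine_len hN]; simp [start]

theorem start_last_add_len (hN : ∀ i, N.pos (N.src i) ≠ N.pos (N.tgt i)) (i : E) :
    T.start ⟨i, Fin.last _⟩ + T.refine.len ⟨i, Fin.last _⟩ = N.len i := by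
  rw [T.refine_len hN, add_sub_cancel, ← T.last i]
  rfl

/-- The bending moment of a self-equilibrated stress on an element. -/
theorem isPrim_momentAt (κ : E → R3 × R3)
    (e : Σ i, Fin (T.m i + 1)) :
    IsPrim (T.refine.len e) (fun s => N.momentAt κ e.1 (T.start e + s))
      (fun _ => cross (κ e.1).1 (N.tangent e.1)) := by
  apply IsPrim.of_hasDerivAt
  · intro s _
    simp only [momentAt_add]
    simpa using ((hasDerivAt_id s).smul_const (cross (κ e.1).1 (N.tangent e.1))).const_add
      (N.momentAt κ e.1 (T.start e))
  · exact continuousOn_const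

theorem continuousOn_complianceOp (hN : N.IsStent) (e : Σ i, Fin (T.m i + 1)) :
    ContinuousOn (T.refine.complianceOp e) (Icc 0 (T.refine.len e)) := by
  have h := (hN.contDiffOn_complianceOp e.1).continuousOn
  exact h.comp (f := fun s => T.start e + s) (by fun_prop)
    fun s hs => T.add_mem_Icc hN.nondegenerate e hs

end Subdivision

/-- A self-equilibrated stress is bounded by its elastic energy. -/
theorem exists_energy_bound [Fintype V] [Fintype E] (hN : N.IsStent)
    (hgeo : N.NoAxialSelfStress) {σ : ℝ} (hσ : 0 < σ) :
    ∃ c, 0 < c ∧ ∀ (k : ℕ) (T : N.Subdivision), T.QuasiUniform σ →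
      (k = 0 → T.refine.DiscreteUnique k (k + 1)) → ∀ κ, N.residual κ = 0 → ∀ R : ℝ, 0 ≤ R →
        ∑ e, ∫ s in (0 : ℝ)..T.refine.len e,
          inner ℝ (T.refine.complianceOp e s (T.projMoment k κ e s)) (T.projMoment k κ e s)
            ≤ R * ‖κ‖ → ‖κ‖ ≤ c * R := by
  obtain ⟨c, hc, h⟩ := exists_stress_bound hN hgeo hσ
  obtain ⟨γ, hγ, hC⟩ := hN.exists_coercive
  refine ⟨c / γ, by positivity, fun k T hT hu κ hκ R hR0 hR => ?_⟩
  have h1 := h k T hT hu κ hκ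
  have h2 : γ * ∑ e, ∫ s in (0 : ℝ)..T.refine.len e, ‖T.projMoment k κ e s‖ ^ 2 ≤ R * ‖κ‖ := by
    refine le_trans ?_ hR
    rw [Finset.mul_sum]
    refine Finset.sum_le_sum fun e _ => ?_
    have hℓ := (T.refine_len_pos hN.nondegenerate e).le
    have hg := (T.isVPoly_projMoment k κ e).isL2 (T.refine.len e)
    rw [← intervalIntegral.integral_const_mul]
    refine intervalIntegral.integral_mono_on hℓ ((hg.intervalIntegrable_sq hℓ).const_mul _)
      ((isL2_clm_apply (T.continuousOn_complianceOp hN e) hg).intervalIntegrable_inner hℓ hg)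
      fun s hs => ?_
    exact hC e.1 _ (T.add_mem_Icc hN.nondegenerate e hs) _
  rcases (norm_nonneg κ).eq_or_lt with h0 | h0
  · rw [← h0]; positivity
  · have h3 : ‖κ‖ * ‖κ‖ ≤ c / γ * R * ‖κ‖ := by
      rw [← sq]
      refine h1.trans ?_
      rw [div_mul_eq_mul_div, div_mul_eq_mul_div, le_div_iff₀ hγ]
      nlinarith
    exact le_of_mul_le_mul_right h3 h0

theorem norm_balance_le_of_sub_le [Fintype E] {A A' B : E → R3} {j : V} {b : ℝ}
    (h : N.balance A' B j = 0) (hb : ∀ i, ‖A i - A' i‖ ≤ b) :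
    ‖N.balance A B j‖ ≤ Fintype.card E * b := by
  rw [← sub_zero (N.balance A B j), ← h, ← balance_sub]
  refine (norm_balance_le _ _ _).trans ?_
  simpa using Finset.sum_le_sum fun i (_ : i ∈ Finset.univ) => hb i

/-- The solution is close to constant forces and affine moments on every strut. -/
theorem Solves.near_affine [Fintype V] [Fintype E] (hN : N.IsStent) (T : N.Subdivision)
    {f : (Σ i, Fin (T.m i + 1)) → ℝ → R3} (hf : ∀ e, IsL2 (T.refine.len e) (f e))
    {S : ForceField (Σ i, Fin (T.m i + 1))}
    {φ : MotionField (V ⊕ (Σ i, Fin (T.m i))) (Σ i, Fin (T.m i + 1))}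
    (h : T.refine.Solves f S φ) {Φ c1 : ℝ} (hΦ : T.refine.loadNorm f = Φ)
    (hα : N.totalLen * ‖S.α‖ ≤ Φ) (hβ : N.totalLen * ‖S.β‖ ≤ 2 * N.radius * Φ)
    (hc1 : N.totalLen * 4 + 2 * N.radius = c1) {X : E → R3 × R3}
    (hX : X = fun i => (S.Pm ⟨i, 0⟩, S.Qm ⟨i, 0⟩)) :
    (∀ e, ‖S.Pm e - (X e.1).1‖ ≤ 4 * Φ ∧ ‖S.Pp e - (X e.1).1‖ ≤ 4 * Φ) ∧
      ∀ e, ∃ Q : ℝ → R3, Q 0 = S.Qm e ∧ Q (T.refine.len e) = S.Qp e ∧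
        (∀ᵐ s ∂volume.restrict (Ioc 0 (T.refine.len e)), S.q e s = Q s) ∧
          ∀ s ∈ Icc 0 (T.refine.len e),
            ‖Q s - N.momentAt X e.1 (T.start e + s)‖ ≤ 2 * c1 * Φ := by
  have hnd := hN.nondegenerate
  have hlen := T.refine_len_pos hnd
  have hΦ0 : 0 ≤ Φ := hΦ ▸ loadNorm_nonneg f
  have htot : ∑ e, T.refine.len e = N.totalLen := T.totalLen_refine hnd
  choose P hP hP0 hPℓ hpP using h.exists_force hlen hf
  choose Q hQ hQ0 hQℓ hqQ using h.exists_moment hlen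
  have hbal := h.balance_eq_zero hlen
  have hPs : ∀ e, ∀ s ∈ Icc 0 (T.refine.len e), ‖P e s - (X e.1).1‖ ≤ 4 * Φ := by
    intro e s hs
    -- The increments of P sum to at most Φ from the load plus L ‖α‖ ≤ Φ from the multiplier.
    have := T.norm_sub_le_of_chain hnd (Y := P) (D := 2 * Φ)
      (δ := fun e => √(T.refine.len e) * l2norm (T.refine.len e) (f e)
        + T.refine.len e * ‖S.α‖) ?_ ?_ ?_ e hs
    · rw [hP0] at this
      simp only [hX]
      linarith
    · intro e s hs
      have hℓ := (hlen e).le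
      refine ((hP e).norm_sub_le hℓ hs).trans ?_
      rw [l2norm_neg]
      calc _ ≤ √(T.refine.len e) * (l2norm (T.refine.len e) (f e)
            + l2norm (T.refine.len e) (fun _ => S.α)) := by
              gcongr; exact l2norm_add_le hℓ (hf e) (isL2_const _)
        _ = _ := by rw [l2norm_const hℓ, mul_add, ← mul_assoc, Real.mul_self_sqrt hℓ]
    · intro i j
      have := (hbal (Sum.inr ⟨i, j⟩)).1
      rw [T.balance_inr] at this
      rw [hPℓ, hP0]; exact sub_eq_zero.1 this
    · rw [Finset.sum_add_distrib, ← Finset.sum_mul, htot]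
      rw [← loadNorm, hΦ]
      linarith
  have hY : ∀ e, IsPrim (T.refine.len e) (fun s => Q e s - N.momentAt X e.1 (T.start e + s))
      (fun s => -(-cross (S.p e s) (T.refine.tangent e) + S.β)
        - cross (X e.1).1 (N.tangent e.1)) :=
    fun e => (hQ e).sub (hlen e).le (T.isPrim_momentAt X e)
  have hmom0 : ∀ i, N.momentAt X i (T.start ⟨i, 0⟩ + 0) = S.Qm ⟨i, 0⟩ := fun i => by
    simp [momentAt, hX]
  have hQs : ∀ e, ∀ s ∈ Icc 0 (T.refine.len e),
      ‖Q e s - N.momentAt X e.1 (T.start e + s)‖ ≤ 2 * c1 * Φ := by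
    intro e s hs
    -- The deviation of the moment from the affine one has density of size at most 4 Φ + ‖β‖;
    -- integrated over the total length this is at most c1 Φ.
    have := T.norm_sub_le_of_chain hnd
      (Y := fun e s => Q e s - N.momentAt X e.1 (T.start e + s)) (D := c1 * Φ)
      (δ := fun e => T.refine.len e * (4 * Φ + ‖S.β‖)) ?_ ?_ ?_ e hs
    · simp only [hmom0, hQ0, sub_self, sub_zero] at this; linarith
    · intro e s hs
      have hℓ := (hlen e).le
      refine ((hY e).norm_sub_le hℓ hs).trans ?_
      have hb : l2norm (T.refine.len e) (fun s => -(-cross (S.p e s) (T.refine.tangent e) + S.β)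
          - cross (X e.1).1 (N.tangent e.1)) ≤ √(T.refine.len e) * (4 * Φ + ‖S.β‖) := by
        have hae : ∀ᵐ s ∂volume.restrict (Ioc 0 (T.refine.len e)),
            -(-cross (S.p e s) (T.refine.tangent e) + S.β) - cross (X e.1).1 (N.tangent e.1)
              = cross (P e s - (X e.1).1) (N.tangent e.1) - S.β := by
          filter_upwards [hpP e] with s hs
          rw [hs, sub_cross', T.refine_tangent hnd]
          abel
        rw [l2norm_congr_ae hℓ hae]
        refine l2norm_le_of_bound hℓ (by positivity) fun s hs => (norm_sub_le _ _).trans ?_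
        gcongr
        refine (norm_cross_le _ _).trans ?_
        rw [norm_tangent hnd, mul_one]
        exact hPs e s (Ioc_subset_Icc_self hs)
      calc _ ≤ √(T.refine.len e) * (√(T.refine.len e) * (4 * Φ + ‖S.β‖)) := by gcongr
        _ = _ := by rw [← mul_assoc, Real.mul_self_sqrt hℓ]
    · intro i j
      have := (hbal (Sum.inr ⟨i, j⟩)).2
      rw [T.balance_inr] at this
      have h2 : T.start ⟨i, j.castSucc⟩ + T.refine.len ⟨i, j.castSucc⟩ = T.start ⟨i, j.succ⟩ + 0 := by
        rw [T.start_castSucc_add_len hnd, add_zero]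
      simp only [hQℓ, hQ0, h2, sub_eq_zero.1 this]
    · rw [← Finset.sum_mul, htot, ← hc1]
      nlinarith
  refine ⟨fun e => ⟨?_, ?_⟩, fun e => ⟨Q e, hQ0 e, hQℓ e, hqQ e, hQs e⟩⟩
  · rw [← hP0]; exact hPs e 0 ⟨le_rfl, (hlen e).le⟩
  · rw [← hPℓ]; exact hPs e _ ⟨(hlen e).le, le_rfl⟩

/-- The solution is balanced and agrees with X at the starts of the struts, so only the entering
ends contribute, each by at most `b`. -/
theorem Solves.norm_residual_le [Fintype V] [Fintype E]
    (hN : ∀ i, N.pos (N.src i) ≠ N.pos (N.tgt i)) (T : N.Subdivision)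
    {f : (Σ i, Fin (T.m i + 1)) → ℝ → R3} {S : ForceField (Σ i, Fin (T.m i + 1))}
    {φ : MotionField (V ⊕ (Σ i, Fin (T.m i))) (Σ i, Fin (T.m i + 1))}
    (h : T.refine.Solves f S φ) {X : E → R3 × R3}
    (hX : X = fun i => (S.Pm ⟨i, 0⟩, S.Qm ⟨i, 0⟩)) {b : ℝ}
    (hP : ∀ e, ‖S.Pp e - (X e.1).1‖ ≤ b)
    (hQ : ∀ i, ‖S.Qp ⟨i, Fin.last _⟩ - N.momentAt X i (N.len i)‖ ≤ b) :
    ‖N.residual X‖ ≤ Fintype.card E * b := by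
  have hb : 0 ≤ Fintype.card E * b := by
    rcases isEmpty_or_nonempty E with h0 | ⟨⟨i⟩⟩
    · simp
    · exact mul_nonneg (Nat.cast_nonneg _) ((norm_nonneg _).trans (hQ i))
  have hbal := h.balance_eq_zero (T.refine_len_pos hN)
  refine (pi_norm_le_iff_of_nonneg hb).2 fun j => max_le ?_ ?_
  · have h1 := (hbal (Sum.inl j)).1
    rw [T.balance_inl] at h1
    have h0 : (fun i => S.Pm ⟨i, 0⟩) = fun i => (X i).1 := by rw [hX]
    rw [h0] at h1
    refine norm_balance_le_of_sub_le h1 fun i => ?_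
    rw [norm_sub_rev]
    exact hP ⟨i, Fin.last _⟩
  · have h1 := (hbal (Sum.inl j)).2
    rw [T.balance_inl] at h1
    have h0 : (fun i => S.Qm ⟨i, 0⟩) = fun i => N.momentAt X i 0 := by
      funext i; simp [momentAt, hX]
    rw [h0] at h1
    refine norm_balance_le_of_sub_le h1 fun i => ?_
    rw [norm_sub_rev]
    exact hQ i

/-- The stress field of κ is annihilated by b, so its moment is orthogonal to C q. Hence q may be
subtracted from one argument of the energy of κ, and only the small difference remains. With index 1
the moment is not changed by the projection. -/
theorem Solves.energy_le [Fintype V] [Fintype E] (hN : N.IsStent) (T : N.Subdivision)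
    {f : (Σ i, Fin (T.m i + 1)) → ℝ → R3} {S : ForceField (Σ i, Fin (T.m i + 1))}
    {φ : MotionField (V ⊕ (Σ i, Fin (T.m i))) (Σ i, Fin (T.m i + 1))}
    (h : T.refine.Solves f S φ) {M b : ℝ} (hM : 0 ≤ M) (hb : 0 ≤ b)
    (hCM : ∀ i, ∀ s ∈ Icc 0 (N.len i), ‖N.complianceOp i s‖ ≤ M) {κ : E → R3 × R3}
    (hκ : N.residual κ = 0)
    (hq : ∀ e, ∀ᵐ s ∂volume.restrict (Ioc 0 (T.refine.len e)),
      ‖T.projMoment 1 κ e s - S.q e s‖ ≤ b) :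
    ∑ e, ∫ s in (0 : ℝ)..T.refine.len e,
      inner ℝ (T.refine.complianceOp e s (T.projMoment 1 κ e s)) (T.projMoment 1 κ e s)
        ≤ M * b * (1 + N.totalLen) * N.totalLen * ‖κ‖ := by
  have hnd := hN.nondegenerate
  have hlen := T.refine_len_pos hnd
  have hL := N.totalLen_nonneg
  have htot : ∑ e, T.refine.len e = N.totalLen := T.totalLen_refine hnd
  obtain ⟨g, hg⟩ : ∃ g, g = T.projMoment 1 κ := ⟨_, rfl⟩
  have hgm : ∀ e s, g e s = N.momentAt κ e.1 (T.start e + s) := fun e s => by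
    simp [hg, Subdivision.projMoment]
  have hgL2 : ∀ e, IsL2 (T.refine.len e) (g e) :=
    fun e => hg ▸ (T.isVPoly_projMoment 1 κ e).isL2 _
  have hgb : ∀ e, ∀ s ∈ Icc 0 (T.refine.len e), ‖g e s‖ ≤ (1 + N.totalLen) * ‖κ‖ :=
    fun e s hs => hg ▸ T.norm_projMoment_le hnd len_le_totalLen 1 κ e hs
  rw [← hg] at hq ⊢
  have henergy : ∑ e, ∫ s in (0 : ℝ)..T.refine.len e,
      inner ℝ (T.refine.complianceOp e s (S.q e s)) (g e s) = 0 := by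
    have h1 := h.eq_V (T.stressField κ g) ⟨hgL2, fun e => isL2_const _⟩
    rw [T.formB_stressField hnd hκ hgL2 h.mem_M (fun e => by simp [hgm]), add_zero] at h1
    simp only [formA, matVec_eq] at h1
    exact h1
  refine le_of_eq_of_le (sub_eq_self.2 henergy).symm ?_
  rw [← Finset.sum_sub_distrib]
  have hfin : M * b * (1 + N.totalLen) * N.totalLen * ‖κ‖
      = ∑ e, T.refine.len e * (M * b * (1 + N.totalLen) * ‖κ‖) := by
    rw [← Finset.sum_mul, htot]; ring
  rw [hfin]
  refine Finset.sum_le_sum fun e _ => ?_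
  have hℓ := (hlen e).le
  have hC := T.continuousOn_complianceOp hN e
  have hS := h.mem_V.q_mem e
  rw [← intervalIntegral.integral_sub
    ((isL2_clm_apply hC (hgL2 e)).intervalIntegrable_inner hℓ (hgL2 e))
    ((isL2_clm_apply hC hS).intervalIntegrable_inner hℓ (hgL2 e))]
  simp only [← inner_sub_left, ← map_sub]
  refine (le_abs_self _).trans ((abs_integral_inner_le hℓ
    (isL2_clm_apply hC ((hgL2 e).sub hS)) (hgL2 e)).trans ?_)
  have h1 := l2norm_le_of_bound hℓ (by positivity) fun s hs => hgb e s (Ioc_subset_Icc_self hs)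
  have h2 := l2norm_clm_apply_le hℓ hM
    (fun s hs => hCM e.1 _ (T.add_mem_Icc hnd e hs)) ((hgL2 e).sub hS)
  have h3 : l2norm (T.refine.len e) (fun s => g e s - S.q e s) ≤ √(T.refine.len e) * b :=
    l2norm_le_of_ae_bound hℓ hb (hq e)
  calc _ ≤ (M * (√(T.refine.len e) * b)) * (√(T.refine.len e) * ((1 + N.totalLen) * ‖κ‖)) := by
        refine mul_le_mul (h2.trans (by gcongr)) h1 (l2norm_nonneg _ _) (by positivity)
    _ = √(T.refine.len e) * √(T.refine.len e) * (M * b * (1 + N.totalLen) * ‖κ‖) := by ring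
    _ = _ := by rw [Real.mul_self_sqrt hℓ]

/-- Bounds for the forces and moments of the solution at the vertices, uniform in the subdivision. -/
theorem exists_stability [Fintype V] [Fintype E] (hN : N.IsStent)
    (hgeo : N.NoAxialSelfStress) {σ : ℝ} (hσ : 0 < σ) :
    ∃ c, 0 ≤ c ∧ ∀ T : N.Subdivision, T.QuasiUniform σ → ∀ f,
      (∀ e, IsL2 (T.refine.len e) (f e)) → ∀ S φ, T.refine.Solves f S φ →
        ‖S.α‖ ≤ c * T.refine.loadNorm f ∧ ‖S.β‖ ≤ c * T.refine.loadNorm f ∧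
          ∀ e, ‖S.Pm e‖ ≤ c * T.refine.loadNorm f ∧ ‖S.Qm e‖ ≤ c * T.refine.loadNorm f := by
  classical
  have := hN.nonempty
  have hnd := hN.nondegenerate
  obtain ⟨cE, hcE, hE⟩ := exists_energy_bound hN hgeo hσ
  obtain ⟨M, hM, hCM⟩ := hN.exists_norm_complianceOp_le
  obtain ⟨cR, hcR, hR⟩ := N.exists_residual_correction
  set L := N.totalLen with hL
  have hLpos : 0 < L := hN.totalLen_pos
  set r := N.radius with hr
  have hr0 : 0 ≤ r := radius_nonneg
  obtain ⟨c1, hc1⟩ : ∃ c, c = L * 4 + 2 * r := ⟨_, rfl⟩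
  obtain ⟨c3, hc3⟩ : ∃ c, c = cR * (Fintype.card E * (4 + 2 * c1)) := ⟨_, rfl⟩
  obtain ⟨c4, hc4⟩ : ∃ c, c = 2 * c1 + (1 + L) * c3 := ⟨_, rfl⟩
  obtain ⟨c5, hc5⟩ : ∃ c, c = cE * (M * c4 * (1 + L) * L) := ⟨_, rfl⟩
  have hc10 : 0 ≤ c1 := by rw [hc1]; positivity
  have hc30 : 0 ≤ c3 := by rw [hc3]; positivity
  have hc40 : 0 ≤ c4 := by rw [hc4]; positivity
  have hc50 : 0 ≤ c5 := by rw [hc5]; positivity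
  refine ⟨1 / L + 2 * r / L + 4 + 2 * c1 + c4 + (1 + L) * c5 + c3 + c5, by positivity,
    fun T hT f hf S φ h => ?_⟩
  have : Nonempty (Σ i, Fin (T.m i + 1)) := ⟨⟨Classical.arbitrary E, 0⟩⟩
  have hlen := T.refine_len_pos hnd
  have hnd' : ∀ e, T.refine.pos (T.refine.src e) ≠ T.refine.pos (T.refine.tgt e) :=
    fun e => dist_pos.1 (hlen e)
  set Φ := T.refine.loadNorm f with hΦ
  have hΦ0 : 0 ≤ Φ := loadNorm_nonneg f
  have htot : ∑ e, T.refine.len e = L := T.totalLen_refine hnd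
  obtain ⟨hα, hβ⟩ := norm_multipliers_le hnd' hf radius_nonneg (T.norm_point_le hnd)
    (fun c ρ => h.eq_M _ (memMh_rigidMotion 0 c ρ).mem)
  rw [htot] at hα hβ
  have hα' : ‖S.α‖ ≤ 1 / L * Φ := by rw [div_mul_eq_mul_div, le_div_iff₀ hLpos]; linarith
  have hβ' : ‖S.β‖ ≤ 2 * r / L * Φ := by rw [div_mul_eq_mul_div, le_div_iff₀ hLpos]; linarith
  have hbal := h.balance_eq_zero hlen
  -- X continues the values at the starts of the struts by constant forces and affine moments. It is
  -- self-equilibrated up to the size of the load, and κ is its correction.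
  obtain ⟨X, hX⟩ : ∃ X : E → R3 × R3, X = fun i => (S.Pm ⟨i, 0⟩, S.Qm ⟨i, 0⟩) := ⟨_, rfl⟩
  obtain ⟨hPs, hQ⟩ := h.near_affine hN T hf rfl hα hβ hc1.symm hX
  choose Q hQ0 hQℓ hqQ hQs using hQ
  have hres : ‖N.residual X‖ ≤ Fintype.card E * (4 + 2 * c1) * Φ := by
    rw [mul_assoc]
    exact h.norm_residual_le hnd T hX (fun e => (hPs e).2.trans (by nlinarith)) fun i => by
      have h2 := hQs ⟨i, Fin.last _⟩ _ ⟨(hlen _).le, le_rfl⟩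
      rw [hQℓ, T.start_last_add_len hnd] at h2
      exact h2.trans (by nlinarith)
  obtain ⟨κ, hκ, hXκ⟩ := hR X
  have hXκ' : ‖X - κ‖ ≤ c3 * Φ := hXκ.trans (by rw [hc3, mul_assoc]; gcongr)
  obtain ⟨g, hg⟩ : ∃ g, g = T.projMoment 1 κ := ⟨_, rfl⟩
  have hgm : ∀ e s, g e s = N.momentAt κ e.1 (T.start e + s) := fun e s => by
    simp [hg, Subdivision.projMoment]
  have hgb : ∀ e, ∀ s ∈ Icc 0 (T.refine.len e), ‖g e s‖ ≤ (1 + L) * ‖κ‖ := fun e s hs =>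
    hg ▸ T.norm_projMoment_le hnd len_le_totalLen 1 κ e hs
  have hy : ∀ e, ∀ s ∈ Icc 0 (T.refine.len e), ‖Q e s - g e s‖ ≤ c4 * Φ := by
    intro e s hs
    have h1 := hQs e s hs
    have hm := T.add_mem_Icc hnd e hs
    have h2 := norm_momentAt_le hnd (X - κ) e.1 hm.1 (hm.2.trans (len_le_totalLen _))
    have h3 : Q e s - g e s = (Q e s - N.momentAt X e.1 (T.start e + s))
        + N.momentAt (X - κ) e.1 (T.start e + s) := by
      rw [hgm]
      simp only [momentAt, Pi.sub_apply, Prod.fst_sub, Prod.snd_sub, sub_cross', smul_sub]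
      abel
    rw [h3]
    refine (norm_add_le _ _).trans ?_
    have h4 : (1 + N.totalLen) * ‖X - κ‖ ≤ (1 + L) * (c3 * Φ) := by gcongr
    rw [hc4, add_mul]
    linarith
  have hκb : ‖κ‖ ≤ cE * (M * (c4 * Φ) * (1 + L) * L) := by
    -- The exact solution does not know the discrete degree; with index 1 the uniqueness condition
    -- is void.
    refine hE 1 T hT (by simp) κ hκ _ (by positivity)
      (h.energy_le hN T hM (by positivity) hCM hκ fun e => ?_)
    filter_upwards [hqQ e, ae_restrict_mem measurableSet_Ioc] with s hs hs'
    rw [hs, ← hg, norm_sub_rev]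
    exact hy e s (Ioc_subset_Icc_self hs')
  have hκb' : ‖κ‖ ≤ c5 * Φ := hκb.trans (le_of_eq (by rw [hc5]; ring))
  have hXb : ‖X‖ ≤ c3 * Φ + c5 * Φ := by
    have := norm_add_le (X - κ) κ
    rw [sub_add_cancel] at this
    linarith
  have h1L : 0 ≤ 1 / L * Φ := by positivity
  have h2L : 0 ≤ 2 * r / L * Φ := by positivity
  have p1 : 0 ≤ c1 * Φ := by positivity
  have p3 : 0 ≤ c3 * Φ := by positivity
  have p4 : 0 ≤ c4 * Φ := by positivity
  have p5 : 0 ≤ c5 * Φ := by positivity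
  have p6 : 0 ≤ (1 + L) * c5 * Φ := by positivity
  have p7 : 0 ≤ 1 / L * Φ + 2 * r / L * Φ + 4 * Φ + 2 * (c1 * Φ) := by positivity
  refine ⟨by linarith, by linarith, fun e => ⟨?_, ?_⟩⟩
  · have h1 := (hPs e).1
    have h2 : ‖(X e.1).1‖ ≤ ‖X‖ := (norm_fst_le (X e.1)).trans (norm_le_pi_norm X e.1)
    have h3 := norm_sub_norm_le (S.Pm e) (X e.1).1
    linarith
  · have h1 := hy e 0 ⟨le_rfl, (hlen e).le⟩
    rw [hQ0] at h1
    have h2 := hgb e 0 ⟨le_rfl, (hlen e).le⟩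
    have h3 := norm_sub_norm_le (S.Qm e) (g e 0)
    have h4 : (1 + L) * ‖κ‖ ≤ (1 + L) * (c5 * Φ) := by gcongr
    linarith

end StrutNetwork

/-! ### ### Polynomial approximation of the exact solution -/

/-- `g` has on `[0, ℓ]` the `L²` distance at most `ε` to a polynomial of degree at most `k`. -/
def ApproxPoly (ℓ : ℝ) (k : ℕ) (ε : ℝ) (g : ℝ → R3) : Prop :=
  ∃ π, IsVPoly k π ∧ l2norm ℓ (fun s => g s - π s) ≤ ε

theorem ApproxPoly.mono {ℓ ε ε' : ℝ} {k : ℕ} {g : ℝ → R3} (h : ApproxPoly ℓ k ε g) (hε : ε ≤ ε') :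
    ApproxPoly ℓ k ε' g := by
  obtain ⟨π, h1, h2⟩ := h
  exact ⟨π, h1, h2.trans hε⟩

theorem norm_crossR_le (t : R3) : ‖crossR t‖ ≤ ‖t‖ :=
  ContinuousLinearMap.opNorm_le_bound _ (norm_nonneg t) fun x => by
    rw [crossR_apply, mul_comm]; exact norm_cross_le x t

/-- The solution of the equations on one element is smooth as the load permits. -/
theorem approxPoly_element {ℓ Λ M B : ℝ} (hℓ : 0 < ℓ) (hΛ : ℓ ≤ Λ) (hM : 0 ≤ M) (hB : 0 ≤ B)
    {r k m : ℕ} (hr : m ≤ r) (hk : m ≤ k) {f p q w P Q : ℝ → R3} {D : ℕ → ℝ → R3}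
    {t α β : R3} (ht : ‖t‖ = 1) {C : ℝ → R3 →L[ℝ] R3} (hC : ContinuousOn C (Icc 0 ℓ))
    {a : ℕ → R3 →L[ℝ] R3} (ha : ∀ j < m + 1, ‖a j‖ ≤ M)
    (hCa : ∀ s ∈ Icc 0 ℓ, ∀ m' ≤ m + 1,
      ‖C s - ∑ j ∈ Finset.range m', s ^ j • a j‖ ≤ M * s ^ m')
    (hf : IsHr ℓ r f D) (hD : ∀ j ≤ r, l2norm ℓ (D j) ≤ B)
    (hα : √ℓ * ‖α‖ ≤ B) (hβ : √ℓ * ‖β‖ ≤ B) (hP0 : √ℓ * ‖P 0‖ ≤ B) (hQ0 : √ℓ * ‖Q 0‖ ≤ B)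
    (hP : IsPrim ℓ P (fun s => -(f s + α)))
    (hQ : IsPrim ℓ Q (fun s => -(-cross (p s) t + β)))
    (hp : ∀ᵐ s ∂volume.restrict (Ioc 0 ℓ), p s = P s)
    (hq : ∀ᵐ s ∂volume.restrict (Ioc 0 ℓ), q s = Q s)
    (hw : IsPrim ℓ w (fun s => C s (q s))) :
    let ε := ((1 + Λ) * (2 + Λ) + 1) * (1 + (1 + Λ) * ((m + 2) * M)) * (ℓ ^ (m + 1) * B)
    ApproxPoly ℓ k ε p ∧ ApproxPoly ℓ k ε q ∧ ApproxPoly ℓ k ε (fun s => C s (q s)) ∧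
      ApproxPoly ℓ k ε w := by
  intro ε
  have hℓ0 := hℓ.le
  have hΛ0 : 0 ≤ Λ := hℓ0.trans hΛ
  set c2 := (1 + Λ) * (2 + Λ) + 1 with hc2
  have hc20 : 0 ≤ c2 := by positivity
  have hk1 : m + 1 ≤ k + 1 := by omega
  have f1 : TaylorL2 ℓ m ((1 + Λ) * B) f := by
    have := hf.taylorL2 hℓ hΛ hB hD m 0 (by omega)
    rwa [hf.zero] at this
  have p1 : TaylorL2 ℓ (m + 1) ((2 + Λ) * B) p := by
    refine (TaylorL2.prim hℓ0 hP (by nlinarith)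
      ((f1.add hℓ0 (taylorL2_const hℓ0 m hB hα)).neg.mono hℓ0 (by linarith))).congr_ae hℓ0 ?_
    filter_upwards [hp] with s hs using hs.symm
  have q1 : TaylorL2 ℓ (m + 1) (c2 * B) q := by
    -- The expansion of p is first lowered to order `m`, so that integration gives q the order `m +
    -- 1`; no higher order is needed, since p has no better one.
    have h1 := p1.of_succ hℓ0 hΛ (by positivity)
    have h2 := (((h1.clm hℓ0 (crossR t)).neg.add hℓ0 (taylorL2_const hℓ0 m hB hβ)).neg).mono
      (B' := c2 * B) hℓ0 (by
        have h3 := norm_crossR_le t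
        rw [ht] at h3
        have h4 : ‖crossR t‖ * ((1 + Λ) * ((2 + Λ) * B)) ≤ 1 * ((1 + Λ) * ((2 + Λ) * B)) := by
          gcongr
        rw [hc2]
        linarith)
    simp only [crossR_apply] at h2
    refine (TaylorL2.prim hℓ0 hQ (hQ0.trans ?_) h2).congr_ae hℓ0 ?_
    · rw [hc2]
      have : 0 ≤ (1 + Λ) * (2 + Λ) * B := by positivity
      linarith
    · filter_upwards [hq] with s hs using hs.symm
  have C1 : TaylorL2 ℓ (m + 1) ((m + 2) * (M * (c2 * B))) (fun s => C s (q s)) := by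
    have := q1.clm_apply hℓ0 hM hC ha hCa (by positivity)
    refine this.mono hℓ0 (le_of_eq ?_)
    push_cast; ring
  have C0 := C1.of_succ hℓ0 hΛ (by positivity)
  obtain ⟨πp, h1, h2⟩ := p1.exists_approx hk1
  obtain ⟨πq, h3, h4⟩ := q1.exists_approx hk1
  obtain ⟨πC, h5, h6⟩ := C1.exists_approx hk1
  obtain ⟨πw, h7, h8⟩ := C0.exists_approx_prim hℓ0 (by positivity) hw hk
  set y := ℓ ^ (m + 1) * B with hy
  have hy0 : 0 ≤ y := by positivity
  have e1 : 0 ≤ (m + 2) * M * (c2 * y) := by positivity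
  have e2 : 0 ≤ Λ * ((m + 2) * M * (c2 * y)) := by positivity
  have e3 : 0 ≤ c2 * y := by positivity
  have e4 : (2 + Λ) * y ≤ c2 * y := by
    gcongr
    rw [hc2]
    nlinarith
  have hε : ε = c2 * y + (m + 2) * M * (c2 * y) + Λ * ((m + 2) * M * (c2 * y)) := by
    simp only [ε]; ring
  refine ⟨⟨πp, h1, h2.trans ?_⟩, ⟨πq, h3, h4.trans ?_⟩, ⟨πC, h5, h6.trans ?_⟩,
    ⟨πw, h7, h8.trans ?_⟩⟩
  · calc _ = (2 + Λ) * y := by rw [hy]; ring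
      _ ≤ _ := by rw [hε]; linarith
  · calc _ = c2 * y := by rw [hy]; ring
      _ ≤ _ := by rw [hε]; linarith
  · calc _ = (m + 2) * M * (c2 * y) := by rw [hy]; ring
      _ ≤ _ := by rw [hε]; linarith
  · calc _ = (m + 2) * M * (c2 * y) + Λ * ((m + 2) * M * (c2 * y)) := by rw [hy]; ring
      _ ≤ _ := by rw [hε]; linarith

namespace StrutNetwork

variable {V E : Type*} {N : StrutNetwork V E}

theorem len_le_maxLen [Finite E] (i : E) : N.len i ≤ N.maxLen :=
  le_ciSup (Set.finite_range N.len).bddAbove i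

/-- The contribution of one strut to the norm of a load. -/
def edgeHr (N : StrutNetwork V E) (r : ℕ) (D : E → ℕ → ℝ → R3) (i : E) : ℝ :=
  √(∑ j ∈ Finset.range (r + 1), ∫ s in (0 : ℝ)..N.len i, ‖D i j s‖ ^ 2)

theorem sq_edgeHr (r : ℕ) (D : E → ℕ → ℝ → R3) (i : E) :
    N.edgeHr r D i ^ 2 = ∑ j ∈ Finset.range (r + 1), ∫ s in (0 : ℝ)..N.len i, ‖D i j s‖ ^ 2 :=
  Real.sq_sqrt (Finset.sum_nonneg fun _ _ => integral_norm_sq_nonneg dist_nonneg _)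

theorem sum_sq_edgeHr [Fintype E] (r : ℕ) (D : E → ℕ → ℝ → R3) :
    ∑ i, N.edgeHr r D i ^ 2 = N.normHr r D ^ 2 := by
  rw [normHr, Real.sq_sqrt]
  · exact Finset.sum_congr rfl fun i _ => sq_edgeHr r D i
  · exact Finset.sum_nonneg fun _ _ => Finset.sum_nonneg fun _ _ =>
      integral_norm_sq_nonneg dist_nonneg _

theorem l2norm_le_edgeHr (r : ℕ) (D : E → ℕ → ℝ → R3) (i : E) {j : ℕ} (hj : j ≤ r) :
    l2norm (N.len i) (D i j) ≤ N.edgeHr r D i := by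
  refine Real.le_sqrt_of_sq_le ?_
  rw [sq_l2norm (ℓ := N.len i) dist_nonneg]
  exact Finset.single_le_sum (f := fun j => ∫ s in (0 : ℝ)..N.len i, ‖D i j s‖ ^ 2)
    (fun _ _ => integral_norm_sq_nonneg dist_nonneg _) (Finset.mem_range.2 (by omega))

theorem loadNorm_le [Fintype E] {r : ℕ} {f : E → ℝ → R3} {D : E → ℕ → ℝ → R3}
    (h : N.IsLoad r f D) : N.loadNorm f ≤ √N.totalLen * N.normHr r D := by
  have h1 : ∀ i, l2norm (N.len i) (f i) ≤ N.edgeHr r D i := fun i => by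
    have := l2norm_le_edgeHr (N := N) r D i (Nat.zero_le r)
    rwa [(h i).zero] at this
  calc N.loadNorm f ≤ ∑ i, √(N.len i) * N.edgeHr r D i := by
        unfold loadNorm; gcongr with i; exact h1 i
    _ ≤ √(∑ i, √(N.len i) ^ 2) * √(∑ i, N.edgeHr r D i ^ 2) := Real.sum_mul_le_sqrt_mul_sqrt ..
    _ = _ := by
        have h0 : 0 ≤ N.normHr r D := Real.sqrt_nonneg _
        rw [sum_sq_edgeHr, Real.sqrt_sq h0]
        congr 2
        exact Finset.sum_congr rfl fun i _ => Real.sq_sqrt dist_nonneg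

/-- Polynomial approximation of the solution, uniform in the subdivision. -/
theorem exists_approximation [Fintype V] [Fintype E] (hN : N.IsStent)
    (hgeo : N.NoAxialSelfStress) {σ : ℝ} (hσ : 0 < σ) (k r : ℕ) :
    ∃ c, 0 ≤ c ∧ ∀ T : N.Subdivision, T.QuasiUniform σ → ∀ f D, T.refine.IsLoad r f D →
      ∀ S φ, T.refine.Solves f S φ → ∃ ε : (Σ i, Fin (T.m i + 1)) → ℝ, (∀ e, 0 ≤ ε e) ∧
        ∑ e, ε e ^ 2
          ≤ (c * T.refine.maxLen ^ min (r + 1) (k + 1) * T.refine.normHr r D) ^ 2 ∧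
        ∀ e, ApproxPoly (T.refine.len e) k (ε e) (S.p e) ∧
          ApproxPoly (T.refine.len e) k (ε e) (S.q e) ∧
          ApproxPoly (T.refine.len e) k (ε e) (fun s => T.refine.complianceOp e s (S.q e s)) ∧
          ApproxPoly (T.refine.len e) k (ε e) (φ.w e) := by
  classical
  have := hN.nonempty
  have hnd := hN.nondegenerate
  -- Only `m` derivatives of the load are useful: integration gives the order `m + 1`, and the
  -- degree `k` admits no more than `k + 1`.
  obtain ⟨m, hm⟩ : ∃ m, m = min r k := ⟨_, rfl⟩
  have hm1 : min (r + 1) (k + 1) = m + 1 := by omega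
  have hmr : m ≤ r := by omega
  have hmk : m ≤ k := by omega
  obtain ⟨cs, hcs, hstab⟩ := exists_stability hN hgeo hσ
  obtain ⟨M, hM, hCM⟩ := hN.exists_taylor (m + 1)
  obtain ⟨L, hL⟩ : ∃ L, L = N.totalLen := ⟨_, rfl⟩
  have hL0 : 0 ≤ L := hL ▸ totalLen_nonneg
  obtain ⟨c', hc'⟩ : ∃ c', c' = cs * √L := ⟨_, rfl⟩
  have hc'0 : 0 ≤ c' := by rw [hc']; positivity
  obtain ⟨c, hc⟩ : ∃ c, c = ((1 + L) * (2 + L) + 1) * (1 + (1 + L) * ((m + 2) * M)) := ⟨_, rfl⟩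
  have hc0 : 0 ≤ c := by rw [hc]; positivity
  refine ⟨c * √(2 + 2 * c' ^ 2 * L), by positivity, fun T hT f D hf S φ h => ?_⟩
  have hlen := T.refine_len_pos hnd
  obtain ⟨F, hF⟩ : ∃ F, F = T.refine.normHr r D := ⟨_, rfl⟩
  have hF0 : 0 ≤ F := hF ▸ Real.sqrt_nonneg _
  have htot : ∑ e, T.refine.len e = L := hL ▸ T.totalLen_refine hnd
  have hfL2 : ∀ e, IsL2 (T.refine.len e) (f e) := fun e => by
    have := (hf e).mem 0 (Nat.zero_le r)
    rwa [(hf e).zero] at this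
  have hΦ : cs * T.refine.loadNorm f ≤ c' * F := by
    have := loadNorm_le hf
    rw [T.totalLen_refine hnd, ← hL, ← hF] at this
    rw [hc', mul_assoc]
    gcongr
  obtain ⟨hα, hβ, hPQ⟩ := hstab T hT f hfL2 S φ h
  set h' := T.refine.maxLen with hh
  have hle : ∀ e, T.refine.len e ≤ h' := fun e => len_le_maxLen e
  have hh0 : 0 ≤ h' := Real.iSup_nonneg fun _ => dist_nonneg
  -- Local data on an element: the load with its derivatives, and the multipliers and nodal values
  -- in the weight √ℓ. With this weight the squares sum to a multiple of the squared norm of the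
  -- load, however many elements there are.
  set B : (Σ i, Fin (T.m i + 1)) → ℝ :=
    fun e => T.refine.edgeHr r D e + √(T.refine.len e) * (c' * F) with hB
  have hB0 : ∀ e, 0 ≤ B e := fun e => add_nonneg (Real.sqrt_nonneg _) (by positivity)
  have hBc : ∀ e (x : R3), ‖x‖ ≤ cs * T.refine.loadNorm f →
      √(T.refine.len e) * ‖x‖ ≤ B e := fun e x hx => by
    have h1 : √(T.refine.len e) * ‖x‖ ≤ √(T.refine.len e) * (c' * F) := by
      gcongr; exact hx.trans hΦ
    exact h1.trans (le_add_of_nonneg_left (Real.sqrt_nonneg _))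
  refine ⟨fun e => c * (h' ^ (m + 1) * B e), fun e => mul_nonneg hc0
    (mul_nonneg (by positivity) (hB0 e)), ?_, fun e => ?_⟩
  · have h1 : ∑ e, B e ^ 2 ≤ (2 + 2 * c' ^ 2 * L) * F ^ 2 := by
      calc ∑ e, B e ^ 2 ≤ ∑ e, (2 * T.refine.edgeHr r D e ^ 2
            + T.refine.len e * (2 * (c' * F) ^ 2)) := by
            refine Finset.sum_le_sum fun e _ => (add_sq_le).trans (le_of_eq ?_)
            rw [mul_pow, Real.sq_sqrt (hlen e).le]; ring
        _ = _ := by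
            rw [Finset.sum_add_distrib, ← Finset.mul_sum, ← Finset.sum_mul, htot, sum_sq_edgeHr,
              ← hF]
            ring
    rw [hm1, ← hF]
    calc ∑ e, (c * (h' ^ (m + 1) * B e)) ^ 2 = (c * h' ^ (m + 1)) ^ 2 * ∑ e, B e ^ 2 := by
          rw [Finset.mul_sum]; exact Finset.sum_congr rfl fun e _ => by ring
      _ ≤ (c * h' ^ (m + 1)) ^ 2 * ((2 + 2 * c' ^ 2 * L) * F ^ 2) := by gcongr
      _ = (c * h' ^ (m + 1)) ^ 2 * (√(2 + 2 * c' ^ 2 * L) ^ 2 * F ^ 2) := by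
          rw [Real.sq_sqrt (by positivity)]
      _ = _ := by ring
  · have hmem := T.add_mem_Icc hnd e ⟨le_rfl, (hlen e).le⟩
    obtain ⟨a, ha1, ha2⟩ := hCM e.1 (T.start e + 0) hmem
    rw [add_zero] at ha2
    obtain ⟨P, hP, hP0, -, hpP⟩ := h.exists_force hlen hfL2 e
    obtain ⟨Q, hQ, hQ0, -, hqQ⟩ := h.exists_moment hlen e
    have hw := (h.isPrim_w hlen (T.continuousOn_complianceOp hN) e).1
    have hΛ : T.refine.len e ≤ L := by
      rw [hL, ← T.totalLen_refine hnd]; exact len_le_totalLen e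
    have hnd' : ∀ e, T.refine.pos (T.refine.src e) ≠ T.refine.pos (T.refine.tgt e) :=
      fun e => dist_pos.1 (hlen e)
    have key := approxPoly_element (hlen e) hΛ hM (hB0 e) hmr hmk (norm_tangent hnd' e)
      (T.continuousOn_complianceOp hN e) ha1
      (fun s hs m' hm' => ha2 s hs.1 (T.add_mem_Icc hnd e hs).2 m' hm') (hf e)
      (fun j hj => (l2norm_le_edgeHr r D e hj).trans (le_add_of_nonneg_right (by positivity)))
      (hBc e _ hα) (hBc e _ hβ) (hBc e _ (hP0 ▸ (hPQ e).1)) (hBc e _ (hQ0 ▸ (hPQ e).2))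
      hP hQ hpP hqQ hw
    rw [← hc] at key
    have hε : c * (T.refine.len e ^ (m + 1) * B e) ≤ c * (h' ^ (m + 1) * B e) := by
      have := hB0 e
      have := hle e
      have := (hlen e).le
      gcongr
    exact ⟨key.1.mono hε, key.2.1.mono hε, key.2.2.1.mono hε, key.2.2.2.mono hε⟩

end StrutNetwork

/-! ### ### The error of the stress on the elements -/

theorem IsL2.intervalIntegrable_of_mem {ℓ s : ℝ} {u : ℝ → R3} (hℓ : 0 ≤ ℓ) (hu : IsL2 ℓ u)
    (hs : s ∈ Icc 0 ℓ) : IntervalIntegrable u volume 0 s :=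
  (hu.intervalIntegrable hℓ).mono_set (by
    rw [uIcc_of_le hs.1, uIcc_of_le hℓ]; exact Icc_subset_Icc_right hs.2)

theorem integral_eq_zero_of_orthogonal {ℓ : ℝ} {k : ℕ} {u : ℝ → R3} (hℓ : 0 ≤ ℓ) (hu : IsL2 ℓ u)
    (h : ∀ ξ, IsVPoly k ξ → ∫ s in (0 : ℝ)..ℓ, inner ℝ (u s) (ξ s) = 0) :
    ∫ s in (0 : ℝ)..ℓ, u s = 0 := by
  have h1 := h _ (isVPoly_const k (∫ s in (0 : ℝ)..ℓ, u s))
  rwa [integral_inner_const hℓ hu, inner_self_eq_zero] at h1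

theorem IsPolyOn.isL2 {ℓ : ℝ} {k : ℕ} {u : ℝ → R3} (h : IsPolyOn ℓ k u) : IsL2 ℓ u := by
  obtain ⟨v, hv, huv⟩ := h.exists_isVPoly
  exact (hv.isL2 ℓ).congr_ae (ae_of_forall_Ioc fun s hs => (huv s (Ioc_subset_Icc_self hs)).symm)

/-- The integrated moment error on an element. -/
theorem integral_cross_sub {ℓ s : ℝ} {p p' : ℝ → R3} (hℓ : 0 ≤ ℓ) (hp : IsL2 ℓ p)
    (hp' : IsL2 ℓ p') (d t : R3) (hs : s ∈ Icc 0 ℓ) :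
    ∫ τ in (0 : ℝ)..s, (-cross (p' τ) t - -cross (p τ) t)
      = s • cross d t + ∫ τ in (0 : ℝ)..s, cross (p τ - p' τ - d) t := by
  have h1 : IsL2 ℓ (fun τ => cross (p τ - p' τ - d) t) := by
    simpa only [crossR_apply] using ((hp.sub hp').sub (isL2_const d)).clm (crossR t)
  have h2 : s • cross d t = ∫ _ in (0 : ℝ)..s, cross d t := by simp
  rw [h2, ← intervalIntegral.integral_add (by simp) (h1.intervalIntegrable_of_mem hℓ hs)]
  congr 1
  funext τ
  simp only [sub_cross']
  abel

/-- The error of the stress on an element. -/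
theorem element_stress_error {ℓ ε : ℝ} {k : ℕ} {p p' q q' gb : ℝ → R3} {d m0 t : R3} (hℓ : 0 ≤ ℓ)
    (ht : ‖t‖ = 1) (hp : IsL2 ℓ p) (hq : IsL2 ℓ q) (hp' : IsPolyOn ℓ k p') (hq' : IsPolyOn ℓ k q')
    (hap : ApproxPoly ℓ k ε p) (haq : ApproxPoly ℓ k ε q)
    (hpo : ∀ ξ, IsVPoly k ξ → ∫ s in (0 : ℝ)..ℓ, inner ℝ (p s - p' s - d) (ξ s) = 0)
    (hqo : ∀ ξ, IsVPoly k ξ → ∫ s in (0 : ℝ)..ℓ, inner ℝ (q s - q' s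
      - (m0 + ∫ τ in (0 : ℝ)..s, (-cross (p' τ) t - -cross (p τ) t))) (ξ s) = 0)
    (hgb : IsVPoly k gb)
    (hg : ∀ ξ, IsVPoly k ξ →
      ∫ s in (0 : ℝ)..ℓ, inner ℝ (m0 + s • cross d t - gb s) (ξ s) = 0) :
    l2norm ℓ (fun s => p s - p' s - d) ≤ 2 * ε ∧ ∃ z, IsL2 ℓ z ∧ l2norm ℓ z ≤ 2 * ℓ * ε ∧
      l2norm ℓ (fun s => q s - q' s - gb s - z s) ≤ (2 + 4 * ℓ) * ε ∧
      ∀ ξ, IsVPoly k ξ → ∫ s in (0 : ℝ)..ℓ, inner ℝ (q s - q' s - gb s - z s) (ξ s) = 0 := by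
  obtain ⟨πp, hπp, hp2⟩ := hap
  obtain ⟨πq, hπq, hq2⟩ := haq
  obtain ⟨vp, hvp, hpv⟩ := hp'.exists_isVPoly
  obtain ⟨vq, hvq, hqv⟩ := hq'.exists_isVPoly
  have hp'2 := hp'.isL2
  have hq'2 := hq'.isL2
  have hzero : l2norm ℓ (fun _ => (0 : R3)) = 0 := by rw [l2norm_const hℓ]; simp
  have ha : l2norm ℓ (fun s => p s - p' s - d) ≤ 2 * ε := by
    have := l2norm_le_of_orthogonal hℓ (isL2_const 0) hp (hvp.add (isVPoly_const k d)) hπp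
      (e := fun s => p s - p' s - d) (ae_of_forall_Ioc fun s hs => by
        rw [hpv s (Ioc_subset_Icc_self hs)]; abel) (by simpa using hpo)
    rw [hzero] at this
    linarith
  have hω : IsL2 ℓ (fun τ => cross (p τ - p' τ - d) t) := by
    simpa only [crossR_apply] using ((hp.sub hp'2).sub (isL2_const d)).clm (crossR t)
  have hωn : l2norm ℓ (fun τ => cross (p τ - p' τ - d) t) ≤ 2 * ε := by
    refine (l2norm_mono_ae hℓ zero_le_one ((hp.sub hp'2).sub (isL2_const d))
      (ae_of_forall_Ioc fun s _ => ?_)).trans (by linarith)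
    refine (norm_cross_le _ _).trans (le_of_eq ?_)
    rw [ht]; ring
  have hz : IsL2 ℓ (fun s => ∫ τ in (0 : ℝ)..s, cross (p τ - p' τ - d) t) :=
    isL2_of_continuousOn (continuousOn_integral hℓ hω)
  -- z is the moment of the non-constant part of the force error; the constant part `d` produces the
  -- affine moment instead.
  set z := fun s => ∫ τ in (0 : ℝ)..s, cross (p τ - p' τ - d) t with hzdef
  have horth : ∀ ξ, IsVPoly k ξ →
      ∫ s in (0 : ℝ)..ℓ, inner ℝ (q s - q' s - gb s - z s) (ξ s) = 0 := by
    intro ξ hξ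
    have hcr : ∀ u, IsL2 ℓ u → IsL2 ℓ (fun s => -cross (u s) t) := fun u hu => by
      simpa only [crossR_apply] using (hu.clm (crossR t)).neg
    have hA : IsL2 ℓ (fun s => q s - q' s
        - (m0 + ∫ τ in (0 : ℝ)..s, (-cross (p' τ) t - -cross (p τ) t))) :=
      (hq.sub hq'2).sub ((isL2_const m0).add
        (isL2_of_continuousOn (continuousOn_integral hℓ ((hcr _ hp'2).sub (hcr _ hp)))))
    have hG : IsL2 ℓ (fun s => m0 + s • cross d t - gb s) :=
      ((isVPoly_affine 0 m0 (cross d t)).isL2 ℓ).sub (hgb.isL2 ℓ)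
    have h1 := intervalIntegral.integral_add
      (hA.intervalIntegrable_inner hℓ (hξ.isL2 ℓ)) (hG.intervalIntegrable_inner hℓ (hξ.isL2 ℓ))
    rw [hqo ξ hξ, hg ξ hξ, add_zero] at h1
    refine Eq.trans ?_ h1
    refine integral_congr_Ioc hℓ (ae_of_forall_Ioc fun s hs => ?_)
    rw [← inner_add_left, integral_cross_sub hℓ hp hp'2 d t (Ioc_subset_Icc_self hs)]
    congr 1
    simp only [hzdef]
    abel
  refine ⟨ha, z, hz, ?_, ?_, horth⟩
  · refine (l2norm_integral_le hℓ hω).trans ?_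
    calc _ ≤ ℓ * (2 * ε) := by gcongr
      _ = _ := by ring
  · have h1 := l2norm_le_of_orthogonal hℓ hz.neg hq (hvq.add hgb) hπq
      (e := fun s => q s - q' s - gb s) (ae_of_forall_Ioc fun s hs => by
        rw [hqv s (Ioc_subset_Icc_self hs)]; abel)
      (by simpa only [← sub_eq_add_neg] using horth)
    rw [l2norm_neg] at h1
    have h2 := l2norm_sub_le hℓ ((hq.sub hq'2).sub (hgb.isL2 ℓ)) hz
    have h3 : l2norm ℓ z ≤ ℓ * (2 * ε) := (l2norm_integral_le hℓ hω).trans (by gcongr)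
    linarith

namespace StrutNetwork

variable {V E : Type*} {N : StrutNetwork V E}

/-- Both solutions satisfy the same equations for discrete test motions, so the load cancels in the
differences. The force difference is the same at both ends of an element and continues across
interior nodes. The deviation of the force error from it has mean zero on the element, so the nodal
moment differences are affine along the strut. The balances at the original vertices make κ
self-equilibrated. -/
theorem exists_self_stress_error [Fintype V] [Fintype E] (hN : N.IsStent) (T : N.Subdivision)
    {k : ℕ} {f : (Σ i, Fin (T.m i + 1)) → ℝ → R3} (hf : ∀ e, IsL2 (T.refine.len e) (f e))
    {S Sh : ForceField (Σ i, Fin (T.m i + 1))}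
    {φ φh : MotionField (V ⊕ (Σ i, Fin (T.m i))) (Σ i, Fin (T.m i + 1))}
    (h : T.refine.Solves f S φ) (hh : T.refine.SolvesDiscrete k (k + 1) f Sh φh) :
    S.α = Sh.α ∧ S.β = Sh.β ∧ ∃ κ, N.residual κ = 0 ∧
      ∀ e, S.Pm e - Sh.Pm e = (κ e.1).1 ∧ S.Pp e - Sh.Pp e = (κ e.1).1 ∧
        S.Qm e - Sh.Qm e = N.momentAt κ e.1 (T.start e) ∧
        S.Qp e - Sh.Qp e = N.momentAt κ e.1 (T.start e + T.refine.len e) ∧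
        (∀ ξ, IsVPoly k ξ → ∫ s in (0 : ℝ)..T.refine.len e,
          inner ℝ (S.p e s - Sh.p e s - (κ e.1).1) (ξ s) = 0) ∧
        ∀ ξ, IsVPoly k ξ → ∫ s in (0 : ℝ)..T.refine.len e, inner ℝ (S.q e s - Sh.q e s
          - (N.momentAt κ e.1 (T.start e) + ∫ τ in (0 : ℝ)..s,
            (-cross (Sh.p e τ) (N.tangent e.1) - -cross (S.p e τ) (N.tangent e.1)))) (ξ s) = 0 := by
  have hnd := hN.nondegenerate
  have := hN.nonempty
  have : Nonempty (Σ i, Fin (T.m i + 1)) := ⟨⟨Classical.arbitrary E, 0⟩⟩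
  have hlen := T.refine_len_pos hnd
  have hnd' : ∀ e, T.refine.pos (T.refine.src e) ≠ T.refine.pos (T.refine.tgt e) :=
    fun e => dist_pos.1 (hlen e)
  obtain ⟨hα, hβ⟩ := multipliers_unique hnd' (S := S) (S' := Sh) fun c ρ => by
    rw [h.eq_M _ (memMh_rigidMotion 0 c ρ).mem, hh.eq_M _ (memMh_rigidMotion k c ρ)]
  have hpL2 := h.mem_V.p_mem
  have hqL2 := h.mem_V.q_mem
  have hpL2' := hh.mem_V.mem.p_mem
  have hqL2' := hh.mem_V.mem.q_mem
  have hcr : ∀ {ℓ : ℝ} {u : ℝ → R3} (t : R3), IsL2 ℓ u → IsL2 ℓ (fun s => -cross (u s) t) :=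
    fun t hu => by simpa only [crossR_apply] using (hu.clm (crossR t)).neg
  have hforce : ∀ e, S.Pm e - Sh.Pm e = S.Pp e - Sh.Pp e ∧
      ∀ ξ, IsVPoly k ξ → ∫ s in (0 : ℝ)..T.refine.len e,
        inner ℝ (S.p e s - Sh.p e s - (S.Pm e - Sh.Pm e)) (ξ s) = 0 := by
    intro e
    have hℓ := (hlen e).le
    have := edge_galerkin (α := S.α) hℓ (k := k) (hpL2 e) (hf e) (hpL2' e) (hf e)
      (fun v ξ hv hξ hd => edgeEq_force
        (h.eq_M _ (memM_single hlen e (hξ.isPrim hd) isPrim_zero)))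
      (fun v ξ hv hξ hd => hα ▸ edgeEq_force
        (hh.eq_M _ (memMh_single hlen e (hξ.isPrim hd) isPrim_zero hv (isVPoly_const _ 0))))
    simpa using this
  have hmean : ∀ e, ∫ s in (0 : ℝ)..T.refine.len e,
      cross (S.p e s - Sh.p e s - (S.Pm e - Sh.Pm e)) (N.tangent e.1) = 0 := by
    intro e
    have hu := ((hpL2 e).sub (hpL2' e)).sub (isL2_const (S.Pm e - Sh.Pm e))
    have h1 := integral_eq_zero_of_orthogonal (hlen e).le hu (hforce e).2
    have h2 := integral_clm (hlen e).le (crossR (N.tangent e.1)) hu ⟨(hlen e).le, le_rfl⟩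
    rw [h1, map_zero] at h2
    simpa only [crossR_apply] using h2
  have hmoment : ∀ e, S.Qp e - Sh.Qp e = (S.Qm e - Sh.Qm e)
        + T.refine.len e • cross (S.Pm e - Sh.Pm e) (N.tangent e.1) ∧
      ∀ ξ, IsVPoly k ξ → ∫ s in (0 : ℝ)..T.refine.len e, inner ℝ (S.q e s - Sh.q e s
          - ((S.Qm e - Sh.Qm e) + ∫ τ in (0 : ℝ)..s,
            (-cross (Sh.p e τ) (N.tangent e.1) - -cross (S.p e τ) (N.tangent e.1)))) (ξ s) = 0 := by
    intro e
    have hℓ := (hlen e).le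
    have h1 := edge_galerkin (α := S.β) hℓ (k := k) (hqL2 e) (hcr (T.refine.tangent e) (hpL2 e))
      (hqL2' e) (hcr (T.refine.tangent e) (hpL2' e))
      (fun v ξ hv hξ hd => edgeEq_moment hℓ (hpL2 e) (hqL2 e) (hξ.isPrim hd)
        (h.eq_M _ (memM_single hlen e isPrim_zero (hξ.isPrim hd))))
      (fun v ξ hv hξ hd => hβ ▸ edgeEq_moment hℓ (hpL2' e) (hqL2' e) (hξ.isPrim hd)
        (hh.eq_M _ (memMh_single hlen e isPrim_zero (hξ.isPrim hd) (isVPoly_const _ 0) hv)))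
    rw [T.refine_tangent hnd] at h1
    refine ⟨?_, h1.2⟩
    rw [← h1.1, integral_cross_sub hℓ (hpL2 e) (hpL2' e) (S.Pm e - Sh.Pm e) _ ⟨hℓ, le_rfl⟩,
      hmean, add_zero]
  have hbal := h.balance_eq_zero hlen
  have hbal' : ∀ j, T.refine.balance Sh.Pp Sh.Pm j = 0 ∧ T.refine.balance Sh.Qp Sh.Qm j = 0 :=
    balance_eq_zero_of_tests fun U W => by
      rw [hh.eq_M _ (memMh_vertex hlen (k + 1) U W), formF_vertex]
  set κ : E → R3 × R3 := fun i => (S.Pm ⟨i, 0⟩ - Sh.Pm ⟨i, 0⟩, S.Qm ⟨i, 0⟩ - Sh.Qm ⟨i, 0⟩) with hκ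
  have hd : ∀ i j, S.Pm ⟨i, j⟩ - Sh.Pm ⟨i, j⟩ = (κ i).1 := by
    intro i j
    induction j using Fin.induction with
    | zero => rfl
    | succ j ih =>
      have h1 := (hbal (Sum.inr ⟨i, j⟩)).1
      have h2 := (hbal' (Sum.inr ⟨i, j⟩)).1
      rw [T.balance_inr, sub_eq_zero] at h1 h2
      rw [← h1, ← h2, ← (hforce _).1, ih]
  have hm : ∀ i j, S.Qm ⟨i, j⟩ - Sh.Qm ⟨i, j⟩ = N.momentAt κ i (T.start ⟨i, j⟩) := by
    intro i j
    induction j using Fin.induction with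
    | zero => simp [momentAt, hκ]
    | succ j ih =>
      have h1 := (hbal (Sum.inr ⟨i, j⟩)).2
      have h2 := (hbal' (Sum.inr ⟨i, j⟩)).2
      rw [T.balance_inr, sub_eq_zero] at h1 h2
      rw [← h1, ← h2, (hmoment _).1, ih, hd, ← T.start_castSucc_add_len hnd, momentAt_add]
  have hmp : ∀ e, S.Qp e - Sh.Qp e = N.momentAt κ e.1 (T.start e + T.refine.len e) := fun e => by
    rw [(hmoment e).1, hm, hd, momentAt_add]
  refine ⟨hα, hβ, κ, ?_, fun e => ⟨hd _ _, (hforce e).1 ▸ hd _ _, hm _ _, hmp e, ?_, ?_⟩⟩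
  · rw [residual_eq_zero_iff]
    intro j
    have h1 := hbal (Sum.inl j)
    have h2 := hbal' (Sum.inl j)
    simp only [T.balance_inl] at h1 h2
    have h3 := congrArg₂ (· - ·) h1.1 h2.1
    have h4 := congrArg₂ (· - ·) h1.2 h2.2
    simp only [← balance_sub, sub_zero, ← (hforce _).1, hd] at h3
    simp only [← balance_sub, sub_zero, hm, hmp, T.start_last_add_len hnd, T.start_zero] at h4
    exact ⟨h3, h4⟩
  · have := (hforce e).2
    rwa [hd] at this
  · have := (hmoment e).2
    rwa [hm] at this

end StrutNetwork

/-! ### ### The energy of the self-equilibrated part of the stress error -/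

/-- The energy of the projected stress on an element. -/
theorem element_energy_le {ℓ L M ε K : ℝ} {k : ℕ} (hℓ : 0 ≤ ℓ) (hL : ℓ ≤ L) (hM : 0 ≤ M)
    (hε : 0 ≤ ε) (hK : 0 ≤ K) {C : ℝ → R3 →L[ℝ] R3} (hC : ContinuousOn C (Icc 0 ℓ))
    (hCM : ∀ s ∈ Icc 0 ℓ, ‖C s‖ ≤ M) (hC0 : ∀ s ∈ Icc 0 ℓ, ‖C s - C 0‖ ≤ M * s)
    (hsymm : ∀ s x y, inner ℝ (C s x) y = inner ℝ x (C s y)) {q q' g gb z : ℝ → R3}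
    (hq : IsL2 ℓ q) (hq' : IsL2 ℓ q') (hg : IsL2 ℓ g) (hz : IsL2 ℓ z) (hgb : IsVPoly k gb)
    (hgbb : ∀ s ∈ Icc 0 ℓ, ‖gb s‖ ≤ (1 + L) * K) (hgbg : ∀ s ∈ Icc 0 ℓ, ‖gb s - g s‖ ≤ ℓ * K)
    (hgb0 : ∀ s ∈ Icc 0 ℓ, ‖gb s - gb 0‖ ≤ ℓ * K)
    (hgo : ∀ ξ, IsVPoly k ξ → ∫ s in (0 : ℝ)..ℓ, inner ℝ (g s - gb s) (ξ s) = 0)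
    (hzl : l2norm ℓ z ≤ 2 * ℓ * ε)
    (hθl : l2norm ℓ (fun s => q s - q' s - gb s - z s) ≤ (2 + 4 * ℓ) * ε)
    (hθo : ∀ ξ, IsVPoly k ξ → ∫ s in (0 : ℝ)..ℓ, inner ℝ (q s - q' s - gb s - z s) (ξ s) = 0)
    (hCq : ApproxPoly ℓ k ε (fun s => C s (q s))) :
    ∫ s in (0 : ℝ)..ℓ, inner ℝ (C s (gb s)) (gb s)
      ≤ (∫ s in (0 : ℝ)..ℓ, inner ℝ (C s (q s)) (g s))
        - (∫ s in (0 : ℝ)..ℓ, inner ℝ (C s (q' s)) (gb s))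
        + (1 + 2 * M * (1 + L) + (2 + 4 * L) * (M * (2 + L))) * (ℓ * (√ℓ * ε)) * K := by
  obtain ⟨π, hπ, hCqπ⟩ := hCq
  have hL0 : 0 ≤ L := hℓ.trans hL
  have hgb2 := hgb.isL2 ℓ
  have hθ := ((hq.sub hq').sub hgb2).sub hz
  have hCgb := isL2_clm_apply hC hgb2
  have hCq2 := isL2_clm_apply hC hq
  have hCq2' := isL2_clm_apply hC hq'
  have hCz := isL2_clm_apply hC hz
  -- a decomposition of the energy
  have i1 := hCq2.intervalIntegrable_inner hℓ (hgb2.sub hg)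
  have i2 := hCq2.intervalIntegrable_inner hℓ hg
  have i3 := hCq2'.intervalIntegrable_inner hℓ hgb2
  have i4 := hCz.intervalIntegrable_inner hℓ hgb2
  have i5 := hθ.intervalIntegrable_inner hℓ hCgb
  have hsplit : ∫ s in (0 : ℝ)..ℓ, inner ℝ (C s (gb s)) (gb s)
      = (∫ s in (0 : ℝ)..ℓ, inner ℝ (C s (q s)) (gb s - g s))
        + (∫ s in (0 : ℝ)..ℓ, inner ℝ (C s (q s)) (g s))
        - (∫ s in (0 : ℝ)..ℓ, inner ℝ (C s (q' s)) (gb s))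
        - (∫ s in (0 : ℝ)..ℓ, inner ℝ (C s (z s)) (gb s))
        - ∫ s in (0 : ℝ)..ℓ, inner ℝ (q s - q' s - gb s - z s) (C s (gb s)) := by
    rw [← intervalIntegral.integral_add i1 i2, ← intervalIntegral.integral_sub (i1.add i2) i3,
      ← intervalIntegral.integral_sub ((i1.add i2).sub i3) i4,
      ← intervalIntegral.integral_sub (((i1.add i2).sub i3).sub i4) i5]
    congr 1
    funext s
    simp only [inner_sub_left, inner_sub_right, hsymm, map_sub]
    ring
  -- The projection error of the moment is orthogonal to the approximant of C q, so C q enters only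
  -- through its approximation error.
  have b1 : ∫ s in (0 : ℝ)..ℓ, inner ℝ (C s (q s)) (gb s - g s) ≤ ε * (√ℓ * (ℓ * K)) := by
    have h1 : ∫ s in (0 : ℝ)..ℓ, inner ℝ (π s) (gb s - g s) = 0 := by
      have := hgo π hπ
      rw [← neg_eq_zero, ← intervalIntegral.integral_neg, ← this]
      congr 1
      funext s
      rw [← inner_neg_right, neg_sub, real_inner_comm]
    have h2 : ∫ s in (0 : ℝ)..ℓ, inner ℝ (C s (q s)) (gb s - g s)
        = ∫ s in (0 : ℝ)..ℓ, inner ℝ (C s (q s) - π s) (gb s - g s) := by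
      simp only [inner_sub_left (C _ (q _))]
      rw [intervalIntegral.integral_sub i1
        ((hπ.isL2 ℓ).intervalIntegrable_inner hℓ (hgb2.sub hg)), h1, sub_zero]
    rw [h2]
    refine (le_abs_self _).trans ((abs_integral_inner_le hℓ (hCq2.sub (hπ.isL2 ℓ))
      (hgb2.sub hg)).trans ?_)
    exact mul_le_mul hCqπ (l2norm_le_of_bound hℓ (by positivity)
      fun s hs => hgbg s (Ioc_subset_Icc_self hs)) (l2norm_nonneg _ _) hε
  have b2 : -(∫ s in (0 : ℝ)..ℓ, inner ℝ (C s (z s)) (gb s))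
      ≤ M * (2 * ℓ * ε) * (√ℓ * ((1 + L) * K)) := by
    refine (neg_le_abs _).trans ((abs_integral_inner_le hℓ hCz hgb2).trans ?_)
    refine mul_le_mul ((l2norm_clm_apply_le hℓ hM hCM hz).trans (by gcongr))
      (l2norm_le_of_bound hℓ (by positivity) fun s hs => hgbb s (Ioc_subset_Icc_self hs))
      (l2norm_nonneg _ _) (by positivity)
  -- The remainder is orthogonal to constants, so only the oscillation of C gb on the element
  -- counts; it is of order ℓ K.
  have b3 : -(∫ s in (0 : ℝ)..ℓ, inner ℝ (q s - q' s - gb s - z s) (C s (gb s)))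
      ≤ (2 + 4 * L) * ε * (√ℓ * (M * (2 + L) * (ℓ * K))) := by
    have hc2 := isL2_const (ℓ := ℓ) (C 0 (gb 0))
    have h2 : ∫ s in (0 : ℝ)..ℓ, inner ℝ (q s - q' s - gb s - z s) (C s (gb s))
        = ∫ s in (0 : ℝ)..ℓ, inner ℝ (q s - q' s - gb s - z s) (C s (gb s) - C 0 (gb 0)) := by
      simp only [inner_sub_right (q _ - q' _ - gb _ - z _)]
      rw [intervalIntegral.integral_sub i5 (hθ.intervalIntegrable_inner hℓ hc2),
        hθo _ (isVPoly_const k _), sub_zero]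
    rw [h2]
    refine (neg_le_abs _).trans ((abs_integral_inner_le hℓ hθ (hCgb.sub hc2)).trans ?_)
    refine mul_le_mul (hθl.trans (by gcongr)) (l2norm_le_of_bound hℓ (by positivity)
      fun s hs => ?_) (l2norm_nonneg _ _) (by positivity)
    have hs' := Ioc_subset_Icc_self hs
    have h3 : C s (gb s) - C 0 (gb 0) = (C s - C 0) (gb s) + C 0 (gb s - gb 0) := by
      simp
    rw [h3]
    calc _ ≤ ‖C s - C 0‖ * ‖gb s‖ + ‖C 0‖ * ‖gb s - gb 0‖ :=
          (norm_add_le _ _).trans (add_le_add (ContinuousLinearMap.le_opNorm _ _)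
            (ContinuousLinearMap.le_opNorm _ _))
      _ ≤ (M * ℓ) * ((1 + L) * K) + M * (ℓ * K) := by
          gcongr
          · exact (hC0 s hs').trans (by have := hs'.2; gcongr)
          · exact hgbb s hs'
          · exact hCM 0 ⟨le_rfl, hℓ⟩
          · exact hgb0 s hs'
      _ = _ := by ring
  rw [hsplit]
  linarith

namespace StrutNetwork

variable {V E : Type*} {N : StrutNetwork V E}

theorem IsStent.exists_lipschitz_complianceOp [Fintype E] (hN : N.IsStent) :
    ∃ M, 0 ≤ M ∧ (∀ i, ∀ s ∈ Icc 0 (N.len i), ‖N.complianceOp i s‖ ≤ M) ∧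
      ∀ i, ∀ x ∈ Icc 0 (N.len i), ∀ s, 0 ≤ s → x + s ≤ N.len i →
        ‖N.complianceOp i (x + s) - N.complianceOp i x‖ ≤ M * s := by
  obtain ⟨M, hM, h⟩ := hN.exists_taylor 1
  refine ⟨M, hM, fun i s hs => ?_, fun i x hx s hs hxs => ?_⟩
  · obtain ⟨a, -, h2⟩ := h i s hs
    simpa using h2 0 le_rfl (by simpa using hs.2) 0 (by norm_num)
  · obtain ⟨a, -, h2⟩ := h i x hx
    -- At `s = 0` the first-order expansion forces its constant term to be the value at `x`.
    have h3 := h2 0 le_rfl (by simpa using hx.2) 1 le_rfl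
    have h4 := h2 s hs hxs 1 le_rfl
    simp only [Finset.sum_range_one, pow_zero, one_smul, pow_one, mul_zero, add_zero,
      norm_le_zero_iff, sub_eq_zero] at h3 h4
    rwa [h3]

/-- The error of the stress is a self-equilibrated stress `κ` at the vertices and, on the elements,
the projection of `κ` up to small terms. -/
structure StressError (T : N.Subdivision) (k : ℕ) (S Sh : ForceField (Σ i, Fin (T.m i + 1)))
    (ε : (Σ i, Fin (T.m i + 1)) → ℝ) (κ : E → R3 × R3) (z : (Σ i, Fin (T.m i + 1)) → ℝ → R3) :
    Prop where
  α_eq : S.α = Sh.α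
  β_eq : S.β = Sh.β
  Pm_eq : ∀ e, S.Pm e - Sh.Pm e = (κ e.1).1
  Pp_eq : ∀ e, S.Pp e - Sh.Pp e = (κ e.1).1
  Qm_eq : ∀ e, S.Qm e - Sh.Qm e = N.momentAt κ e.1 (T.start e)
  Qp_eq : ∀ e, S.Qp e - Sh.Qp e = N.momentAt κ e.1 (T.start e + T.refine.len e)
  p_le : ∀ e, l2norm (T.refine.len e) (fun s => S.p e s - Sh.p e s - (κ e.1).1) ≤ 2 * ε e
  z_mem : ∀ e, IsL2 (T.refine.len e) (z e)
  z_le : ∀ e, l2norm (T.refine.len e) (z e) ≤ 2 * T.refine.len e * ε e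
  q_le : ∀ e, l2norm (T.refine.len e)
    (fun s => S.q e s - Sh.q e s - T.projMoment k κ e s - z e s) ≤ (2 + 4 * T.refine.len e) * ε e
  q_orth : ∀ e ξ, IsVPoly k ξ → ∫ s in (0 : ℝ)..T.refine.len e,
    inner ℝ (S.q e s - Sh.q e s - T.projMoment k κ e s - z e s) (ξ s) = 0

theorem exists_stressError [Fintype E] [Fintype V] (hN : N.IsStent) (T : N.Subdivision) {k : ℕ}
    {f : (Σ i, Fin (T.m i + 1)) → ℝ → R3} (hf : ∀ e, IsL2 (T.refine.len e) (f e))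
    {S Sh : ForceField (Σ i, Fin (T.m i + 1))}
    {φ φh : MotionField (V ⊕ (Σ i, Fin (T.m i))) (Σ i, Fin (T.m i + 1))}
    (h : T.refine.Solves f S φ) (hh : T.refine.SolvesDiscrete k (k + 1) f Sh φh)
    {ε : (Σ i, Fin (T.m i + 1)) → ℝ} (hp : ∀ e, ApproxPoly (T.refine.len e) k (ε e) (S.p e))
    (hq : ∀ e, ApproxPoly (T.refine.len e) k (ε e) (S.q e)) :
    ∃ κ, N.residual κ = 0 ∧ ∃ z, StressError T k S Sh ε κ z := by
  have hnd := hN.nondegenerate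
  obtain ⟨hα, hβ, κ, hκ, H⟩ := exists_self_stress_error hN T hf h hh
  have key : ∀ e, l2norm (T.refine.len e) (fun s => S.p e s - Sh.p e s - (κ e.1).1) ≤ 2 * ε e ∧
      ∃ z, IsL2 (T.refine.len e) z ∧ l2norm (T.refine.len e) z ≤ 2 * T.refine.len e * ε e ∧
      l2norm (T.refine.len e) (fun s => S.q e s - Sh.q e s - T.projMoment k κ e s - z s)
        ≤ (2 + 4 * T.refine.len e) * ε e ∧
      ∀ ξ, IsVPoly k ξ → ∫ s in (0 : ℝ)..T.refine.len e,
        inner ℝ (S.q e s - Sh.q e s - T.projMoment k κ e s - z s) (ξ s) = 0 := by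
    intro e
    obtain ⟨-, -, -, -, hpo, hqo⟩ := H e
    refine element_stress_error (T.refine_len_pos hnd e).le (norm_tangent hnd e.1) (h.mem_V.p_mem e)
      (h.mem_V.q_mem e) (hh.mem_V.p_poly e) (hh.mem_V.q_poly e) (hp e) (hq e) hpo hqo
      (T.isVPoly_projMoment k κ e) fun ξ hξ => ?_
    simp only [← momentAt_add]
    have h1 := T.integral_projMoment_sub hnd k κ e hξ
    exact h1
  choose hpl z hz using key
  exact ⟨κ, hκ, z, ⟨hα, hβ, fun e => (H e).1, fun e => (H e).2.1, fun e => (H e).2.2.1,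
    fun e => (H e).2.2.2.1, hpl, fun e => (hz e).1, fun e => (hz e).2.1, fun e => (hz e).2.2.1,
    fun e => (hz e).2.2.2⟩⟩

namespace StressError

variable {T : N.Subdivision} {k : ℕ} {S Sh : ForceField (Σ i, Fin (T.m i + 1))}
  {ε : (Σ i, Fin (T.m i + 1)) → ℝ} {κ : E → R3 × R3} {z : (Σ i, Fin (T.m i + 1)) → ℝ → R3}

theorem energy_element_le [Fintype E] (hN : N.IsStent) (H : StressError T k S Sh ε κ z)
    (e : Σ i, Fin (T.m i + 1)) (hq : IsL2 (T.refine.len e) (S.q e))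
    (hq' : IsL2 (T.refine.len e) (Sh.q e)) {M : ℝ} (hM : 0 ≤ M)
    (hCM : ∀ s ∈ Icc 0 (N.len e.1), ‖N.complianceOp e.1 s‖ ≤ M)
    (hLip : ∀ x ∈ Icc 0 (N.len e.1), ∀ s, 0 ≤ s → x + s ≤ N.len e.1 →
        ‖N.complianceOp e.1 (x + s) - N.complianceOp e.1 x‖ ≤ M * s) (hε : 0 ≤ ε e)
    (hCq : ApproxPoly (T.refine.len e) k (ε e) (fun s => T.refine.complianceOp e s (S.q e s))) :
    ∫ s in (0 : ℝ)..T.refine.len e,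
      inner ℝ (T.refine.complianceOp e s (T.projMoment k κ e s)) (T.projMoment k κ e s)
    ≤ (∫ s in (0 : ℝ)..T.refine.len e,
        inner ℝ (T.refine.complianceOp e s (S.q e s)) (N.momentAt κ e.1 (T.start e + s)))
      - (∫ s in (0 : ℝ)..T.refine.len e,
        inner ℝ (T.refine.complianceOp e s (Sh.q e s)) (T.projMoment k κ e s))
      + (1 + 2 * M * (1 + N.totalLen) + (2 + 4 * N.totalLen) * (M * (2 + N.totalLen)))
        * (T.refine.len e * (√(T.refine.len e) * ε e)) * ‖κ‖ := by
  have hnd := hN.nondegenerate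
  have hpos := T.refine_len_pos hnd e
  have hLe : T.refine.len e ≤ N.totalLen := by
    have := T.start_add_len_le hnd e
    have := T.start_nonneg e
    have := N.len_le_totalLen e.1
    linarith
  have hmem := fun s hs => T.add_mem_Icc hnd e (s := s) hs
  have hC := T.continuousOn_complianceOp hN e
  have hgbv := T.isVPoly_projMoment k κ e
  have hgbb := fun s hs => T.norm_projMoment_le hnd N.len_le_totalLen k κ e (s := s) hs
  have hgbg := fun s hs => T.norm_projMoment_sub_le hnd k κ e (s := s) hs
  have hgb0 := fun s hs => T.norm_projMoment_sub_zero_le hnd k κ e (s := s) hs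
  have hgorth := fun ξ hξ => T.integral_projMoment_sub hnd k κ e (ξ := ξ) hξ
  have hgL2 := (T.isPrim_momentAt κ e).isL2 hpos.le
  have hz := H.z_mem e
  have hzl := H.z_le e
  have hθl := H.q_le e
  have hθo := H.q_orth e
  have hCz : ∀ s ∈ Icc 0 (T.refine.len e), ‖T.refine.complianceOp e s‖ ≤ M :=
    fun s hs => hCM _ (hmem s hs)
  have hC0 : ∀ s ∈ Icc 0 (T.refine.len e),
      ‖T.refine.complianceOp e s - T.refine.complianceOp e 0‖ ≤ M * s := fun s hs => by
    have h1 := hLip _ (hmem 0 ⟨le_rfl, hpos.le⟩) s hs.1 (by simpa using (hmem s hs).2)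
    rw [add_zero] at h1
    rw [T.refine_complianceOp, T.refine_complianceOp, add_zero]
    exact h1
  exact element_energy_le hpos.le hLe hM hε (norm_nonneg κ) hC hCz hC0
    (fun s x y => hN.complianceOp_symm e.1 _ x y) hq hq' hgL2 hz hgbv hgbb hgbg hgb0 hgorth hzl
    hθl hθo hCq

end StressError

end StrutNetwork

/-! ### ### Estimates at the vertices -/

namespace SimpleGraph

/-- On a finite connected graph, a function that varies little along the edges varies little. -/
theorem Connected.exists_norm_sub_le {V : Type*} [Finite V] {G : SimpleGraph V}
    (hG : G.Connected) : ∃ n : ℕ, ∀ (Z : V → R3) (D : ℝ), 0 ≤ D →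
      (∀ a b, G.Adj a b → ‖Z a - Z b‖ ≤ D) → ∀ a b, ‖Z a - Z b‖ ≤ n * D := by
  have := Fintype.ofFinite V
  have hw : ∀ a b, Nonempty (G.Walk a b) := fun a b => hG.preconnected a b
  refine ⟨∑ a, ∑ b, (hw a b).some.length, fun Z D hD h a b => ?_⟩
  have key : ∀ {a b} (p : G.Walk a b), ‖Z a - Z b‖ ≤ p.length * D := by
    intro a b p
    induction p with
    | nil => simp
    | @cons x y w hab p ih =>
      rw [Walk.length_cons]
      push_cast
      have h1 := h _ _ hab
      have h2 := norm_sub_le_norm_sub_add_norm_sub (Z x) (Z y) (Z w)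
      exact h2.trans (by linarith)
  refine (key (hw a b).some).trans ?_
  gcongr
  exact (Finset.single_le_sum (f := fun b => (hw a b).some.length) (fun _ _ => Nat.zero_le _)
    (Finset.mem_univ b)).trans (Finset.single_le_sum
      (f := fun a => ∑ b, (hw a b).some.length) (fun _ _ => Nat.zero_le _) (Finset.mem_univ a))

end SimpleGraph

namespace StrutNetwork

variable {V E : Type*} {N : StrutNetwork V E}

theorem maxLen_nonneg : 0 ≤ N.maxLen := Real.iSup_nonneg fun _ => dist_nonneg

/-- Cauchy–Schwarz over the struts: the squared weights add up to the total length, so their number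
does not enter. -/
theorem sum_sqrt_len_mul_le [Fintype E] {ε : E → ℝ} {η : ℝ} (hη : 0 ≤ η)
    (h : ∑ i, ε i ^ 2 ≤ η ^ 2) : ∑ i, √(N.len i) * ε i ≤ √N.totalLen * η := by
  calc _ ≤ √(∑ i, √(N.len i) ^ 2) * √(∑ i, ε i ^ 2) := Real.sum_mul_le_sqrt_mul_sqrt ..
    _ ≤ √(∑ i, √(N.len i) ^ 2) * η := by gcongr; exact Real.sqrt_le_iff.2 ⟨hη, h⟩
    _ = _ := by
        congr 2
        exact Finset.sum_congr rfl fun i _ => Real.sq_sqrt dist_nonneg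

theorem sum_len_mul_sqrt_len_mul_le [Fintype E] {ε : E → ℝ} {η : ℝ} (hη : 0 ≤ η)
    (hε : ∀ i, 0 ≤ ε i) (h : ∑ i, ε i ^ 2 ≤ η ^ 2) :
    ∑ i, N.len i * (√(N.len i) * ε i) ≤ √N.totalLen * (N.maxLen * η) := by
  calc _ ≤ ∑ i, N.maxLen * (√(N.len i) * ε i) := by
        gcongr with i
        · exact mul_nonneg (Real.sqrt_nonneg _) (hε i)
        · exact len_le_maxLen i
    _ = N.maxLen * ∑ i, √(N.len i) * ε i := (Finset.mul_sum ..).symm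
    _ ≤ N.maxLen * (√N.totalLen * η) := by
        gcongr
        · exact maxLen_nonneg
        · exact sum_sqrt_len_mul_le hη h
    _ = _ := by ring

/-- The stress error at the vertices is small. -/
theorem exists_stress_estimate [Fintype V] [Fintype E] (hN : N.IsStent)
    (hgeo : N.NoAxialSelfStress) {σ : ℝ} (hσ : 0 < σ) :
    ∃ c, 0 ≤ c ∧ ∀ (k : ℕ) (T : N.Subdivision), T.QuasiUniform σ →
      (k = 0 → T.refine.DiscreteUnique k (k + 1)) → ∀ f, (∀ e, IsL2 (T.refine.len e) (f e)) →
      ∀ S φ Sh φh, T.refine.Solves f S φ → T.refine.SolvesDiscrete k (k + 1) f Sh φh →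
      ∀ (ε : (Σ i, Fin (T.m i + 1)) → ℝ) (η : ℝ), (∀ e, 0 ≤ ε e) → 0 ≤ η →
      ∑ e, ε e ^ 2 ≤ η ^ 2 → (∀ e, ApproxPoly (T.refine.len e) k (ε e) (S.p e)) →
      (∀ e, ApproxPoly (T.refine.len e) k (ε e) (S.q e)) →
      (∀ e, ApproxPoly (T.refine.len e) k (ε e)
        (fun s => T.refine.complianceOp e s (S.q e s))) →
      ∃ κ z, StressError T k S Sh ε κ z ∧ ‖κ‖ ≤ c * (T.refine.maxLen * η) := by
  have hnd := hN.nondegenerate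
  obtain ⟨cE, hcE, hE⟩ := exists_energy_bound hN hgeo hσ
  obtain ⟨M, hM, hCM, hLip⟩ := hN.exists_lipschitz_complianceOp
  have hL0 : 0 ≤ N.totalLen := totalLen_nonneg
  obtain ⟨a, ha⟩ : ∃ a, a = 1 + 2 * M * (1 + N.totalLen)
    + (2 + 4 * N.totalLen) * (M * (2 + N.totalLen)) := ⟨_, rfl⟩
  have ha0 : 0 ≤ a := by rw [ha]; positivity
  refine ⟨cE * (a * √N.totalLen), by positivity, fun k T hT hu f hf S φ Sh φh h hh ε η hε hη hεη
    hp hq hCq => ?_⟩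
  obtain ⟨κ, hκ, z, H⟩ := exists_stressError hN T hf h hh hp hq
  refine ⟨κ, z, H, ?_⟩
  have hlen := T.refine_len_pos hnd
  have hh0 : 0 ≤ T.refine.maxLen := maxLen_nonneg
  -- The exact problem is tested with the affine moment of κ, the discrete problem below with its
  -- projection; b annihilates both fields.
  have e1 : ∑ e, ∫ s in (0 : ℝ)..T.refine.len e, inner ℝ (T.refine.complianceOp e s (S.q e s))
      (N.momentAt κ e.1 (T.start e + s)) = 0 := by
    have hgL2 := fun e => (T.isPrim_momentAt κ e).isL2 (hlen e).le
    have h1 := h.eq_V (T.stressField κ fun e s => N.momentAt κ e.1 (T.start e + s))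
      ⟨hgL2, fun e => isL2_const _⟩
    rw [T.formB_stressField hnd hκ hgL2 h.mem_M (fun e => by simp), add_zero] at h1
    simp only [formA, matVec_eq] at h1
    exact h1
  have e2 : ∑ e, ∫ s in (0 : ℝ)..T.refine.len e, inner ℝ (T.refine.complianceOp e s (Sh.q e s))
      (T.projMoment k κ e s) = 0 := by
    have h1 := hh.eq_V _ (T.memVh_stressField κ k)
    rw [T.formB_stressField_projMoment hnd hκ hh.mem_M, add_zero] at h1
    simp only [formA, matVec_eq] at h1
    exact h1
  have e3 : ‖κ‖ ≤ cE * (a * (√N.totalLen * (T.refine.maxLen * η))) := by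
    refine hE k T hT hu κ hκ _ (by positivity) ?_
    refine (Finset.sum_le_sum fun e _ => H.energy_element_le hN e (h.mem_V.q_mem e)
      (hh.mem_V.mem.q_mem e) hM (hCM e.1) (hLip e.1) (hε e) (hCq e)).trans ?_
    rw [Finset.sum_add_distrib, Finset.sum_sub_distrib, e1, e2, ← ha, sub_zero, zero_add,
      ← Finset.sum_mul, ← Finset.mul_sum]
    gcongr
    rw [← T.totalLen_refine hnd]
    exact sum_len_mul_sqrt_len_mul_le hη hε hεη
  exact e3.trans (le_of_eq (by ring))

/-- Continuous functions on the struts with mean zero whose derivative has small integrals on the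
elements are small at all vertices. -/
theorem exists_nodal_bound [Fintype V] [Fintype E] (hN : N.IsStent) :
    ∃ c, 0 ≤ c ∧ ∀ (T : N.Subdivision) (ε : (Σ i, Fin (T.m i + 1)) → ℝ) (η K a : ℝ),
      (∀ e, 0 ≤ ε e) → 0 ≤ η → 0 ≤ K → 0 ≤ a → ∑ e, ε e ^ 2 ≤ η ^ 2 →
      ∀ (Y y : (Σ i, Fin (T.m i + 1)) → ℝ → R3) (Z : V ⊕ (Σ i, Fin (T.m i)) → R3),
        (∀ e, IsPrim (T.refine.len e) (Y e) (y e)) → (∀ e, Y e 0 = Z (T.refine.src e)) →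
        (∀ e, Y e (T.refine.len e) = Z (T.refine.tgt e)) →
        (∀ e, l2norm (T.refine.len e) (y e) ≤ a * (ε e + √(T.refine.len e) * K)) →
        (∀ e, ‖∫ s in (0 : ℝ)..T.refine.len e, y e s‖
          ≤ a * (T.refine.len e * (√(T.refine.len e) * ε e) + T.refine.len e * K)) →
        ∑ e, ∫ s in (0 : ℝ)..T.refine.len e, Y e s = 0 →
        ∀ v, ‖Z v‖ ≤ c * (a * (T.refine.maxLen * η + K)) := by
  classical
  have hnd := hN.nondegenerate
  obtain ⟨n, hn⟩ := hN.connected.exists_norm_sub_le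
  obtain ⟨L, hL⟩ : ∃ L, L = N.totalLen := ⟨_, rfl⟩
  have hLpos : 0 < L := hL ▸ hN.totalLen_pos
  refine ⟨(√L + L + L ^ 2) * (2 * (n + 1) + 1 / L), by positivity,
    fun T ε η K a hε hη hK ha hεη Y y Z hY hY0 hYℓ hy hyi hmean => ?_⟩
  have hlen := T.refine_len_pos hnd
  obtain ⟨H, hH⟩ : ∃ H, H = T.refine.maxLen * η := ⟨_, rfl⟩
  have hH0 : 0 ≤ H := hH ▸ mul_nonneg maxLen_nonneg hη
  have htot : ∑ e, T.refine.len e = L := hL ▸ T.totalLen_refine hnd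
  have hle : ∀ e, T.refine.len e ≤ L := fun e => by
    rw [← htot]
    exact Finset.single_le_sum (fun e _ => (hlen e).le) (Finset.mem_univ e)
  have hsum : ∑ e, T.refine.len e * (√(T.refine.len e) * ε e) ≤ √L * H := by
    have := sum_len_mul_sqrt_len_mul_le (N := T.refine) hη hε hεη
    rwa [T.totalLen_refine hnd, ← hL, ← hH] at this
  obtain ⟨D, hD⟩ : ∃ D, D = (√L + L + L ^ 2) * (a * (H + K)) := ⟨_, rfl⟩
  have hD0 : 0 ≤ D := by rw [hD]; positivity
  -- Nodal increments depend on y only through its integrals over the elements, for which the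
  -- sharper hypothesis with the additional factor ℓ holds.
  have hinc : ∑ e, ‖Z (T.refine.tgt e) - Z (T.refine.src e)‖ ≤ D := by
    have h1 : ∀ e, ‖Z (T.refine.tgt e) - Z (T.refine.src e)‖
        ≤ a * (T.refine.len e * (√(T.refine.len e) * ε e) + T.refine.len e * K) := fun e => by
      rw [← hYℓ, ← hY0, (hY e).eq _ ⟨(hlen e).le, le_rfl⟩, add_sub_cancel_left]
      exact hyi e
    refine (Finset.sum_le_sum fun e _ => h1 e).trans ?_
    rw [← Finset.mul_sum, Finset.sum_add_distrib, ← Finset.sum_mul, htot, hD]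
    have : a * (√L * H + L * K) ≤ (√L + L + L ^ 2) * (a * (H + K)) := by
      have p1 : 0 ≤ √L * (a * K) + L * (a * H) + L ^ 2 * (a * (H + K)) := by positivity
      linarith
    refine le_trans ?_ this
    gcongr
  have hstrut : ∀ i, ∑ j : Fin (T.m i + 1), ‖Z (T.refine.tgt ⟨i, j⟩) - Z (T.refine.src ⟨i, j⟩)‖
      ≤ D := fun i => by
    rw [Fintype.sum_sigma] at hinc
    exact (Finset.single_le_sum (f := fun i => ∑ j : Fin (T.m i + 1),
      ‖Z (T.refine.tgt ⟨i, j⟩) - Z (T.refine.src ⟨i, j⟩)‖)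
      (fun i _ => Finset.sum_nonneg fun _ _ => norm_nonneg _) (Finset.mem_univ i)).trans hinc
  have hnode : ∀ i j, ‖Z (T.nodeVertex i j) - Z (Sum.inl (N.src i))‖ ≤ D := fun i j => by
    have h1 := norm_sub_zero_le_sum (fun j => Z (T.nodeVertex i j)) j
    have h2 := hstrut i
    simp only [T.refine_tgt, T.refine_src] at h2
    exact h1.trans h2
  have hinl : ∀ a b, ‖Z (Sum.inl a) - Z (Sum.inl b)‖ ≤ n * D := by
    refine hn (fun a => Z (Sum.inl a)) D hD0 fun a b hab => ?_
    rw [SimpleGraph.fromRel_adj] at hab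
    obtain ⟨-, ⟨i, rfl, rfl⟩ | ⟨i, rfl, rfl⟩⟩ := hab
    · rw [norm_sub_rev, ← T.nodeVertex_last]; exact hnode i _
    · rw [← T.nodeVertex_last]; exact hnode i _
  have hvert : ∀ v, ∃ b, ‖Z v - Z (Sum.inl b)‖ ≤ D := by
    rintro (b | ⟨i, j⟩)
    · exact ⟨b, by simpa using hD0⟩
    · exact ⟨N.src i, by rw [← T.nodeVertex_interior]; exact hnode i _⟩
  obtain ⟨b₀⟩ := hN.connected.nonempty
  set Z0 := Z (Sum.inl b₀) with hZ0
  have hall : ∀ v, ‖Z v - Z0‖ ≤ (n + 1) * D := fun v => by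
    obtain ⟨b, hb⟩ := hvert v
    have h1 := hinl b b₀
    have h2 := norm_sub_le_norm_sub_add_norm_sub (Z v) (Z (Sum.inl b)) Z0
    linarith
  -- the mean value
  have hmid : ∀ e, ‖∫ s in (0 : ℝ)..T.refine.len e, (Y e s - Y e 0)‖
      ≤ a * (T.refine.len e * (√(T.refine.len e) * ε e) + T.refine.len e * (L * K)) := fun e => by
    have hℓ := (hlen e).le
    have h1 := norm_integral_le_l2norm hℓ (((hY e).isL2 hℓ).sub (isL2_const (Y e 0)))
      ⟨hℓ, le_rfl⟩
    have h2 : l2norm (T.refine.len e) (fun s => Y e s - Y e 0)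
        ≤ T.refine.len e * (a * (ε e + √(T.refine.len e) * K)) := by
      rw [l2norm_congr_ae hℓ (v := fun s => ∫ τ in (0 : ℝ)..s, y e τ)
        (ae_of_forall_Ioc fun s hs => by
          rw [(hY e).eq s (Ioc_subset_Icc_self hs), add_sub_cancel_left])]
      refine (l2norm_integral_le hℓ (hY e).mem).trans ?_
      gcongr
      exact hy e
    refine h1.trans ((mul_le_mul_of_nonneg_left h2 (Real.sqrt_nonneg _)).trans ?_)
    calc _ = a * (T.refine.len e * (√(T.refine.len e) * ε e)
          + T.refine.len e * ((√(T.refine.len e) * √(T.refine.len e)) * K)) := by ring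
      _ ≤ _ := by
        rw [Real.mul_self_sqrt hℓ]
        have := hle e
        gcongr
  -- Since the total mean vanishes, L Z0 is minus the integral of Y - Z0, and all deviations from Z0
  -- are already bounded.
  have hZ0b : L * ‖Z0‖ ≤ D + L * ((n + 1) * D) := by
    have h1 : L • Z0 = -∑ e, ((∫ s in (0 : ℝ)..T.refine.len e, (Y e s - Y e 0))
        + T.refine.len e • (Z (T.refine.src e) - Z0)) := by
      have h2 : ∀ e, (∫ s in (0 : ℝ)..T.refine.len e, (Y e s - Y e 0))
          + T.refine.len e • (Z (T.refine.src e) - Z0)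
          = (∫ s in (0 : ℝ)..T.refine.len e, Y e s) - T.refine.len e • Z0 := fun e => by
        rw [intervalIntegral.integral_sub (((hY e).isL2 (hlen e).le).intervalIntegrable
          (hlen e).le) (by simp), hY0]
        simp only [intervalIntegral.integral_const, sub_zero, smul_sub]
        abel
      simp only [h2, Finset.sum_sub_distrib, hmean, ← Finset.sum_smul, htot]
      simp
    have h3 : L * ‖Z0‖ = ‖L • Z0‖ := by rw [norm_smul, Real.norm_of_nonneg hLpos.le]
    rw [h3, h1, norm_neg]
    refine (norm_sum_le _ _).trans ?_
    have h4 : ∀ e, ‖(∫ s in (0 : ℝ)..T.refine.len e, (Y e s - Y e 0))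
        + T.refine.len e • (Z (T.refine.src e) - Z0)‖
        ≤ a * (T.refine.len e * (√(T.refine.len e) * ε e) + T.refine.len e * (L * K))
          + T.refine.len e * ((n + 1) * D) := fun e => by
      refine (norm_add_le _ _).trans (add_le_add (hmid e) ?_)
      rw [norm_smul, Real.norm_of_nonneg (hlen e).le]
      have := (hlen e).le
      gcongr
      exact hall _
    refine (Finset.sum_le_sum fun e _ => h4 e).trans ?_
    rw [Finset.sum_add_distrib, ← Finset.mul_sum, Finset.sum_add_distrib, ← Finset.sum_mul,
      ← Finset.sum_mul, htot]
    gcongr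
    have : a * (√L * H + L * (L * K)) ≤ D := by
      have p1 : 0 ≤ √L * (a * K) + L * (a * (H + K)) + L ^ 2 * (a * H) := by positivity
      rw [hD]
      linarith
    refine le_trans ?_ this
    gcongr
  intro v
  rw [← hH]
  have h5 : ‖Z0‖ ≤ D / L + (n + 1) * D := by
    rw [div_add' _ _ _ hLpos.ne', le_div_iff₀ hLpos]
    linarith
  have h6 := norm_le_norm_add_norm_sub' (Z v) Z0
  have h7 := hall v
  calc ‖Z v‖ ≤ D / L + (n + 1) * D + (n + 1) * D := by linarith
    _ = _ := by rw [hD]; ring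

end StrutNetwork

/-! ### ### The error of the motion -/

/-- The remainder θ of the moment error is only of size ε but has mean zero on the element. In the
integral of C θ only C - C 0 counts, which gains a factor ℓ; z carries this factor already and gb is
of size K. The L² bound has no such gain. -/
theorem element_curvature_le {ℓ L M ε K : ℝ} {k : ℕ} (hℓ : 0 ≤ ℓ) (hL : ℓ ≤ L) (hM : 0 ≤ M)
    (hε : 0 ≤ ε) (hK : 0 ≤ K) {C : ℝ → R3 →L[ℝ] R3} (hC : ContinuousOn C (Icc 0 ℓ))
    (hCM : ∀ s ∈ Icc 0 ℓ, ‖C s‖ ≤ M) (hC0 : ∀ s ∈ Icc 0 ℓ, ‖C s - C 0‖ ≤ M * s)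
    {q q' gb z : ℝ → R3} (hq : IsL2 ℓ q) (hq' : IsL2 ℓ q') (hz : IsL2 ℓ z) (hgb : IsVPoly k gb)
    (hgbb : ∀ s ∈ Icc 0 ℓ, ‖gb s‖ ≤ (1 + L) * K) (hzl : l2norm ℓ z ≤ 2 * ℓ * ε)
    (hθl : l2norm ℓ (fun s => q s - q' s - gb s - z s) ≤ (2 + 4 * ℓ) * ε)
    (hθo : ∀ ξ, IsVPoly k ξ → ∫ s in (0 : ℝ)..ℓ, inner ℝ (q s - q' s - gb s - z s) (ξ s) = 0) :
    l2norm ℓ (fun s => q s - q' s) ≤ (2 + 6 * L) * (ε + √ℓ * K) ∧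
      ‖∫ s in (0 : ℝ)..ℓ, (C s (q s) - C s (q' s))‖
        ≤ M * (4 + 4 * L) * (ℓ * (√ℓ * ε) + ℓ * K) := by
  have hL0 : 0 ≤ L := hℓ.trans hL
  have hgb2 := hgb.isL2 ℓ
  have hgbl : l2norm ℓ gb ≤ √ℓ * ((1 + L) * K) :=
    l2norm_le_of_bound hℓ (by positivity) fun s hs => hgbb s (Ioc_subset_Icc_self hs)
  have hθ := ((hq.sub hq').sub hgb2).sub hz
  have hℓε : ℓ * ε ≤ L * ε := by gcongr
  set θ := fun s => q s - q' s - gb s - z s with hθdef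
  have hsplit : ∀ s, q s - q' s = gb s + z s + θ s := fun s => by simp only [hθdef]; abel
  constructor
  · simp only [hsplit]
    have h1 := l2norm_add_le hℓ (hgb2.add hz) hθ
    have h2 := l2norm_add_le hℓ hgb2 hz
    have h3 : 0 ≤ √ℓ * K := by positivity
    have h4 : 0 ≤ L * (√ℓ * K) := by positivity
    linarith
  · have hC0θ : IsL2 ℓ (fun s => (C s - C 0) (θ s)) :=
      isL2_clm_apply (hC.sub continuousOn_const) hθ
    have hCs : IsL2 ℓ (fun s => C s (gb s) + C s (z s)) :=
      (isL2_clm_apply hC hgb2).add (isL2_clm_apply hC hz)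
    have h0 : ∫ s in (0 : ℝ)..ℓ, C 0 (θ s) = 0 := by
      rw [integral_clm hℓ (C 0) hθ ⟨hℓ, le_rfl⟩, integral_eq_zero_of_orthogonal hℓ hθ hθo, map_zero]
    have h1 : ∫ s in (0 : ℝ)..ℓ, (C s (q s) - C s (q' s))
        = (∫ s in (0 : ℝ)..ℓ, (C s (gb s) + C s (z s)))
          + ∫ s in (0 : ℝ)..ℓ, (C s - C 0) (θ s) := by
      rw [← add_zero (∫ s in (0 : ℝ)..ℓ, (C s - C 0) (θ s)), ← h0,
        ← intervalIntegral.integral_add (hC0θ.intervalIntegrable hℓ)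
          ((hθ.clm (C 0)).intervalIntegrable hℓ),
        ← intervalIntegral.integral_add (hCs.intervalIntegrable hℓ)
          ((hC0θ.add (hθ.clm (C 0))).intervalIntegrable hℓ)]
      congr 1
      funext s
      rw [← map_sub, hsplit]
      simp
    have h2 := norm_integral_le_l2norm hℓ hCs ⟨hℓ, le_rfl⟩
    have h3 := norm_integral_le_l2norm hℓ hC0θ ⟨hℓ, le_rfl⟩
    have h4 : l2norm ℓ (fun s => C s (gb s) + C s (z s))
        ≤ M * (√ℓ * ((1 + L) * K)) + M * (2 * ℓ * ε) := by
      refine (l2norm_add_le hℓ (isL2_clm_apply hC hgb2) (isL2_clm_apply hC hz)).trans ?_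
      exact add_le_add ((l2norm_clm_apply_le hℓ hM hCM hgb2).trans (by gcongr))
        ((l2norm_clm_apply_le hℓ hM hCM hz).trans (by gcongr))
    have h5 : l2norm ℓ (fun s => (C s - C 0) (θ s)) ≤ (M * ℓ) * ((2 + 4 * L) * ε) := by
      refine (l2norm_clm_apply_le (C := fun s => C s - C 0) hℓ (by positivity)
        (fun s hs => (hC0 s hs).trans (mul_le_mul_of_nonneg_left hs.2 hM)) hθ).trans ?_
      exact mul_le_mul_of_nonneg_left (hθl.trans (by gcongr)) (by positivity)
    rw [h1]
    refine (norm_add_le _ _).trans ((add_le_add (h2.trans (mul_le_mul_of_nonneg_left h4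
      (Real.sqrt_nonneg _))) (h3.trans (mul_le_mul_of_nonneg_left h5
      (Real.sqrt_nonneg _)))).trans ?_)
    calc _ = M * (1 + L) * ((√ℓ * √ℓ) * K) + M * (4 + 4 * L) * (ℓ * (√ℓ * ε)) := by ring
      _ = M * (1 + L) * (ℓ * K) + M * (4 + 4 * L) * (ℓ * (√ℓ * ε)) := by
          rw [Real.mul_self_sqrt hℓ]
      _ ≤ M * (4 + 4 * L) * (ℓ * K) + M * (4 + 4 * L) * (ℓ * (√ℓ * ε)) := by
          gcongr <;> linarith
      _ = _ := by ring

/-- A Galerkin error estimate for derivatives. -/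
theorem l2norm_sub_le_of_projection {ℓ ε : ℝ} {k : ℕ} (hℓ : 0 ≤ ℓ) {y y' a b : ℝ → R3}
    (ha : IsL2 ℓ a) (hb : IsL2 ℓ b) (hy' : IsL2 ℓ y')
    (hya : ∀ᵐ s ∂volume.restrict (Ioc 0 ℓ), y s = a s)
    (hpoly : ∃ v, IsVPoly k v ∧ ∀ᵐ s ∂volume.restrict (Ioc 0 ℓ), y' s = v s)
    (hort : ∀ ξ, IsVPoly k ξ → ∫ s in (0 : ℝ)..ℓ, inner ℝ (y' s - b s) (ξ s) = 0)
    (happ : ApproxPoly ℓ k ε a) :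
    l2norm ℓ (fun s => y s - y' s) ≤ 2 * ε + l2norm ℓ (fun s => a s - b s) ∧
      ∫ s in (0 : ℝ)..ℓ, (y s - y' s) = ∫ s in (0 : ℝ)..ℓ, (a s - b s) := by
  obtain ⟨v, hv, hy'v⟩ := hpoly
  obtain ⟨π, hπ, haπ⟩ := happ
  have hy : IsL2 ℓ y := ha.congr_ae (by filter_upwards [hya] with s hs using hs.symm)
  constructor
  · have h1 := l2norm_le_of_orthogonal hℓ (hb.sub ha) ha hv hπ (e := fun s => y s - y' s)
      (by filter_upwards [hya, hy'v] with s h1 h2; rw [h1, h2]) (fun ξ hξ => by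
        rw [← neg_eq_zero, ← intervalIntegral.integral_neg]
        refine Eq.trans (integral_congr_Ioc hℓ ?_) (hort ξ hξ)
        filter_upwards [hya] with s hs
        rw [hs, ← inner_neg_left]
        congr 1
        abel)
    have h2 : l2norm ℓ (fun s => b s - a s) = l2norm ℓ (fun s => a s - b s) := by
      rw [← l2norm_neg]; simp only [neg_sub]
    linarith
  · have h1 := integral_eq_zero_of_orthogonal hℓ (hy'.sub hb) hort
    rw [intervalIntegral.integral_sub (hy'.intervalIntegrable hℓ) (hb.intervalIntegrable hℓ),
      sub_eq_zero] at h1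
    rw [intervalIntegral.integral_sub (hy.intervalIntegrable hℓ) (hy'.intervalIntegrable hℓ),
      intervalIntegral.integral_sub (ha.intervalIntegrable hℓ) (hb.intervalIntegrable hℓ), h1,
      integral_congr_Ioc hℓ hya]

theorem IsPrim.l2norm_le {ℓ : ℝ} {Y y : ℝ → R3} (hℓ : 0 ≤ ℓ) (h : IsPrim ℓ Y y) :
    l2norm ℓ Y ≤ √ℓ * ‖Y 0‖ + ℓ * l2norm ℓ y := by
  rw [l2norm_congr_ae hℓ (v := fun s => Y 0 + ∫ τ in (0 : ℝ)..s, y τ)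
    (ae_of_forall_Ioc fun s hs => h.eq s (Ioc_subset_Icc_self hs)), ← l2norm_const hℓ]
  refine (l2norm_add_le hℓ (isL2_const _) (isL2_of_continuousOn
    (continuousOn_integral hℓ h.mem))).trans ?_
  gcongr
  exact l2norm_integral_le hℓ h.mem

namespace StrutNetwork

variable {V E : Type*} {N : StrutNetwork V E}

theorem StressError.curvature_le [Fintype E] (hN : N.IsStent) {T : N.Subdivision} {k : ℕ}
    {S Sh : ForceField (Σ i, Fin (T.m i + 1))} {ε : (Σ i, Fin (T.m i + 1)) → ℝ} {κ : E → R3 × R3}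
    {z : (Σ i, Fin (T.m i + 1)) → ℝ → R3} (H : StressError T k S Sh ε κ z) {K : ℝ} (hκ : ‖κ‖ ≤ K)
    (e : Σ i, Fin (T.m i + 1)) (hq : IsL2 (T.refine.len e) (S.q e))
    (hq' : IsL2 (T.refine.len e) (Sh.q e)) {M : ℝ} (hM : 0 ≤ M)
    (hCM : ∀ s ∈ Icc 0 (N.len e.1), ‖N.complianceOp e.1 s‖ ≤ M)
    (hLip : ∀ x ∈ Icc 0 (N.len e.1), ∀ s, 0 ≤ s → x + s ≤ N.len e.1 →
        ‖N.complianceOp e.1 (x + s) - N.complianceOp e.1 x‖ ≤ M * s) (hε : 0 ≤ ε e) :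
    l2norm (T.refine.len e) (fun s => S.q e s - Sh.q e s)
      ≤ (2 + 6 * N.totalLen) * (ε e + √(T.refine.len e) * K) ∧
    ‖∫ s in (0 : ℝ)..T.refine.len e,
      (T.refine.complianceOp e s (S.q e s) - T.refine.complianceOp e s (Sh.q e s))‖
      ≤ M * (4 + 4 * N.totalLen)
        * (T.refine.len e * (√(T.refine.len e) * ε e) + T.refine.len e * K) := by
  have hnd := hN.nondegenerate
  have hpos := T.refine_len_pos hnd e
  have hLe : T.refine.len e ≤ N.totalLen := by
    rw [← T.totalLen_refine hnd]; exact len_le_totalLen e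
  have hmem := fun s hs => T.add_mem_Icc hnd e (s := s) hs
  have hK : 0 ≤ K := (norm_nonneg κ).trans hκ
  have hL0 : 0 ≤ N.totalLen := totalLen_nonneg
  refine element_curvature_le hpos.le hLe hM hε hK (T.continuousOn_complianceOp hN e)
    (fun s hs => hCM _ (hmem s hs)) (fun s hs => ?_) hq hq' (H.z_mem e)
    (T.isVPoly_projMoment k κ e) (fun s hs =>
      (T.norm_projMoment_le hnd len_le_totalLen k κ e hs).trans (by gcongr))
    (H.z_le e) (H.q_le e) (H.q_orth e)
  have h1 := hLip _ (hmem 0 ⟨le_rfl, hpos.le⟩) s hs.1 (by simpa using (hmem s hs).2)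
  rw [add_zero] at h1
  rw [T.refine_complianceOp, T.refine_complianceOp, add_zero]
  exact h1

/-- Galerkin equations for the derivatives of the displacement and the rotation. -/
theorem galerkin_motion [Fintype V] [Fintype E] (hlen : ∀ i, 0 < N.len i)
    (hC : ∀ i, ContinuousOn (N.complianceOp i) (Icc 0 (N.len i))) {k : ℕ} {f : E → ℝ → R3}
    {S Sh : ForceField E} {φ φh : MotionField V E} (h : N.Solves f S φ)
    (hh : N.SolvesDiscrete k (k + 1) f Sh φh) (hnt : ∀ i, ‖N.tangent i‖ = 1) {ε : ℝ} (i : E)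
    (hCq : ApproxPoly (N.len i) k ε (fun s => N.complianceOp i s (S.q i s)))
    (hw : ApproxPoly (N.len i) k ε (φ.w i)) :
    (l2norm (N.len i) (fun s => φ.dw i s - φh.dw i s) ≤ 2 * ε + l2norm (N.len i)
      (fun s => N.complianceOp i s (S.q i s) - N.complianceOp i s (Sh.q i s)) ∧
    ∫ s in (0 : ℝ)..N.len i, (φ.dw i s - φh.dw i s) = ∫ s in (0 : ℝ)..N.len i,
      (N.complianceOp i s (S.q i s) - N.complianceOp i s (Sh.q i s))) ∧
    l2norm (N.len i) (fun s => φ.du i s - φh.du i s)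
      ≤ 2 * ε + l2norm (N.len i) (fun s => φ.w i s - φh.w i s) ∧
    ‖∫ s in (0 : ℝ)..N.len i, (φ.du i s - φh.du i s)‖
      ≤ √(N.len i) * l2norm (N.len i) (fun s => φ.w i s - φh.w i s) := by
  have hℓ := (hlen i).le
  obtain ⟨hpu, hpw⟩ := hh.mem_M.exists_poly hlen i
  have hCq2 := isL2_clm_apply (hC i) (h.mem_V.q_mem i)
  have hCq2' := isL2_clm_apply (hC i) (hh.mem_V.mem.q_mem i)
  have hw2 := (((h.mem_M.w_mem i).isPrim (hlen i)).isL2 hℓ)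
  have hw2' := (((hh.mem_M.mem.w_mem i).isPrim (hlen i)).isL2 hℓ)
  set t := N.tangent i with ht
  have hle : ∀ x, ‖-cross t x‖ ≤ 1 * ‖x‖ := fun x => by
    rw [norm_neg, ← hnt i]; exact norm_cross_le _ _
  have hcr : ∀ u, IsL2 (N.len i) u → IsL2 (N.len i) (fun s => -cross t (u s)) := fun u hu => by
    simpa only [crossL_apply] using (hu.clm (crossL t)).neg
  refine ⟨l2norm_sub_le_of_projection hℓ hCq2 hCq2' (hh.mem_M.mem.w_mem i).deriv_mem
    (h.isPrim_w hlen hC i).2 hpw (fun ξ hξ => ?_) hCq, ?_⟩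
  · exact curvature_test hℓ (hξ.isL2 _) (hh.mem_M.mem.w_mem i).deriv_mem hCq2'
      (hh.eq_V _ (memVh_single i 0 0 0 0 hξ (isVPoly_const k 0)))
  · have happ : ApproxPoly (N.len i) k ε (fun s => -cross t (φ.w i s)) := by
      obtain ⟨π, hπ, hπw⟩ := hw
      refine ⟨fun s => -cross t (π s), (hπ.clm (crossL t)).neg, le_trans ?_ hπw⟩
      refine (l2norm_mono_ae hℓ zero_le_one (hw2.sub (hπ.isL2 _))
        (ae_of_forall_Ioc fun s _ => ?_)).trans (by rw [one_mul])
      have : -cross t (φ.w i s) - -cross t (π s) = -cross t (φ.w i s - π s) := by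
        rw [cross_sub']; abel
      rw [this]
      exact hle _
    have h1 := l2norm_sub_le_of_projection hℓ (hcr _ hw2) (hcr _ hw2')
      (hh.mem_M.mem.u_mem i).deriv_mem (h.isPrim_u hlen i).2 hpu (fun ξ hξ => by
        simp only [sub_neg_eq_add]
        exact strain_test (hh.eq_V _ (memVh_single i 0 0 0 0 (isVPoly_const k 0) hξ))) happ
    have h2 : ∀ s, -cross t (φ.w i s) - -cross t (φh.w i s) = -cross t (φ.w i s - φh.w i s) :=
      fun s => by rw [cross_sub']; abel
    simp only [h2] at h1
    have h3 : l2norm (N.len i) (fun s => -cross t (φ.w i s - φh.w i s))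
        ≤ l2norm (N.len i) (fun s => φ.w i s - φh.w i s) := by
      refine (l2norm_mono_ae hℓ zero_le_one (hw2.sub hw2')
        (ae_of_forall_Ioc fun s _ => hle _)).trans (by rw [one_mul])
    refine ⟨h1.1.trans (by linarith), ?_⟩
    rw [h1.2]
    exact (norm_integral_le_l2norm hℓ (hcr _ (hw2.sub hw2')) ⟨hℓ, le_rfl⟩).trans
      (mul_le_mul_of_nonneg_left h3 (Real.sqrt_nonneg _))

/-- The rotation is treated before the displacement, because the error of u' consists of an
approximation error and the rotation error. For each of them the integrals over the elements give
the nodal errors, and these together with the derivative errors give the L² errors. -/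
theorem exists_motion_estimate [Fintype V] [Fintype E] (hN : N.IsStent) :
    ∃ c, 0 ≤ c ∧ ∀ (k : ℕ) (T : N.Subdivision) (f) (S Sh) (φ φh), T.refine.Solves f S φ →
      T.refine.SolvesDiscrete k (k + 1) f Sh φh →
      ∀ (ε : (Σ i, Fin (T.m i + 1)) → ℝ) (η K : ℝ) (κ z), (∀ e, 0 ≤ ε e) → 0 ≤ η → ‖κ‖ ≤ K →
      ∑ e, ε e ^ 2 ≤ η ^ 2 → StressError T k S Sh ε κ z →
      (∀ e, ApproxPoly (T.refine.len e) k (ε e)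
        (fun s => T.refine.complianceOp e s (S.q e s))) →
      (∀ e, ApproxPoly (T.refine.len e) k (ε e) (φ.w e)) →
      (∀ v, ‖φ.U v - φh.U v‖ ≤ c * (T.refine.maxLen * η + K) ∧
        ‖φ.W v - φh.W v‖ ≤ c * (T.refine.maxLen * η + K)) ∧
      ∀ e, let ζ := c * (ε e + √(T.refine.len e) * (T.refine.maxLen * η + K));
        l2norm (T.refine.len e) (fun s => S.q e s - Sh.q e s) ≤ ζ ∧
        l2norm (T.refine.len e) (fun s => φ.u e s - φh.u e s) ≤ ζ ∧
        l2norm (T.refine.len e) (fun s => φ.du e s - φh.du e s) ≤ ζ ∧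
        l2norm (T.refine.len e) (fun s => φ.w e s - φh.w e s) ≤ ζ ∧
        l2norm (T.refine.len e) (fun s => φ.dw e s - φh.dw e s) ≤ ζ := by
  have hnd := hN.nondegenerate
  obtain ⟨M, hM, hCM, hLip⟩ := hN.exists_lipschitz_complianceOp
  obtain ⟨cn, hcn, hnode⟩ := exists_nodal_bound hN
  obtain ⟨L, hL⟩ : ∃ L, L = N.totalLen := ⟨_, rfl⟩
  have hL0 : 0 ≤ L := hL ▸ totalLen_nonneg
  -- One constant for both hypotheses of the nodal bound: the L² norm of the error of ω' and its
  -- integral over an element.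
  obtain ⟨a, ha⟩ : ∃ a, a = 2 + M * (2 + 6 * L) + M * (4 + 4 * L) := ⟨_, rfl⟩
  have ha0 : 0 ≤ a := by rw [ha]; positivity
  obtain ⟨c1, hc1⟩ : ∃ c1, c1 = cn * a := ⟨_, rfl⟩
  have hc10 : 0 ≤ c1 := by rw [hc1]; positivity
  obtain ⟨b, hb⟩ : ∃ b, b = 2 + L * a + a + 1 := ⟨_, rfl⟩
  have hb0 : 0 ≤ b := by rw [hb]; positivity
  obtain ⟨c3, hc3⟩ : ∃ c3, c3 = cn * b * (c1 + 2) := ⟨_, rfl⟩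
  have hc30 : 0 ≤ c3 := by rw [hc3]; positivity
  refine ⟨(2 + 6 * L) + a + (c1 + L * a) + b * (c1 + 2) + (c3 + L * (b * (c1 + 2))),
    by positivity, fun k T f S Sh φ φh h hh ε η K κ z hε hη hκ hεη H hCq hw => ?_⟩
  have hlen := T.refine_len_pos hnd
  have hnd' : ∀ e, T.refine.pos (T.refine.src e) ≠ T.refine.pos (T.refine.tgt e) :=
    fun e => dist_pos.1 (hlen e)
  have hK : 0 ≤ K := (norm_nonneg κ).trans hκ
  obtain ⟨J, hJ⟩ : ∃ J, J = T.refine.maxLen * η + K := ⟨_, rfl⟩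
  have hH0 : 0 ≤ T.refine.maxLen * η := mul_nonneg maxLen_nonneg hη
  have hKJ : K ≤ J := by linarith
  have hJ0 : 0 ≤ J := hK.trans hKJ
  have hle : ∀ e, T.refine.len e ≤ L := fun e => by
    rw [hL, ← T.totalLen_refine hnd]; exact len_le_totalLen e
  have hcurv := fun e => H.curvature_le hN hκ e (h.mem_V.q_mem e) (hh.mem_V.mem.q_mem e) hM
    (hCM e.1) (hLip e.1) (hε e)
  rw [← hL] at hcurv
  have hgal := fun e => galerkin_motion hlen (T.continuousOn_complianceOp hN) h hh
    (norm_tangent hnd') e (hCq e) (hw e)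
  have hEV : ∀ G, T.refine.MemVh k G → T.refine.formA S G + T.refine.formB G φ = 0 :=
    fun G hG => h.eq_V G hG.mem
  have hWp := fun e => ((h.mem_M.w_mem e).isPrim (hlen e)).sub (hlen e).le
    ((hh.mem_M.mem.w_mem e).isPrim (hlen e))
  have hUp := fun e => ((h.mem_M.u_mem e).isPrim (hlen e)).sub (hlen e).le
    ((hh.mem_M.mem.u_mem e).isPrim (hlen e))
  have hnod := fun e => nodal_of_tests hEV e
  have hnod' := fun e => nodal_of_tests hh.eq_V e
  have hmean := mean_of_tests hEV
  have hmean' := mean_of_tests hh.eq_V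
  have hL2 : ∀ e, IsL2 (T.refine.len e) (φ.u e) ∧ IsL2 (T.refine.len e) (φh.u e) ∧
      IsL2 (T.refine.len e) (φ.w e) ∧ IsL2 (T.refine.len e) (φh.w e) := fun e =>
    ⟨isL2_of_continuousOn (h.mem_M.u_mem e).cont, isL2_of_continuousOn (hh.mem_M.mem.u_mem e).cont,
      isL2_of_continuousOn (h.mem_M.w_mem e).cont, isL2_of_continuousOn (hh.mem_M.mem.w_mem e).cont⟩
  have hsrc : ∀ e, φ.w e 0 - φh.w e 0 = φ.W (T.refine.src e) - φh.W (T.refine.src e) ∧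
      φ.u e 0 - φh.u e 0 = φ.U (T.refine.src e) - φh.U (T.refine.src e) := fun e => by
    rw [(hnod e).2.2.2, (hnod' e).2.2.2, (hnod e).2.1, (hnod' e).2.1]
    exact ⟨rfl, rfl⟩
  have htgt : ∀ e, φ.w e (T.refine.len e) - φh.w e (T.refine.len e)
        = φ.W (T.refine.tgt e) - φh.W (T.refine.tgt e) ∧
      φ.u e (T.refine.len e) - φh.u e (T.refine.len e)
        = φ.U (T.refine.tgt e) - φh.U (T.refine.tgt e) := fun e => by
    rw [(hnod e).2.2.1, (hnod' e).2.2.1, (hnod e).1, (hnod' e).1]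
    exact ⟨rfl, rfl⟩
  have hmid : ∑ e, ∫ s in (0 : ℝ)..T.refine.len e, (φ.u e s - φh.u e s) = 0 ∧
      ∑ e, ∫ s in (0 : ℝ)..T.refine.len e, (φ.w e s - φh.w e s) = 0 := by
    have h1 := fun e => intervalIntegral.integral_sub
      ((hL2 e).1.intervalIntegrable (hlen e).le) ((hL2 e).2.1.intervalIntegrable (hlen e).le)
    have h2 := fun e => intervalIntegral.integral_sub
      ((hL2 e).2.2.1.intervalIntegrable (hlen e).le)
      ((hL2 e).2.2.2.intervalIntegrable (hlen e).le)
    simp only [h1, h2, Finset.sum_sub_distrib, hmean, hmean', sub_self, and_self]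
  have hx0 : ∀ e, 0 ≤ √(T.refine.len e) := fun e => Real.sqrt_nonneg _
  have hxx : ∀ e, √(T.refine.len e) * √(T.refine.len e) = T.refine.len e :=
    fun e => Real.mul_self_sqrt (hlen e).le
  -- the rotation
  have hdw : ∀ e, l2norm (T.refine.len e) (fun s => φ.dw e s - φh.dw e s)
      ≤ a * (ε e + √(T.refine.len e) * K) := fun e => by
    refine (hgal e).1.1.trans ?_
    have h1 := l2norm_clm_apply_le (hlen e).le hM
      (fun s hs => hCM e.1 _ (T.add_mem_Icc hnd e hs)) ((h.mem_V.q_mem e).sub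
        (hh.mem_V.mem.q_mem e))
    simp only [map_sub] at h1
    have h2 := h1.trans (mul_le_mul_of_nonneg_left (hcurv e).1 hM)
    have h3 : 0 ≤ M * (4 + 4 * L) * (ε e + √(T.refine.len e) * K) := by
      have := hε e
      positivity
    have h4 : 0 ≤ √(T.refine.len e) * K := by positivity
    refine (add_le_add_right h2 (2 * ε e)).trans ?_
    rw [ha]
    linarith
  have hW : ∀ v, ‖φ.W v - φh.W v‖ ≤ c1 * J := by
    rw [hc1, hJ, mul_assoc]
    refine hnode T ε η K a hε hη hK ha0 hεη _ _ (fun v => φ.W v - φh.W v) hWp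
      (fun e => (hsrc e).1) (fun e => (htgt e).1) hdw (fun e => ?_) hmid.2
    rw [(hgal e).1.2]
    refine (hcurv e).2.trans (mul_le_mul_of_nonneg_right ?_ ?_)
    · rw [ha]
      have : 0 ≤ 2 + M * (2 + 6 * L) := by positivity
      linarith
    · have := (hlen e).le
      have := hε e
      positivity
  have hwl : ∀ e, l2norm (T.refine.len e) (fun s => φ.w e s - φh.w e s)
      ≤ √(T.refine.len e) * (c1 * J) + T.refine.len e * (a * (ε e + √(T.refine.len e) * K)) :=
    fun e => by
    refine ((hWp e).l2norm_le (hlen e).le).trans (add_le_add ?_ ?_)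
    · rw [(hsrc e).1]
      exact mul_le_mul_of_nonneg_left (hW _) (hx0 e)
    · exact mul_le_mul_of_nonneg_left (hdw e) (hlen e).le
  have hwl' : ∀ e, l2norm (T.refine.len e) (fun s => φ.w e s - φh.w e s)
      ≤ (c1 + L * a) * (ε e + √(T.refine.len e) * J) := fun e => by
    refine (hwl e).trans ?_
    have h1 : T.refine.len e * (a * (ε e + √(T.refine.len e) * K))
        ≤ L * (a * (ε e + √(T.refine.len e) * J)) := by
      have := hε e
      gcongr
      exact hle e
    have h2 : 0 ≤ c1 * ε e := mul_nonneg hc10 (hε e)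
    linarith
  -- the displacement
  have hdu : ∀ e, l2norm (T.refine.len e) (fun s => φ.du e s - φh.du e s)
      ≤ b * (ε e + √(T.refine.len e) * ((c1 + 1) * J)) := fun e => by
    refine (hgal e).2.1.trans ?_
    have h1 := hwl e
    have h2 : T.refine.len e * (a * (ε e + √(T.refine.len e) * K))
        ≤ L * (a * (ε e + √(T.refine.len e) * J)) := by
      have := hε e
      gcongr
      exact hle e
    obtain ⟨x, hx⟩ : ∃ x, x = √(T.refine.len e) * J := ⟨_, rfl⟩
    have hx0 : 0 ≤ x := hx ▸ mul_nonneg (hx0 e) hJ0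
    have p1 : 0 ≤ (2 + L * a + a) * (c1 * x) + 2 * x + a * x + x := by positivity
    have p2 : 0 ≤ (a + 1) * ε e := mul_nonneg (by positivity) (hε e)
    have e1 : √(T.refine.len e) * ((c1 + 1) * J) = (c1 + 1) * x := by rw [hx]; ring
    have e2 : √(T.refine.len e) * (c1 * J) = c1 * x := by rw [hx]; ring
    rw [e1, hb]
    rw [← hx] at h2
    rw [e2] at h1
    linarith
  have hU : ∀ v, ‖φ.U v - φh.U v‖ ≤ c3 * J := fun v => by
    -- The nodal bound is used with `(c1 + 1) * J` in the role of `K`, since the nodal rotation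
    -- error now belongs to the data.
    have h1 := hnode T ε η ((c1 + 1) * J) b hε hη (by positivity) hb0 hεη _ _
      (fun v => φ.U v - φh.U v) hUp (fun e => (hsrc e).2) (fun e => (htgt e).2) hdu
      (fun e => ?_) hmid.1 v
    · refine h1.trans ?_
      have h2 : T.refine.maxLen * η ≤ J := by linarith
      calc _ ≤ cn * (b * (J + (c1 + 1) * J)) := by gcongr
        _ = _ := by rw [hc3]; ring
    · refine (hgal e).2.2.trans ((mul_le_mul_of_nonneg_left (hwl e) (hx0 e)).trans ?_)
      have hℓ := (hlen e).le
      have hε' := hε e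
      calc _ = (√(T.refine.len e) * √(T.refine.len e)) * (c1 * J)
            + a * (T.refine.len e * (√(T.refine.len e) * ε e))
            + T.refine.len e * (a * ((√(T.refine.len e) * √(T.refine.len e)) * K)) := by ring
        _ = T.refine.len e * (c1 * J) + a * (T.refine.len e * (√(T.refine.len e) * ε e))
            + T.refine.len e * (a * (T.refine.len e * K)) := by rw [hxx]
        _ ≤ T.refine.len e * (c1 * J) + a * (T.refine.len e * (√(T.refine.len e) * ε e))
            + T.refine.len e * (a * (L * J)) := by
            have := hle e
            gcongr
        _ ≤ _ := by
            rw [hb]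
            have p1 : 0 ≤ (2 + L * a + 1) * (T.refine.len e * (√(T.refine.len e) * ε e)) := by
              positivity
            have p2 : 0 ≤ (2 + L * a + a) * (T.refine.len e * (c1 * J))
              + (2 + a + 1) * (T.refine.len e * J) := by positivity
            linarith
  have hul : ∀ e, l2norm (T.refine.len e) (fun s => φ.u e s - φh.u e s)
      ≤ (c3 + L * (b * (c1 + 2))) * (ε e + √(T.refine.len e) * J) := fun e => by
    refine ((hUp e).l2norm_le (hlen e).le).trans ?_
    rw [(hsrc e).2]
    have h1 := mul_le_mul_of_nonneg_left (hU (T.refine.src e)) (hx0 e)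
    have hε' := hε e
    have hℓ := (hlen e).le
    have h2 : T.refine.len e * l2norm (T.refine.len e) (fun s => φ.du e s - φh.du e s)
        ≤ L * (b * (ε e + √(T.refine.len e) * ((c1 + 1) * J))) :=
      mul_le_mul (hle e) (hdu e) (l2norm_nonneg _ _) hL0
    have p1 : 0 ≤ c3 * ε e + L * (b * ((c1 + 1) * ε e)) + L * (b * (√(T.refine.len e) * J)) := by
      positivity
    linarith
  have hdu' : ∀ e, l2norm (T.refine.len e) (fun s => φ.du e s - φh.du e s)
      ≤ b * (c1 + 2) * (ε e + √(T.refine.len e) * J) := fun e => by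
    refine (hdu e).trans ?_
    have hε' := hε e
    have p1 : 0 ≤ b * ((c1 + 1) * ε e) + b * (√(T.refine.len e) * J) := by positivity
    linarith
  rw [← hJ]
  have q1 : 0 ≤ (2 + 6 * L) := by positivity
  have q2 : 0 ≤ c1 + L * a := by positivity
  have q3 : 0 ≤ b * (c1 + 2) := by positivity
  have q4 : 0 ≤ L * (b * (c1 + 2)) := by positivity
  have q5 : 0 ≤ L * a := by positivity
  refine ⟨fun v => ⟨(hU v).trans ?_, (hW v).trans ?_⟩, fun e => ?_⟩
  · gcongr
    linarith
  · gcongr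
    linarith
  · have hζ : 0 ≤ ε e + √(T.refine.len e) * J := add_nonneg (hε e) (mul_nonneg (hx0 e) hJ0)
    have hKJ' : ε e + √(T.refine.len e) * K ≤ ε e + √(T.refine.len e) * J := by
      have := hx0 e
      gcongr
    refine ⟨(hcurv e).1.trans ?_, (hul e).trans ?_, (hdu' e).trans ?_, (hwl' e).trans ?_,
      (hdw e).trans ?_⟩
    · exact mul_le_mul (by linarith) hKJ' (add_nonneg (hε e) (mul_nonneg (hx0 e) hK)) (by positivity)
    · exact mul_le_mul_of_nonneg_right (by linarith) hζ
    · exact mul_le_mul_of_nonneg_right (by linarith) hζ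
    · exact mul_le_mul_of_nonneg_right (by linarith) hζ
    · exact mul_le_mul (by linarith) hKJ' (add_nonneg (hε e) (mul_nonneg (hx0 e) hK)) (by positivity)

end StrutNetwork

/-! ### ### Summation over the elements and conclusion -/

theorem integral_norm_sq_le {ℓ ζ : ℝ} {x : ℝ → R3} (hℓ : 0 ≤ ℓ) (h : l2norm ℓ x ≤ ζ) :
    ∫ s in (0 : ℝ)..ℓ, ‖x s‖ ^ 2 ≤ ζ ^ 2 := by
  rw [← sq_l2norm hℓ]
  exact pow_le_pow_left₀ (l2norm_nonneg _ _) h 2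

namespace StrutNetwork

variable {V E : Type*} {N : StrutNetwork V E}

/-- The weights √ℓ turn the contribution of J into the total length, so interior errors need no
count of elements. -/
theorem sum_sq_add_le [Fintype E] {ε : E → ℝ} {η : ℝ} (h : ∑ i, ε i ^ 2 ≤ η ^ 2) (c J : ℝ) :
    ∑ i, (c * (ε i + √(N.len i) * J)) ^ 2 ≤ c ^ 2 * (2 * η ^ 2 + 2 * N.totalLen * J ^ 2) := by
  calc _ ≤ ∑ i, c ^ 2 * (2 * ε i ^ 2 + N.len i * (2 * J ^ 2)) := by
        refine Finset.sum_le_sum fun i _ => ?_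
        rw [mul_pow]
        refine mul_le_mul_of_nonneg_left (add_sq_le.trans (le_of_eq ?_)) (sq_nonneg c)
        rw [mul_pow, Real.sq_sqrt (show 0 ≤ N.len i from dist_nonneg)]
        ring
    _ ≤ _ := by
        rw [← Finset.mul_sum, Finset.sum_add_distrib, ← Finset.mul_sum, ← Finset.sum_mul,
          ← totalLen]
        refine mul_le_mul_of_nonneg_left ?_ (sq_nonneg c)
        linarith

namespace Subdivision

variable (T : N.Subdivision)

theorem QuasiUniform.mono {σ σ' : ℝ} {T : N.Subdivision} (h : T.QuasiUniform σ) (hσ : σ ≤ σ') :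
    T.QuasiUniform σ' :=
  fun e e' => (h e e').trans (mul_le_mul_of_nonneg_right hσ dist_nonneg)

theorem maxLen_le [Fintype E] (hN : N.IsStent) : T.refine.maxLen ≤ N.totalLen := by
  have := hN.nonempty
  have : Nonempty (Σ i, Fin (T.m i + 1)) := ⟨⟨Classical.arbitrary E, 0⟩⟩
  refine ciSup_le fun e => ?_
  rw [← T.totalLen_refine hN.nondegenerate]
  exact len_le_totalLen e

/-- The number of elements of a quasi-uniform subdivision. -/
theorem card_mul_maxLen_le [Fintype E] (hN : N.IsStent) {σ : ℝ} (hT : T.QuasiUniform σ) :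
    (Fintype.card (Σ i, Fin (T.m i + 1)) : ℝ) * T.refine.maxLen ≤ σ * N.totalLen := by
  have := hN.nonempty
  have : Nonempty (Σ i, Fin (T.m i + 1)) := ⟨⟨Classical.arbitrary E, 0⟩⟩
  have h1 : ∀ e, T.refine.maxLen ≤ σ * T.refine.len e := fun e => ciSup_le fun e' => hT e' e
  have h2 := Finset.sum_le_sum fun e (_ : e ∈ Finset.univ) => h1 e
  rw [← Finset.mul_sum, ← totalLen, T.totalLen_refine hN.nondegenerate] at h2
  simpa using h2

theorem card_vertices_le [Fintype V] [Fintype E] :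
    Fintype.card (V ⊕ (Σ i, Fin (T.m i)))
      ≤ Fintype.card V + Fintype.card (Σ i, Fin (T.m i + 1)) := by
  rw [Fintype.card_sum, Fintype.card_sigma, Fintype.card_sigma]
  gcongr with i
  simp

end Subdivision

/-- End forces and moments enter unweighted, four vectors per element. Their contribution is the
number of elements times J², for which ν is a bound. -/
theorem normV_sub_le [Fintype E] (hN : N.IsStent) {T : N.Subdivision} {k : ℕ}
    {S Sh : ForceField (Σ i, Fin (T.m i + 1))} {ε : (Σ i, Fin (T.m i + 1)) → ℝ} {κ : E → R3 × R3}
    {z : (Σ i, Fin (T.m i + 1)) → ℝ → R3} (H : StressError T k S Sh ε κ z) {η J c ν : ℝ}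
    (hp : ∀ e, IsL2 (T.refine.len e) (S.p e))
    (hp' : ∀ e, IsL2 (T.refine.len e) (Sh.p e))
    (hεη : ∑ e, ε e ^ 2 ≤ η ^ 2) (hκ : ‖κ‖ ≤ J)
    (hq : ∀ e, l2norm (T.refine.len e) (fun s => S.q e s - Sh.q e s)
      ≤ c * (ε e + √(T.refine.len e) * J))
    (hν : (Fintype.card (Σ i, Fin (T.m i + 1)) : ℝ) * J ^ 2 ≤ ν) :
    T.refine.normV (S - Sh) ≤ √((c ^ 2 + 4) * (2 * η ^ 2 + 2 * N.totalLen * J ^ 2)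
      + 4 * (1 + N.totalLen) ^ 2 * ν) := by
  have hnd := hN.nondegenerate
  have hlen := T.refine_len_pos hnd
  have hJ0 : 0 ≤ J := (norm_nonneg κ).trans hκ
  have hL0 : 0 ≤ N.totalLen := totalLen_nonneg
  have hpl : ∀ e, l2norm (T.refine.len e) (fun s => S.p e s - Sh.p e s)
      ≤ 2 * (ε e + √(T.refine.len e) * J) := fun e => by
    have hℓ := (hlen e).le
    have h1 := l2norm_add_le hℓ (((hp e).sub (hp' e)).sub (isL2_const (κ e.1).1))
      (isL2_const (κ e.1).1)
    simp only [sub_add_cancel] at h1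
    rw [l2norm_const hℓ] at h1
    have h2 := H.p_le e
    have h3 : √(T.refine.len e) * ‖(κ e.1).1‖ ≤ √(T.refine.len e) * J := by
      gcongr
      exact ((norm_fst_le (κ e.1)).trans (norm_le_pi_norm κ e.1)).trans hκ
    have h4 : 0 ≤ √(T.refine.len e) * J := by positivity
    linarith
  have hmom : ∀ i x, 0 ≤ x → x ≤ N.len i → ‖N.momentAt κ i x‖ ≤ (1 + N.totalLen) * J :=
    fun i x h0 h1 => (norm_momentAt_le hnd κ i h0 (h1.trans (len_le_totalLen i))).trans
      (by gcongr)
  have hfor : ∀ i, ‖(κ i).1‖ ≤ (1 + N.totalLen) * J := fun i =>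
    ((norm_fst_le (κ i)).trans (norm_le_pi_norm κ i)).trans (hκ.trans (by nlinarith))
  have t1 : ∑ e, ∫ s in (0 : ℝ)..T.refine.len e, ‖(S - Sh).q e s‖ ^ 2
      ≤ c ^ 2 * (2 * η ^ 2 + 2 * N.totalLen * J ^ 2) := by
    rw [← T.totalLen_refine hnd]
    exact (Finset.sum_le_sum fun e _ => integral_norm_sq_le (hlen e).le (hq e)).trans
      (sum_sq_add_le hεη c J)
  have t2 : ∑ e, ∫ s in (0 : ℝ)..T.refine.len e, ‖(S - Sh).p e s‖ ^ 2
      ≤ 2 ^ 2 * (2 * η ^ 2 + 2 * N.totalLen * J ^ 2) := by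
    rw [← T.totalLen_refine hnd]
    exact (Finset.sum_le_sum fun e _ => integral_norm_sq_le (hlen e).le (hpl e)).trans
      (sum_sq_add_le hεη 2 J)
  have t3 : ∑ e, (‖(S - Sh).Pp e‖ ^ 2 + ‖(S - Sh).Pm e‖ ^ 2 + ‖(S - Sh).Qp e‖ ^ 2
      + ‖(S - Sh).Qm e‖ ^ 2) ≤ 4 * (1 + N.totalLen) ^ 2 * ν := by
    have h1 : ∀ e, ‖(S - Sh).Pp e‖ ^ 2 + ‖(S - Sh).Pm e‖ ^ 2 + ‖(S - Sh).Qp e‖ ^ 2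
        + ‖(S - Sh).Qm e‖ ^ 2 ≤ 4 * (1 + N.totalLen) ^ 2 * J ^ 2 := fun e => by
      have e1 : (S - Sh).Pp e = (κ e.1).1 := H.Pp_eq e
      have e2 : (S - Sh).Pm e = (κ e.1).1 := H.Pm_eq e
      have e3 : (S - Sh).Qp e = N.momentAt κ e.1 (T.start e + T.refine.len e) := H.Qp_eq e
      have e4 : (S - Sh).Qm e = N.momentAt κ e.1 (T.start e) := H.Qm_eq e
      have h2 := T.start_add_len_le hnd e
      have h3 := hmom e.1 _ (add_nonneg (T.start_nonneg e) (hlen e).le) h2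
      have h4 := hmom e.1 _ (T.start_nonneg e) (by linarith [hlen e])
      have h5 := hfor e.1
      rw [e1, e2, e3, e4]
      have s1 := pow_le_pow_left₀ (norm_nonneg _) h3 2
      have s2 := pow_le_pow_left₀ (norm_nonneg _) h4 2
      have s3 := pow_le_pow_left₀ (norm_nonneg _) h5 2
      rw [mul_pow] at s1 s2 s3
      linarith
    refine (Finset.sum_le_sum fun e _ => h1 e).trans ?_
    rw [Finset.sum_const, Finset.card_univ, nsmul_eq_mul]
    have h6 : 0 ≤ 4 * (1 + N.totalLen) ^ 2 := by positivity
    have h7 := mul_le_mul_of_nonneg_left hν h6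
    linarith
  have t4 : ‖(S - Sh).α‖ ^ 2 = 0 := by
    have : (S - Sh).α = 0 := sub_eq_zero.2 H.α_eq
    simp [this]
  have t5 : ‖(S - Sh).β‖ ^ 2 = 0 := by
    have : (S - Sh).β = 0 := sub_eq_zero.2 H.β_eq
    simp [this]
  refine Real.sqrt_le_sqrt ?_
  rw [t4, t5]
  linarith

/-- The unweighted vertex values again cost J² per vertex, and the number of vertices is at most
that of the original vertices plus that of the elements. -/
theorem normM_sub_le [Fintype V] [Fintype E] (hN : N.IsStent) {T : N.Subdivision}
    {φ φh : MotionField (V ⊕ (Σ i, Fin (T.m i))) (Σ i, Fin (T.m i + 1))}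
    (hφ : T.refine.MemM φ) (hφh : T.refine.MemM φh) {ε : (Σ i, Fin (T.m i + 1)) → ℝ}
    {η J c ν : ℝ} (hεη : ∑ e, ε e ^ 2 ≤ η ^ 2)
    (hv : ∀ v, ‖φ.U v - φh.U v‖ ≤ c * J ∧ ‖φ.W v - φh.W v‖ ≤ c * J)
    (he : ∀ e, l2norm (T.refine.len e) (fun s => φ.u e s - φh.u e s)
        ≤ c * (ε e + √(T.refine.len e) * J) ∧
      l2norm (T.refine.len e) (fun s => φ.du e s - φh.du e s)
        ≤ c * (ε e + √(T.refine.len e) * J) ∧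
      l2norm (T.refine.len e) (fun s => φ.w e s - φh.w e s)
        ≤ c * (ε e + √(T.refine.len e) * J) ∧
      l2norm (T.refine.len e) (fun s => φ.dw e s - φh.dw e s)
        ≤ c * (ε e + √(T.refine.len e) * J))
    (hν : (Fintype.card (Σ i, Fin (T.m i + 1)) : ℝ) * J ^ 2 ≤ ν) :
    T.refine.normM (φ - φh) ≤ √(4 * c ^ 2 * (2 * η ^ 2 + 2 * N.totalLen * J ^ 2)
      + 2 * c ^ 2 * (Fintype.card V * J ^ 2 + ν)) := by
  have hnd := hN.nondegenerate
  have hlen := T.refine_len_pos hnd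
  have key : ∀ {x dx : (Σ i, Fin (T.m i + 1)) → ℝ → R3},
      (∀ e, IsL2 (T.refine.len e) (x e)) → (∀ e, IsL2 (T.refine.len e) (dx e)) →
      (∀ e, l2norm (T.refine.len e) (x e) ≤ c * (ε e + √(T.refine.len e) * J)) →
      (∀ e, l2norm (T.refine.len e) (dx e) ≤ c * (ε e + √(T.refine.len e) * J)) →
      ∑ e, ∫ s in (0 : ℝ)..T.refine.len e, (‖x e s‖ ^ 2 + ‖dx e s‖ ^ 2)
        ≤ 2 * (c ^ 2 * (2 * η ^ 2 + 2 * N.totalLen * J ^ 2)) := by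
    intro x dx hx hdx h1 h2
    have h3 : ∀ e, ∫ s in (0 : ℝ)..T.refine.len e, (‖x e s‖ ^ 2 + ‖dx e s‖ ^ 2)
        ≤ 2 * (c * (ε e + √(T.refine.len e) * J)) ^ 2 := fun e => by
      have hℓ := (hlen e).le
      rw [intervalIntegral.integral_add ((hx e).intervalIntegrable_sq hℓ)
        ((hdx e).intervalIntegrable_sq hℓ)]
      linarith [integral_norm_sq_le hℓ (h1 e), integral_norm_sq_le hℓ (h2 e)]
    refine (Finset.sum_le_sum fun e _ => h3 e).trans ?_
    rw [← Finset.mul_sum, ← T.totalLen_refine hnd]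
    exact mul_le_mul_of_nonneg_left (sum_sq_add_le hεη c J) zero_le_two
  have t1 := key (x := (φ - φh).u) (dx := (φ - φh).du)
    (fun e => (isL2_of_continuousOn (hφ.u_mem e).cont).sub
      (isL2_of_continuousOn (hφh.u_mem e).cont))
    (fun e => (hφ.u_mem e).deriv_mem.sub (hφh.u_mem e).deriv_mem)
    (fun e => (he e).1) (fun e => (he e).2.1)
  have t2 := key (x := (φ - φh).w) (dx := (φ - φh).dw)
    (fun e => (isL2_of_continuousOn (hφ.w_mem e).cont).sub
      (isL2_of_continuousOn (hφh.w_mem e).cont))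
    (fun e => (hφ.w_mem e).deriv_mem.sub (hφh.w_mem e).deriv_mem)
    (fun e => (he e).2.2.1) (fun e => (he e).2.2.2)
  have t3 : ∑ v, (‖(φ - φh).U v‖ ^ 2 + ‖(φ - φh).W v‖ ^ 2)
      ≤ 2 * c ^ 2 * (Fintype.card V * J ^ 2 + ν) := by
    have h1 : ∀ v, ‖(φ - φh).U v‖ ^ 2 + ‖(φ - φh).W v‖ ^ 2 ≤ 2 * c ^ 2 * J ^ 2 := fun v => by
      have s1 := pow_le_pow_left₀ (norm_nonneg _) (hv v).1 2
      have s2 := pow_le_pow_left₀ (norm_nonneg _) (hv v).2 2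
      rw [mul_pow] at s1 s2
      change ‖φ.U v - φh.U v‖ ^ 2 + ‖φ.W v - φh.W v‖ ^ 2 ≤ _
      linarith
    refine (Finset.sum_le_sum fun v _ => h1 v).trans ?_
    rw [Finset.sum_const, Finset.card_univ, nsmul_eq_mul]
    have h2 : (Fintype.card (V ⊕ (Σ i, Fin (T.m i))) : ℝ)
        ≤ Fintype.card V + Fintype.card (Σ i, Fin (T.m i + 1)) := by
      exact_mod_cast T.card_vertices_le
    have h3 : 0 ≤ 2 * c ^ 2 * J ^ 2 := by positivity
    have h4 := mul_le_mul_of_nonneg_right h2 h3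
    have h5 := mul_le_mul_of_nonneg_left hν (show 0 ≤ 2 * c ^ 2 by positivity)
    linarith
  refine Real.sqrt_le_sqrt ?_
  linarith

end StrutNetwork

end

theorem theorem4p6 {V E : Type*} [Fintype V] [Fintype E] (N : StrutNetwork V E)
    (hN : N.IsStent) (hgeo : N.NoAxialSelfStress) (k n : ℕ) (hn : n = k + 1) (r : ℕ) (σ : ℝ) :
    ∃ c : ℝ, 0 < c ∧
      ∀ T : N.Subdivision, T.QuasiUniform σ → (k = 0 → T.refine.DiscreteUnique k n) →
        ∀ f D, T.refine.IsLoad r f D →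
          ∀ S φ, T.refine.Solves f S φ →
            ∀ Sh φh, T.refine.SolvesDiscrete k n f Sh φh →
              T.refine.normV (S - Sh) + T.refine.normM (φ - φh)
                ≤ c * T.refine.maxLen ^ min (r + 1) (k + 1) * T.refine.normHr r D := by
  subst hn
  -- The constants are taken for a positive ratio; a larger ratio only admits more subdivisions.
  have hσ' : 0 < max σ 1 := lt_max_of_lt_right one_pos
  obtain ⟨ca, hca, happ⟩ := StrutNetwork.exists_approximation hN hgeo hσ' k r
  obtain ⟨cκ, hcκ, hstress⟩ := StrutNetwork.exists_stress_estimate hN hgeo hσ'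
  obtain ⟨c, hc, hmotion⟩ := StrutNetwork.exists_motion_estimate hN
  obtain ⟨L, hL⟩ : ∃ L, L = N.totalLen := ⟨_, rfl⟩
  have hL0 : 0 ≤ L := hL ▸ StrutNetwork.totalLen_nonneg
  -- constants in the bounds of `J`, of the number of elements, and of the two norms
  obtain ⟨b, hb⟩ : ∃ b, b = (1 + cκ) * L := ⟨_, rfl⟩
  obtain ⟨ν, hν⟩ : ∃ ν, ν = (1 + cκ) ^ 2 * (max σ 1 * L * L) := ⟨_, rfl⟩
  have hb0 : 0 ≤ b := by rw [hb]; positivity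
  have hν0 : 0 ≤ ν := by rw [hν]; positivity
  obtain ⟨A, hA⟩ : ∃ A, A = (c ^ 2 + 4) * (2 + 2 * L * b ^ 2) + 4 * (1 + L) ^ 2 * ν := ⟨_, rfl⟩
  obtain ⟨B, hB⟩ : ∃ B, B = 4 * c ^ 2 * (2 + 2 * L * b ^ 2)
    + 2 * c ^ 2 * (Fintype.card V * b ^ 2 + ν) := ⟨_, rfl⟩
  refine ⟨(√A + √B) * ca + 1, by positivity, fun T hT hu f D hf S φ h Sh φh hh => ?_⟩
  replace hT := hT.mono (le_max_left σ 1)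
  have hfL2 : ∀ e, IsL2 (T.refine.len e) (f e) := fun e => by
    have := (hf e).mem 0 (Nat.zero_le r)
    rwa [(hf e).zero] at this
  obtain ⟨ε, hε, hεη, happ⟩ := happ T hT f D hf S φ h
  have hh0 : 0 ≤ T.refine.maxLen := StrutNetwork.maxLen_nonneg
  have hF0 : 0 ≤ T.refine.normHr r D := Real.sqrt_nonneg _
  obtain ⟨η, hη⟩ : ∃ η, η = ca * T.refine.maxLen ^ min (r + 1) (k + 1) * T.refine.normHr r D :=
    ⟨_, rfl⟩
  have hη0 : 0 ≤ η := by rw [hη]; positivity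
  rw [← hη] at hεη
  obtain ⟨κ, z, H, hκ⟩ := hstress k T hT hu f hfL2 S φ Sh φh h hh ε η hε hη0 hεη
    (fun e => (happ e).1) (fun e => (happ e).2.1) fun e => (happ e).2.2.1
  obtain ⟨hv, he⟩ := hmotion k T f S Sh φ φh h hh ε η _ κ z hε hη0 hκ hεη H
    (fun e => (happ e).2.2.1) fun e => (happ e).2.2.2
  obtain ⟨J, hJ⟩ : ∃ J, J = T.refine.maxLen * η + cκ * (T.refine.maxLen * η) := ⟨_, rfl⟩
  simp only [← hJ] at hv he
  have hJ0 : 0 ≤ J := by rw [hJ]; positivity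
  have hJ1 : J = (1 + cκ) * (T.refine.maxLen * η) := by rw [hJ]; ring
  have hκJ : ‖κ‖ ≤ J := hκ.trans (by rw [hJ]; have := mul_nonneg hh0 hη0; linarith)
  have hmax : T.refine.maxLen ≤ L := hL ▸ T.maxLen_le hN
  have hJb : J ≤ b * η := by
    rw [hJ1, hb, mul_assoc]
    gcongr
  have hJb2 : J ^ 2 ≤ b ^ 2 * η ^ 2 := by
    rw [← mul_pow]
    exact pow_le_pow_left₀ hJ0 hJb 2
  -- J² contains h² η². One factor h compensates the number of elements by quasi-uniformity, and the
  -- other is bounded by the total length.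
  have hcard : (Fintype.card (Σ i, Fin (T.m i + 1)) : ℝ) * J ^ 2 ≤ ν * η ^ 2 := by
    have h1 := T.card_mul_maxLen_le hN hT
    rw [← hL] at h1
    calc _ = (1 + cκ) ^ 2 * (((Fintype.card (Σ i, Fin (T.m i + 1)) : ℝ) * T.refine.maxLen)
          * T.refine.maxLen) * η ^ 2 := by rw [hJ1]; ring
      _ ≤ (1 + cκ) ^ 2 * ((max σ 1 * L) * L) * η ^ 2 := by gcongr
      _ = _ := by rw [hν]
  have hV : T.refine.normV (S - Sh) ≤ √A * η := by
    refine (StrutNetwork.normV_sub_le hN H h.mem_V.p_mem hh.mem_V.mem.p_mem hεη hκJ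
      (fun e => (he e).1) hcard).trans ?_
    rw [← Real.sqrt_sq hη0, ← Real.sqrt_mul' _ (sq_nonneg η)]
    refine Real.sqrt_le_sqrt ?_
    rw [Real.sqrt_sq hη0, ← hL]
    calc _ ≤ (c ^ 2 + 4) * (2 * η ^ 2 + 2 * L * (b ^ 2 * η ^ 2))
          + 4 * (1 + L) ^ 2 * (ν * η ^ 2) := by gcongr
      _ = _ := by rw [hA]; ring
  have hM : T.refine.normM (φ - φh) ≤ √B * η := by
    refine (StrutNetwork.normM_sub_le hN h.mem_M hh.mem_M.mem hεη hv
      (fun e => (he e).2) hcard).trans ?_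
    rw [← Real.sqrt_sq hη0, ← Real.sqrt_mul' _ (sq_nonneg η)]
    refine Real.sqrt_le_sqrt ?_
    rw [Real.sqrt_sq hη0, ← hL]
    calc _ ≤ 4 * c ^ 2 * (2 * η ^ 2 + 2 * L * (b ^ 2 * η ^ 2))
          + 2 * c ^ 2 * (Fintype.card V * (b ^ 2 * η ^ 2) + ν * η ^ 2) := by gcongr
      _ = _ := by rw [hB]; ring
  have hlast : 0 ≤ T.refine.maxLen ^ min (r + 1) (k + 1) * T.refine.normHr r D := by positivity
  calc _ ≤ √A * η + √B * η := add_le_add hV hM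
    _ = (√A + √B) * ca * (T.refine.maxLen ^ min (r + 1) (k + 1) * T.refine.normHr r D) := by
        rw [hη]; ring
    _ ≤ _ := by rw [mul_assoc _ (T.refine.maxLen ^ _)]; gcongr; linarith
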